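/- **Theorem 1.2.** Let $n\ge 3$, let $g:\mathbb R^n\to\mathbb R^n$ be quadratic (each component is a homogeneous quadratic form) and let $i\in\{1,\dots,n\}$ be fixed. For $f\in C^\infty_{per}(\mathbb R^n)$, the smooth vector fields $f:\mathbb R^n\to\mathbb R^n$ that are $2\pi$-periodic in each variable, consider $$u_t=\Delta u+D_i\,\mathbb P g(u),\quad x\in\mathbb R^n,\ t>0,\qquad u(x,0)=f(x),$$ where $\mathbb P=(\mathbb P_{kl})$, $\mathbb P_{kl}=\delta_{kl}+R_kR_l$, is the Leray projector and $R_k=(-\Delta)^{-1/2}D_k$ is the $k$-th Riesz transform, i.e. the operator on periodic functions with Fourier symbol $i\xi_k/|\xi|$ for $\xi\in\mathbb Z^n\setminus\{0\}$ (with $i$ the imaginary unit here) and $0$ for $\xi=0$. Solutions are smooth on $\mathbb R^n\times[0,T)$ and $2\pi$-periodic in each space variable, and $T(f)\in[0,\infty]$ denotes the supremum of all $T$ such that a solution exists for $0\le t<T$. Put $|h|_\infty=\sup_x|h(x)|$ with the Euclidean norm $|\cdot|$ and $|\mathcal D^jh|_\infty=\max_{|\alpha|=j}|D^\alpha h|_\infty$.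 (a) There is a constant $c_0>0$ such that for every $f\in C^\infty_{per}(\mathbb R^n)$, $f\not\equiv0$, $$T(f)>\frac{c_0}{|f|_\infty^2},$$ and every solution $u$, on any interval $0\le t<T$ ($0<T\le\infty$) on which it exists, satisfies $$|u(t)|_\infty\le 2|f|_\infty\quad\text{for } 0\le t\le \frac{c_0}{|f|_\infty^2},\ t<T.$$ (b) With the same $c_0$, for every $j=1,2,\dots$ there is a constant $K_j>0$ such that for every $f\in C^\infty_{per}(\mathbb R^n)$, $f\not\equiv0$, every such solution satisfies $$t^{j/2}\,|\mathcal D^ju(t)|_\infty\le K_j|f|_\infty\quad\text{for } 0<t\le \frac{c_0}{|f|_\infty^2},\ t<T.$$ The constants $c_0$ and $K_j$ do not depend on $t$ or $f$ (nor on $u$ or $T$). -/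

import Mathlib

open Set MeasureTheory
open scoped ContDiff

noncomputable section

namespace PeriodicModel

/-- `ℝⁿ` with its Euclidean norm. -/
abbrev Rn (n : ℕ) : Type := EuclideanSpace ℝ (Fin n)

/-- `h` is `2π`-periodic in each of the variables `x₁, …, xₙ`. -/
def IsPeriodic {n : ℕ} {F : Type*} (h : Rn n → F) : Prop :=
  ∀ (k : Fin n) (x : Rn n), h (x + EuclideanSpace.single k (2 * Real.pi)) = h x

/-- The space `C^∞_per(ℝⁿ)` of smooth `2π`-periodic vector fields. -/
def SmoothPeriodic {n : ℕ} (h : Rn n → Rn n) : Prop :=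
  ContDiff ℝ ∞ h ∧ IsPeriodic h

/-- The maximum norm `|h|_∞ = sup_x |h(x)|`, with `|·|` the Euclidean norm. -/
def maxNorm {n : ℕ} (h : Rn n → Rn n) : ℝ := ⨆ x, ‖h x‖

/-- The partial derivative `D_k = ∂/∂x_k`. -/
def partialD {n : ℕ} (k : Fin n) (h : Rn n → Rn n) : Rn n → Rn n :=
  fun x => fderiv ℝ h x (EuclideanSpace.single k 1)

/-- `D^α = D_1^{α_1} ⋯ D_n^{α_n}` for a multiindex `α`. -/
def multiD {n : ℕ} (α : Fin n → ℕ) (h : Rn n → Rn n) : Rn n → Rn n :=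
  (List.finRange n).foldr (fun k w => (partialD k)^[α k] w) h

/-- `|𝒟^j h|_∞ = max_{|α| = j} |D^α h|_∞`. -/
def derivMaxNorm {n : ℕ} (j : ℕ) (h : Rn n → Rn n) : ℝ :=
  ⨆ α : {α : Fin n → ℕ // ∑ k, α k = j}, maxNorm (multiD α.1 h)

/-- The character `x ↦ e^{i ξ·x}` for a frequency `ξ ∈ ℤⁿ`. -/
def character {n : ℕ} (ξ : Fin n → ℤ) (x : Rn n) : ℂ :=
  Complex.exp (Complex.I * ((∑ k, (ξ k : ℝ) * x k : ℝ) : ℂ))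

/-- The Fourier coefficient `(2π)^{-n} ∫_{[0,2π]^n} φ(x) e^{-i ξ·x} dx`. -/
def fourierCoefficient {n : ℕ} (φ : Rn n → ℂ) (ξ : Fin n → ℤ) : ℂ :=
  (((2 * Real.pi) ^ n)⁻¹ : ℝ) *
    ∫ x in {x : Rn n | ∀ k, x k ∈ Icc 0 (2 * Real.pi)}, φ x * character (-ξ) x

/-- The Fourier symbol `i ξ_k / |ξ|` of the Riesz transform `R_k = (-Δ)^{-1/2} D_k`; it is `0` at
`ξ = 0`. -/
def rieszSymbol {n : ℕ} (k : Fin n) (ξ : Fin n → ℤ) : ℂ :=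
  if ξ = 0 then 0 else Complex.I * (ξ k : ℂ) / (Real.sqrt (∑ l, (ξ l : ℝ) ^ 2) : ℂ)

/-- The `k`-th Riesz transform `R_k = (-Δ)^{-1/2} D_k` on smooth periodic functions, as a Fourier
series (which converges absolutely for smooth `φ`). -/
def riesz {n : ℕ} (k : Fin n) (φ : Rn n → ℂ) : Rn n → ℂ :=
  fun x => ∑' ξ : Fin n → ℤ, rieszSymbol k ξ * fourierCoefficient φ ξ * character ξ x

/-- The Leray projector `ℙ = (ℙ_{kl})`, `ℙ_{kl} = δ_{kl} + R_k R_l`, on smooth periodic real vector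
fields (`R_k R_l` maps real functions to real functions, so that the real part is just the passage
from `ℂ` back to `ℝ`). -/
def leray {n : ℕ} (h : Rn n → Rn n) : Rn n → Rn n :=
  fun x => WithLp.toLp 2 fun k =>
    h x k + ∑ l, (riesz k (riesz l fun y => ((h y l : ℝ) : ℂ)) x).re

/-- The time interval `0 ≤ t < T`, where `T = ∞` is allowed. -/
def timeInterval (T : EReal) : Set ℝ := {t : ℝ | 0 ≤ t ∧ (t : EReal) < T}

/-- `u` (with `u t x` for `u(x,t)`) is a smooth, spatially `2π`-periodic solution of
`u_t = Δu + D_i ℙ g(u)`, `u(x,0) = f(x)`, in the time interval `0 ≤ t < T`. -/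
structure IsSolution {n : ℕ} (g : QuadraticMap ℝ (Rn n) (Rn n)) (i : Fin n) (f : Rn n → Rn n)
    (T : EReal) (u : ℝ → Rn n → Rn n) : Prop where
  smooth : ContDiffOn ℝ ∞ (fun p : ℝ × Rn n => u p.1 p.2) (timeInterval T ×ˢ univ)
  periodic : ∀ t ∈ timeInterval T, IsPeriodic (u t)
  initial : u 0 = f
  equation : ∀ t ∈ timeInterval T, 0 < t → ∀ x,
    HasDerivAt (fun s => u s x)
      (Laplacian.laplacian (u t) x + partialD i (leray fun y => g (u t y)) x) t

/-- `T(f) ∈ [0,∞]`, the end of the maximal interval of existence: the supremum of all `T` such that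
a smooth periodic solution exists for `0 ≤ t < T`. -/
def lifespan {n : ℕ} (g : QuadraticMap ℝ (Rn n) (Rn n)) (i : Fin n) (f : Rn n → Rn n) : EReal :=
  sSup {T : EReal | ∃ u, IsSolution g i f T u}

end PeriodicModel

end

/-!
The equation is solved on the side of the Fourier coefficients. A smooth periodic vector field is
the same as a lattice sequence that decays faster than every power of the frequency, and for the
coefficients `a t ξ` of a solution the equation is the system of ordinary differential equations
`a' = -|ξ|² a + i ξ_i ℙ_ξ (a * a)_ξ` (`IsMild`), in which `ℙ_ξ` is a matrix and `a * a` is a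
convolution taken with the complex bilinear extension of `g`. The lemmas `IsSolution.isMild` and
`IsMild.isSolution` translate between the two formulations.

Duhamel's formula and the bound `t^{-1/2}` for the norm of `D_i ℙ e^{tΔ}` on bounded functions
(`norm_synth_lerayDeriv_heat_le`) give the estimates. That bound holds although `ℙ` itself is
unbounded in the maximum norm: since `1/|ξ|² = ∫_0^∞ e^{-s|ξ|²} ds`, the operator `R_k R_l e^{tΔ}`
is an integral of second derivatives of the heat semigroup, and one derivative more makes this
integral converge. Each operator `D_k e^{tΔ}` is in turn an average of translations with an integrable
weight built from a Gaussian density, so it is bounded in the maximum norm.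

* At the first time at which `|u|` reaches `2|f|_∞`, Duhamel's formula yields `√t |f|_∞ > c` with a
  constant `c > 0` (`IsMild.norm_synth_le`); hence `c₀ = c²`.
* For the derivatives of order `j`, Duhamel's formula is restarted at a fixed fraction of the time
  `t`. Leibniz' rule leaves a term with the derivative of order `j` of `u` itself; its coefficient is
  small, so it is absorbed into the left-hand side after taking the supremum of
  `t^{j/2} |D^j u(t)|_∞` over time. The other terms are known by induction
  (`exists_weighted_bound`).
* A solution exists on a time interval that depends only on the sum of the Fourier coefficients of
  the initial value (`exists_isMild`), by contraction on sequences of continuous paths. Away from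
  `t = 0`, the bounds for the derivatives of order `n + 1` control this sum uniformly, so the solution
  can be continued by steps of a fixed length until it passes the time `c₀/|f|_∞²`
  (`exists_isMild_lt`).
* Joint smoothness in space and time follows since the system of differential equations expresses
  every time derivative of the coefficients through rapidly decaying sequences
  (`IsMild.smoothPath`, `SmoothPath.contDiffOn`).
-/

noncomputable section

namespace PeriodicModel

/-! ### Lattice sequences and Fourier synthesis -/

/-- The lattice `ℤⁿ` of frequencies. -/
abbrev Freq (n : ℕ) : Type := Fin n → ℤ

/-- The complexification `ℂⁿ` of `ℝⁿ`, with its Hermitian norm. -/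
abbrev Cn (n : ℕ) : Type := EuclideanSpace ℂ (Fin n)

/-- The square `|ξ|²` of the Euclidean length of a frequency; `‖ξ‖` is its maximum norm. -/
def lenSq {n : ℕ} (ξ : Freq n) : ℝ := ∑ l, (ξ l : ℝ) ^ 2

/-- The sum of the Fourier series with coefficients `b`. -/
def synth {n : ℕ} {F : Type*} [NormedAddCommGroup F] [NormedSpace ℂ F] (b : Freq n → F)
    (x : Rn n) : F := ∑' ξ, character ξ x • b ξ

/-- A family of lattice sequences decays faster than every power of `ξ`, uniformly for parameters
in `S`. -/
def RapidOn {n : ℕ} {F T : Type*} [NormedAddCommGroup F] (S : Set T) (a : T → Freq n → F) : Prop :=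
  ∀ s : ℕ, ∃ M, ∀ t ∈ S, ∀ ξ, (1 + ‖ξ‖) ^ s * ‖a t ξ‖ ≤ M

/-- A lattice sequence decays faster than every power of `ξ`. -/
def Rapid {n : ℕ} {F : Type*} [NormedAddCommGroup F] (b : Freq n → F) : Prop :=
  ∀ s : ℕ, ∃ M, ∀ ξ, (1 + ‖ξ‖) ^ s * ‖b ξ‖ ≤ M

variable {n : ℕ} {F : Type*} [NormedAddCommGroup F] {T : Type*}

lemma abs_le_norm (ξ : Freq n) (k : Fin n) : |(ξ k : ℝ)| ≤ ‖ξ‖ := by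
  have := norm_le_pi_norm ξ k
  rwa [Int.norm_eq_abs] at this

lemma lenSq_nonneg (ξ : Freq n) : 0 ≤ lenSq ξ := Finset.sum_nonneg fun _ _ => sq_nonneg _

lemma sq_le_lenSq (ξ : Freq n) (k : Fin n) : (ξ k : ℝ) ^ 2 ≤ lenSq ξ :=
  Finset.single_le_sum (f := fun l => (ξ l : ℝ) ^ 2) (fun _ _ => sq_nonneg _) (Finset.mem_univ k)

lemma lenSq_le (ξ : Freq n) : lenSq ξ ≤ n * ‖ξ‖ ^ 2 := by
  have : ∀ l ∈ Finset.univ, (ξ l : ℝ) ^ 2 ≤ ‖ξ‖ ^ 2 := fun l _ => by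
    rw [← sq_abs]
    exact pow_le_pow_left₀ (abs_nonneg _) (abs_le_norm ξ l) 2
  simpa [lenSq] using Finset.sum_le_card_nsmul _ _ _ this

lemma lenSq_neg (ξ : Freq n) : lenSq (-ξ) = lenSq ξ := by simp [lenSq]

lemma lenSq_eq_zero {ξ : Freq n} : lenSq ξ = 0 ↔ ξ = 0 := by
  rw [lenSq, Finset.sum_eq_zero_iff_of_nonneg fun _ _ => sq_nonneg _]
  simp [funext_iff]

lemma summable_weight (n : ℕ) : Summable fun ξ : Freq n => ((1 + ‖ξ‖) ^ (n + 1))⁻¹ := by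
  classical
  let L : Submodule ℤ (Fin n → ℝ) := Submodule.span ℤ (range (Pi.basisFun ℝ (Fin n)))
  have hr : Module.finrank ℤ L < n + 1 := by
    have : Module.finrank ℤ L = Module.finrank ℝ (Fin n → ℝ) := ZLattice.rank ℝ L
    simp [this]
  have h := ZLattice.summable_norm_pow_inv L (n + 1) hr
  let e : Freq n → L := fun ξ => ⟨fun k => (ξ k : ℝ), by
    have : (fun k => (ξ k : ℝ)) = ∑ k, ξ k • (Pi.basisFun ℝ (Fin n)) k := by
      ext l
      simp [Finset.sum_apply, Pi.single_apply]
    rw [this]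
    exact Submodule.sum_mem _ fun k _ => Submodule.smul_mem _ _ (Submodule.subset_span ⟨k, rfl⟩)⟩
  have he : Function.Injective e := fun ξ η hξ => by
    ext k
    have := congrFun (Subtype.ext_iff.1 hξ) k
    exact Int.cast_injective (α := ℝ) this
  have hn : ∀ ξ, ‖e ξ‖ = ‖ξ‖ := fun ξ => by
    simp only [e, Submodule.coe_norm, Pi.norm_def]
    congr 2
  refine .of_norm_bounded_eventually (h.comp_injective he) ?_
  refine (Set.finite_singleton (0 : Freq n)).subset fun ξ hξ => ?_
  by_contra h0
  refine hξ ?_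
  have hp : 0 < ‖ξ‖ := norm_pos_iff.2 h0
  change ‖((1 + ‖ξ‖) ^ (n + 1))⁻¹‖ ≤ ‖e ξ‖⁻¹ ^ (n + 1)
  rw [hn, Real.norm_of_nonneg (by positivity), inv_pow]
  gcongr
  linarith

section Rapid

lemma RapidOn.rapid {S : Set T} {a : T → Freq n → F} (h : RapidOn S a) {t : T} (ht : t ∈ S) :
    Rapid (a t) := fun s => (h s).imp fun _ hM => hM t ht

lemma rapidOn_unit {b : Freq n → F} : RapidOn (univ : Set Unit) (fun _ => b) ↔ Rapid b := by
  simp [RapidOn, Rapid]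

lemma Rapid.rapidOn {b : Freq n → F} (h : Rapid b) (S : Set T) : RapidOn S (fun _ => b) :=
  fun s => (h s).imp fun _ hM _ _ => hM

lemma RapidOn.of_le {F' : Type*} [NormedAddCommGroup F'] {S : Set T} {a : T → Freq n → F}
    (h : RapidOn S a) {b : T → Freq n → F'} (C : ℝ) (p : ℕ)
    (hb : ∀ t ∈ S, ∀ ξ, ‖b t ξ‖ ≤ C * (1 + ‖ξ‖) ^ p * ‖a t ξ‖) : RapidOn S b := by
  intro s
  obtain ⟨M, hM⟩ := h (p + s)
  refine ⟨|C| * M, fun t ht ξ => ?_⟩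
  calc (1 + ‖ξ‖) ^ s * ‖b t ξ‖ ≤ (1 + ‖ξ‖) ^ s * (|C| * (1 + ‖ξ‖) ^ p * ‖a t ξ‖) := by
        gcongr
        refine (hb t ht ξ).trans ?_
        gcongr
        exact le_abs_self C
    _ = |C| * ((1 + ‖ξ‖) ^ (p + s) * ‖a t ξ‖) := by ring
    _ ≤ |C| * M := by
        gcongr
        exact hM t ht ξ

lemma Rapid.of_le {F' : Type*} [NormedAddCommGroup F'] {a : Freq n → F} (h : Rapid a)
    {b : Freq n → F'} (C : ℝ) (p : ℕ) (hb : ∀ ξ, ‖b ξ‖ ≤ C * (1 + ‖ξ‖) ^ p * ‖a ξ‖) : Rapid b :=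
  rapidOn_unit.1 <| (rapidOn_unit.2 h).of_le C p fun _ _ => hb

lemma RapidOn.add {S : Set T} {a b : T → Freq n → F} (ha : RapidOn S a) (hb : RapidOn S b) :
    RapidOn S (fun t ξ => a t ξ + b t ξ) := by
  intro s
  obtain ⟨M, hM⟩ := ha s
  obtain ⟨M', hM'⟩ := hb s
  refine ⟨M + M', fun t ht ξ => ?_⟩
  calc (1 + ‖ξ‖) ^ s * ‖a t ξ + b t ξ‖ ≤ (1 + ‖ξ‖) ^ s * (‖a t ξ‖ + ‖b t ξ‖) := by
        gcongr
        exact norm_add_le _ _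
    _ ≤ M + M' := by linarith [hM t ht ξ, hM' t ht ξ]

lemma RapidOn.exists_summable {S : Set T} {a : T → Freq n → F} (h : RapidOn S a) (s : ℕ) :
    ∃ u : Freq n → ℝ, Summable u ∧ (∀ ξ, 0 ≤ u ξ) ∧
      ∀ t ∈ S, ∀ ξ, (1 + ‖ξ‖) ^ s * ‖a t ξ‖ ≤ u ξ := by
  obtain ⟨M, hM⟩ := h (s + (n + 1))
  refine ⟨fun ξ => |M| * ((1 + ‖ξ‖) ^ (n + 1))⁻¹, (summable_weight n).mul_left _,
    fun ξ => by positivity, fun t ht ξ => ?_⟩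
  beta_reduce
  rw [← div_eq_mul_inv, le_div_iff₀ (by positivity)]
  calc _ = (1 + ‖ξ‖) ^ (s + (n + 1)) * ‖a t ξ‖ := by ring
    _ ≤ |M| := (hM t ht ξ).trans (le_abs_self M)

lemma RapidOn.exists_summable_norm {S : Set T} {a : T → Freq n → F} (h : RapidOn S a) :
    ∃ u : Freq n → ℝ, Summable u ∧ (∀ ξ, 0 ≤ u ξ) ∧ ∀ t ∈ S, ∀ ξ, ‖a t ξ‖ ≤ u ξ := by
  simpa using h.exists_summable 0

lemma Rapid.summable_norm {b : Freq n → F} (h : Rapid b) : Summable fun ξ => ‖b ξ‖ := by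
  obtain ⟨u, hu, -, hb⟩ := (rapidOn_unit.2 h).exists_summable_norm
  exact .of_nonneg_of_le (fun _ => norm_nonneg _) (hb () trivial) hu

end Rapid

variable [NormedSpace ℂ F]

section Character

lemma norm_character (ξ : Freq n) (x : Rn n) : ‖character ξ x‖ = 1 := by
  rw [character, mul_comm, Complex.norm_exp_ofReal_mul_I]

lemma character_add (ξ η : Freq n) (x : Rn n) :
    character (ξ + η) x = character ξ x * character η x := by
  simp only [character, ← Complex.exp_add, ← mul_add, ← Complex.ofReal_add, ← Finset.sum_add_distrib,
    Pi.add_apply, Int.cast_add, add_mul]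

lemma character_add_right (ξ : Freq n) (x y : Rn n) :
    character ξ (x + y) = character ξ x * character ξ y := by
  simp only [character, ← Complex.exp_add, PiLp.add_apply, mul_add, Finset.sum_add_distrib,
    Complex.ofReal_add]

lemma character_single (ξ : Freq n) (k : Fin n) (r : ℝ) :
    character ξ (EuclideanSpace.single k r) = Complex.exp (Complex.I * ((ξ k * r : ℝ) : ℂ)) := by
  simp [character]

lemma character_neg (ξ : Freq n) (x : Rn n) :
    character (-ξ) x = (starRingEnd ℂ) (character ξ x) := by
  simp only [character, ← Complex.exp_conj]
  simp

lemma character_zero (x : Rn n) : character (0 : Freq n) x = 1 := by simp [character]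

lemma contDiff_character (ξ : Freq n) : ContDiff ℝ ∞ (character ξ) := by
  unfold character
  have : ContDiff ℝ ∞ fun x : Rn n => ∑ k, (ξ k : ℝ) * x k := by fun_prop
  exact (contDiff_const.mul (Complex.ofRealCLM.contDiff.comp this)).cexp

lemma continuous_character (ξ : Freq n) : Continuous (character ξ) :=
  (contDiff_character ξ).continuous

lemma isPeriodic_character (ξ : Freq n) : IsPeriodic (character ξ) := by
  intro k x
  rw [character_add_right, character_single]
  have : Complex.exp (Complex.I * ((ξ k * (2 * Real.pi) : ℝ) : ℂ)) = 1 := by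
    rw [Complex.exp_eq_one_iff]
    exact ⟨ξ k, by push_cast; ring⟩
  rw [this, mul_one]

/-- The real linear form `v ↦ ξ · v`. -/
def freqForm (ξ : Freq n) : Rn n →L[ℝ] ℝ := ∑ k, (ξ k : ℝ) • EuclideanSpace.proj k

lemma freqForm_apply (ξ : Freq n) (v : Rn n) : freqForm ξ v = ∑ k, (ξ k : ℝ) * v k := by
  simp [freqForm]

lemma freqForm_single (ξ : Freq n) (k : Fin n) :
    freqForm ξ (EuclideanSpace.single k 1) = ξ k := by
  simp [freqForm_apply]

lemma norm_freqForm_le (ξ : Freq n) : ‖freqForm ξ‖ ≤ n * ‖ξ‖ := by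
  refine ContinuousLinearMap.opNorm_le_bound _ (by positivity) fun v => ?_
  rw [freqForm_apply]
  have : ∀ k ∈ Finset.univ, ‖(ξ k : ℝ) * v k‖ ≤ ‖ξ‖ * ‖v‖ := fun k _ => by
    rw [norm_mul]
    gcongr
    · exact abs_le_norm ξ k
    · exact PiLp.norm_apply_le v k
  refine (norm_sum_le_of_le _ this).trans_eq ?_
  simp [mul_assoc]

lemma hasFDerivAt_character (ξ : Freq n) (x : Rn n) :
    HasFDerivAt (character ξ) ((freqForm ξ).smulRight (Complex.I * character ξ x)) x := by
  have h1 : HasFDerivAt (fun x => Complex.I * Complex.ofRealCLM (freqForm ξ x))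
      (Complex.I • (Complex.ofRealCLM.comp (freqForm ξ))) x :=
    ((Complex.ofRealCLM.comp (freqForm ξ)).hasFDerivAt).const_mul _
  have h2 := h1.cexp
  have h3 : (fun x => Complex.exp (Complex.I * Complex.ofRealCLM (freqForm ξ x))) = character ξ := by
    funext y
    simp only [character, freqForm_apply, Complex.ofRealCLM_apply]
  have h4 := congrFun h3 x
  beta_reduce at h4
  rw [h3, h4] at h2
  refine h2.congr_fderiv ?_
  ext v
  simp
  ring

end Character

section Synth

lemma summable_synth [CompleteSpace F] {b : Freq n → F} (hb : Summable fun ξ => ‖b ξ‖) (x : Rn n) :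
    Summable fun ξ => character ξ x • b ξ :=
  .of_norm <| by simpa [norm_smul, norm_character] using hb

lemma isPeriodic_synth (b : Freq n → F) : IsPeriodic (synth b) := fun k x => by
  simp only [synth, isPeriodic_character _ k x]

lemma norm_synth_le {b : Freq n → F} (hb : Summable fun ξ => ‖b ξ‖) (x : Rn n) :
    ‖synth b x‖ ≤ ∑' ξ, ‖b ξ‖ := by
  have h : ∀ ξ, ‖character ξ x • b ξ‖ = ‖b ξ‖ := fun ξ => by rw [norm_smul, norm_character, one_mul]
  have h' : Summable fun ξ => ‖character ξ x • b ξ‖ := by simpa only [h] using hb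
  exact (norm_tsum_le_tsum_norm h').trans_eq (tsum_congr h)

lemma synth_add [CompleteSpace F] {b c : Freq n → F} (hb : Summable fun ξ => ‖b ξ‖)
    (hc : Summable fun ξ => ‖c ξ‖) (x : Rn n) :
    synth (fun ξ => b ξ + c ξ) x = synth b x + synth c x := by
  simp only [synth, smul_add]
  exact (summable_synth hb x).tsum_add (summable_synth hc x)

lemma clm_synth [CompleteSpace F] {F' : Type*} [NormedAddCommGroup F'] [NormedSpace ℂ F']
    (A : F →L[ℂ] F') {b : Freq n → F} (hb : Summable fun ξ => ‖b ξ‖) (x : Rn n) :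
    A (synth b x) = synth (fun ξ => A (b ξ)) x := by
  simp only [synth]
  rw [A.map_tsum (summable_synth hb x)]
  simp

/-- The coefficients of the `k`-th partial derivative. -/
def derivCoef (k : Fin n) (b : Freq n → F) : Freq n → F := fun ξ => (Complex.I * ξ k) • b ξ

lemma norm_derivCoef_le (k : Fin n) (b : Freq n → F) (ξ : Freq n) :
    ‖derivCoef k b ξ‖ ≤ 1 * (1 + ‖ξ‖) ^ 1 * ‖b ξ‖ := by
  rw [derivCoef, norm_smul]
  gcongr
  rw [pow_one, norm_mul, Complex.norm_I, one_mul, one_mul, Complex.norm_intCast]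
  exact (abs_le_norm ξ k).trans (le_add_of_nonneg_left zero_le_one)

lemma Rapid.derivCoef {b : Freq n → F} (hb : Rapid b) (k : Fin n) : Rapid (derivCoef k b) :=
  hb.of_le 1 1 fun ξ => norm_derivCoef_le k b ξ

end Synth

section Conv

/-- The convolution of two lattice sequences with respect to a bilinear map; it gives the Fourier
coefficients of a pointwise product. -/
def conv (B : F →L[ℂ] F →L[ℂ] F) (a b : Freq n → F) : Freq n → F :=
  fun ξ => ∑' η, B (a η) (b (ξ - η))

variable (B : F →L[ℂ] F →L[ℂ] F)

lemma RapidOn.conv {S : Set T} {a b : T → Freq n → F} (ha : RapidOn S a) (hb : RapidOn S b) :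
    RapidOn S (fun t => conv B (a t) (b t)) := by
  intro s
  obtain ⟨u, hu, hu0, hau⟩ := ha.exists_summable s
  obtain ⟨M, hM⟩ := hb s
  refine ⟨∑' η, ‖B‖ * u η * M, fun t ht ξ => ?_⟩
  have hle : ∀ η, ‖((1 + ‖ξ‖) ^ s : ℝ) • B (a t η) (b t (ξ - η))‖ ≤ ‖B‖ * u η * M := fun η => by
    rw [norm_smul, Real.norm_of_nonneg (by positivity)]
    have h1 : 1 + ‖ξ‖ ≤ (1 + ‖η‖) * (1 + ‖ξ - η‖) := by
      have := norm_add_le η (ξ - η)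
      rw [add_sub_cancel] at this
      nlinarith [norm_nonneg η, norm_nonneg (ξ - η)]
    calc _ ≤ ((1 + ‖η‖) * (1 + ‖ξ - η‖)) ^ s * (‖B‖ * ‖a t η‖ * ‖b t (ξ - η)‖) := by
          gcongr
          exact B.le_opNorm₂ _ _
      _ = ‖B‖ * ((1 + ‖η‖) ^ s * ‖a t η‖) * ((1 + ‖ξ - η‖) ^ s * ‖b t (ξ - η)‖) := by
          rw [mul_pow]; ring
      _ ≤ _ := by
          gcongr
          · exact mul_nonneg B.opNorm_nonneg (hu0 η)
          · exact hau t ht η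
          · exact hM t ht _
  have hs : Summable fun η => ‖B‖ * u η * M := (hu.mul_left _).mul_right _
  calc (1 + ‖ξ‖) ^ s * ‖PeriodicModel.conv B (a t) (b t) ξ‖
      = ‖∑' η, ((1 + ‖ξ‖) ^ s : ℝ) • B (a t η) (b t (ξ - η))‖ := by
        rw [tsum_const_smul'', norm_smul, Real.norm_of_nonneg (by positivity)]
        rfl
    _ ≤ _ := tsum_of_norm_bounded hs.hasSum hle

lemma Rapid.conv {a b : Freq n → F} (ha : Rapid a) (hb : Rapid b) : Rapid (conv B a b) :=
  rapidOn_unit.1 <| (rapidOn_unit.2 ha).conv B (rapidOn_unit.2 hb)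

variable [CompleteSpace F]

lemma summable_conv {a b : Freq n → F} (ha : Summable fun ξ => ‖a ξ‖)
    (hb : Rapid b) (ξ : Freq n) : Summable fun η => B (a η) (b (ξ - η)) := by
  obtain ⟨M, hM⟩ := hb 0
  refine .of_norm_bounded ((ha.mul_left ‖B‖).mul_right M) fun η => ?_
  refine (B.le_opNorm₂ _ _).trans ?_
  gcongr
  simpa using hM (ξ - η)

/-- Synthesis turns convolutions into pointwise products. -/
lemma synth_conv {a b : Freq n → F} (ha : Summable fun ξ => ‖a ξ‖) (hb : Summable fun ξ => ‖b ξ‖)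
    (x : Rn n) : synth (conv B a b) x = B (synth a x) (synth b x) := by
  let f : Freq n × Freq n → F := fun p => character (p.1 + p.2) x • B (a p.1) (b p.2)
  have hf : Summable f := by
    refine .of_norm_bounded ((ha.mul_of_nonneg hb (fun _ => norm_nonneg _)
      (fun _ => norm_nonneg _)).mul_left ‖B‖) fun p => ?_
    rw [norm_smul, norm_character, one_mul, ← mul_assoc]
    exact B.le_opNorm₂ _ _
  let e : Freq n × Freq n ≃ Freq n × Freq n :=
    { toFun := fun p => (p.2, p.1 - p.2)
      invFun := fun p => (p.1 + p.2, p.1)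
      left_inv := fun p => by simp
      right_inv := fun p => by simp }
  have h1 : ∑' p, f p = B (synth a x) (synth b x) := by
    rw [hf.tsum_prod]
    have : ∀ η, ∑' ζ, f (η, ζ) = B (character η x • a η) (synth b x) := fun η => by
      rw [synth, (B _).map_tsum (summable_synth hb x)]
      refine tsum_congr fun ζ => ?_
      simp [f, character_add, smul_smul, mul_comm]
    simp only [this]
    exact ((B.flip (synth b x)).map_tsum (summable_synth ha x)).symm
  have h2 := (e.summable_iff.2 hf).tsum_prod
  simp only [Function.comp_apply] at h2
  rw [← h1, ← e.tsum_eq f, h2, synth]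
  refine tsum_congr fun ξ => ?_
  rw [conv, ← tsum_const_smul'']
  refine tsum_congr fun η => ?_
  simp [f, e]

/-- The Leibniz rule. -/
lemma derivCoef_conv {a b : Freq n → F} (ha : Rapid a) (hb : Rapid b) (k : Fin n) :
    derivCoef k (conv B a b) =
      fun ξ => conv B (derivCoef k a) b ξ + conv B a (derivCoef k b) ξ := by
  funext ξ
  rw [derivCoef, conv, conv, conv, ← tsum_const_smul'', ← Summable.tsum_add]
  · refine tsum_congr fun η => ?_
    simp only [derivCoef, map_smul, FunLike.coe_smul, Pi.smul_apply, ← add_smul]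
    congr 1
    simp
    ring
  · exact summable_conv B (ha.derivCoef k).summable_norm hb ξ
  · exact summable_conv B ha.summable_norm (hb.derivCoef k) ξ

end Conv

section Deriv

variable [NormedSpace ℝ F]

lemma ofReal_smul_eq [IsScalarTower ℝ ℂ F] (r : ℝ) (v : F) : (r : ℂ) • v = r • v := by
  rw [← mul_one (r : ℂ), ← Complex.real_smul, smul_assoc, one_smul]

/-- The derivative of the map `x ↦ e^{i ξ·x} v`. -/
def characterDeriv (ξ : Freq n) (v : F) (x : Rn n) : Rn n →L[ℝ] F :=
  (freqForm ξ).smulRight ((Complex.I * character ξ x) • v)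

lemma norm_characterDeriv_le (ξ : Freq n) (v : F) (x : Rn n) :
    ‖characterDeriv ξ v x‖ ≤ n * ((1 + ‖ξ‖) ^ 1 * ‖v‖) := by
  rw [characterDeriv, ContinuousLinearMap.norm_smulRight_apply, norm_smul, norm_mul, Complex.norm_I,
    norm_character, one_mul, one_mul, ← mul_assoc, pow_one]
  gcongr
  refine (norm_freqForm_le ξ).trans ?_
  gcongr
  linarith

variable [IsScalarTower ℝ ℂ F]

lemma hasFDerivAt_character_smul (ξ : Freq n) (v : F) (x : Rn n) :
    HasFDerivAt (fun x => character ξ x • v) (characterDeriv ξ v x) x := by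
  refine ((hasFDerivAt_character ξ x).smul_const v).congr_fderiv ?_
  ext w
  simp [characterDeriv, ← ofReal_smul_eq, smul_smul]

lemma characterDeriv_single (ξ : Freq n) (v : F) (x : Rn n) (k : Fin n) :
    characterDeriv ξ v x (EuclideanSpace.single k 1) = character ξ x • ((Complex.I * ξ k) • v) := by
  rw [characterDeriv, ContinuousLinearMap.smulRight_apply, freqForm_single, ← ofReal_smul_eq,
    smul_smul, smul_smul]
  congr 1
  push_cast
  ring

variable [CompleteSpace F]

lemma hasFDerivAt_synth {b : Freq n → F} (hb : Rapid b) (x : Rn n) :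
    HasFDerivAt (synth b) (∑' ξ, characterDeriv ξ (b ξ) x) x := by
  obtain ⟨u, hu, -, hbu⟩ := (rapidOn_unit.2 hb).exists_summable 1
  refine hasFDerivAt_tsum (u := fun ξ => n * u ξ) (x₀ := 0) (hu.mul_left _)
    (fun ξ y => hasFDerivAt_character_smul ξ (b ξ) y) (fun ξ y => ?_)
    (summable_synth hb.summable_norm 0) x
  refine (norm_characterDeriv_le ξ (b ξ) y).trans ?_
  gcongr
  exact hbu () trivial ξ

/-- Synthesis turns multiplication by `i ξ_k` into `∂/∂x_k`. -/
lemma fderiv_synth_single {b : Freq n → F} (hb : Rapid b) (x : Rn n) (k : Fin n) :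
    fderiv ℝ (synth b) x (EuclideanSpace.single k 1) = synth (derivCoef k b) x := by
  obtain ⟨u, hu, -, hbu⟩ := (rapidOn_unit.2 hb).exists_summable 1
  have hs : Summable fun ξ => characterDeriv ξ (b ξ) x := by
    refine .of_norm_bounded (hu.mul_left (n : ℝ)) fun ξ =>
      (norm_characterDeriv_le ξ (b ξ) x).trans ?_
    gcongr
    exact hbu () trivial ξ
  rw [(hasFDerivAt_synth hb x).fderiv, synth]
  refine ((ContinuousLinearMap.apply ℝ F (EuclideanSpace.single k (1 : ℝ))).map_tsum hs).trans ?_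
  exact tsum_congr fun ξ => characterDeriv_single ξ (b ξ) x k

end Deriv

end PeriodicModel

namespace PeriodicModel

/-! ### Fourier coefficients of periodic functions -/

variable {n : ℕ}

/-- The point with coordinates `2π y_k`. -/
def scale (y : Fin n → ℝ) : Rn n := WithLp.toLp 2 fun k => 2 * Real.pi * y k

/-- The half-open cube with lower corner `a` and side length `1`. -/
def unitCube (a : Fin n → ℝ) : Set (Fin n → ℝ) := {y | ∀ k, y k ∈ Ioc (a k) (a k + 1)}

/-- The mean of a `2π`-periodic function over a cell of periodicity. -/
def cellMean (φ : Rn n → ℂ) : ℂ := ∫ y in unitCube 0, φ (scale y)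

lemma continuous_scale : Continuous (scale (n := n)) := by
  unfold scale
  fun_prop

lemma scale_add (y z : Fin n → ℝ) : scale (y + z) = scale y + scale z := by
  ext k
  simp [scale, mul_add]

lemma scale_surjective : Function.Surjective (scale (n := n)) := fun x =>
  ⟨fun k => x k / (2 * Real.pi), by
    ext k
    simp only [scale]
    field_simp⟩

lemma unitCube_eq_pi (a : Fin n → ℝ) :
    unitCube a = univ.pi fun k => Ioc (a k) (a k + 1) := by
  ext y
  simp [unitCube]

lemma volume_unitCube (a : Fin n → ℝ) : volume (unitCube a) = 1 := by
  rw [unitCube_eq_pi, volume_pi_pi]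
  simp

open scoped Pointwise in
lemma mean_eq_cellMean (φ : Rn n → ℂ) :
    (((2 * Real.pi) ^ n)⁻¹ : ℝ) * ∫ x in {x : Rn n | ∀ k, x k ∈ Icc 0 (2 * Real.pi)}, φ x =
      cellMean φ := by
  have hpi : (0 : ℝ) < 2 * Real.pi := by positivity
  have h1 := (PiLp.volume_preserving_toLp (Fin n)).setIntegral_preimage_emb
    (MeasurableEquiv.toLp 2 (Fin n → ℝ)).measurableEmbedding φ
    {x : Rn n | ∀ k, x k ∈ Icc 0 (2 * Real.pi)}
  have h2 := Measure.setIntegral_comp_smul_of_pos (volume : Measure (Fin n → ℝ))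
    (fun y => φ (WithLp.toLp 2 y)) (Icc (0 : Fin n → ℝ) 1) hpi
  have h3 : (2 * Real.pi) • Icc (0 : Fin n → ℝ) 1 =
      WithLp.toLp 2 ⁻¹' {x : Rn n | ∀ k, x k ∈ Icc 0 (2 * Real.pi)} := by
    ext y
    rw [mem_smul_set_iff_inv_smul_mem₀ hpi.ne']
    simp only [mem_Icc, Pi.le_def, Pi.smul_apply, smul_eq_mul, Pi.zero_apply, Pi.one_apply,
      mem_preimage, mem_ofPred_eq, ← forall_and]
    refine forall_congr' fun k => and_congr ?_ ?_
    · exact mul_nonneg_iff_of_pos_left (inv_pos.2 hpi)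
    · rw [inv_mul_le_iff₀ hpi, mul_one]
  have h4 : (unitCube (0 : Fin n → ℝ) : Set _) =ᵐ[volume] Icc (0 : Fin n → ℝ) 1 := by
    rw [unitCube_eq_pi]
    simpa [volume_pi] using Measure.univ_pi_Ioc_ae_eq_Icc (μ := fun _ : Fin n => (volume : Measure ℝ))
      (f := 0) (g := 1)
  rw [cellMean, setIntegral_congr_set h4, ← h1, ← h3]
  simp only [Module.finrank_fintype_fun_eq_card, Fintype.card_fin] at h2
  rw [← Complex.real_smul, ← h2]
  rfl

lemma fourierCoefficient_eq (φ : Rn n → ℂ) (ξ : Freq n) :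
    fourierCoefficient φ ξ = cellMean fun x => φ x * character (-ξ) x :=
  mean_eq_cellMean _

section Lift

variable {F : Type*}

lemma IsPeriodic.scale_int {φ : Rn n → F} (hφ : IsPeriodic φ) (x : Rn n) (m : Fin n → ℤ) :
    φ (x + scale fun k => (m k : ℝ)) = φ x := by
  have h : ∀ s : Finset (Fin n), Function.Periodic φ
      (∑ k ∈ s, m k • EuclideanSpace.single k (2 * Real.pi)) := by
    intro s
    induction s using Finset.induction_on with
    | empty => simp [Function.Periodic]
    | insert k s hk ih =>
      rw [Finset.sum_insert hk]
      have hk' : Function.Periodic φ (EuclideanSpace.single k (2 * Real.pi)) := hφ k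
      exact (hk'.zsmul (m k)).add_period ih
  have h2 : (scale fun k => (m k : ℝ)) =
      ∑ k, m k • EuclideanSpace.single k (2 * Real.pi) := by
    ext l
    simp [scale, WithLp.ofLp_sum, Finset.sum_apply, Pi.single_apply, mul_comm]
  rw [h2]
  exact h _ x

/-- The point of the torus `(ℝ/ℤ)ⁿ` represented by `y`. -/
def torusMk (y : Fin n → ℝ) : UnitAddTorus (Fin n) := fun k => (y k : UnitAddCircle)

lemma exists_torus_lift [TopologicalSpace F] {φ : Rn n → F} (hc : Continuous φ)
    (hφ : IsPeriodic φ) :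
    ∃ H : C(UnitAddTorus (Fin n), F), ∀ y, H (torusMk y) = φ (scale y) := by
  have hq : Topology.IsQuotientMap (torusMk (n := n)) :=
    (IsOpenQuotientMap.piMap fun _ : Fin n => (QuotientAddGroup.isOpenQuotientMap_mk :
      IsOpenQuotientMap ((↑) : ℝ → UnitAddCircle))).isQuotientMap
  let q : C(Fin n → ℝ, UnitAddTorus (Fin n)) := ⟨torusMk, hq.continuous⟩
  have hq' : Topology.IsQuotientMap q := hq
  let g : C(Fin n → ℝ, F) := ⟨fun y => φ (scale y), hc.comp continuous_scale⟩
  have hf : Function.FactorsThrough g q := by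
    intro y z hyz
    have h1 : ∀ k, ∃ m : ℤ, (m : ℝ) = y k - z k := fun k => by
      have : (y k : UnitAddCircle) = (z k : UnitAddCircle) := congrFun hyz k
      have := QuotientAddGroup.eq_iff_sub_mem.1 this
      obtain ⟨m, hm⟩ := AddSubgroup.mem_zmultiples_iff.1 this
      exact ⟨m, by simpa using hm⟩
    choose m hm using h1
    have h2 : y = z + fun k => (m k : ℝ) := by
      ext k
      simp [hm k]
    change φ (scale y) = φ (scale z)
    rw [h2, scale_add, hφ.scale_int]
  exact ⟨hq'.lift g hf, fun y => DFunLike.congr_fun (hq'.lift_comp g hf) y⟩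

lemma IsPeriodic.exists_bound [NormedAddCommGroup F] {φ : Rn n → F} (hc : Continuous φ)
    (hφ : IsPeriodic φ) : ∃ M, ∀ x, ‖φ x‖ ≤ M := by
  obtain ⟨H, hH⟩ := exists_torus_lift hc hφ
  refine ⟨‖H‖, fun x => ?_⟩
  obtain ⟨y, rfl⟩ := scale_surjective x
  rw [← hH]
  exact H.norm_coe_le_norm _

end Lift

lemma cellMean_translate {φ : Rn n → ℂ} (hc : Continuous φ) (hφ : IsPeriodic φ) (v : Rn n) :
    cellMean (fun x => φ (x + v)) = cellMean φ := by
  obtain ⟨H, hH⟩ := exists_torus_lift hc hφ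
  obtain ⟨a, rfl⟩ := scale_surjective v
  have h1 := (measurePreserving_add_right (volume : Measure (Fin n → ℝ)) a).setIntegral_preimage_emb
    (MeasurableEquiv.addRight a).measurableEmbedding (fun y => φ (scale y)) (unitCube a)
  have h2 : (fun y => y + a) ⁻¹' unitCube a = unitCube 0 := by
    ext y
    simp only [unitCube, mem_preimage, mem_ofPred_eq, mem_Ioc, Pi.add_apply, Pi.zero_apply]
    refine forall_congr' fun k => ?_
    constructor <;> rintro ⟨h, h'⟩ <;> constructor <;> linarith
  rw [h2] at h1
  simp only [scale_add] at h1
  rw [cellMean, h1, cellMean]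
  have h3 := (UnitAddTorus.integral_preimage H a).symm.trans (UnitAddTorus.integral_preimage H 0)
  exact (integral_congr_ae (.of_forall fun y => (hH y).symm)).trans
    (h3.trans (integral_congr_ae (.of_forall fun y => hH y)))

lemma norm_cellMean_le {φ : Rn n → ℂ} {M : ℝ} (h : ∀ x, ‖φ x‖ ≤ M) : ‖cellMean φ‖ ≤ M := by
  have := norm_setIntegral_le_of_norm_le_const (μ := volume) (s := unitCube (0 : Fin n → ℝ))
    (f := fun y => φ (scale y)) (C := M) (by simp [volume_unitCube]) fun y _ => h _
  simpa [cellMean, Measure.real, volume_unitCube] using this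

lemma norm_fourierCoefficient_le {φ : Rn n → ℂ} {M : ℝ} (h : ∀ x, ‖φ x‖ ≤ M) (ξ : Freq n) :
    ‖fourierCoefficient φ ξ‖ ≤ M := by
  rw [fourierCoefficient_eq]
  exact norm_cellMean_le fun x => by simpa [norm_character] using h x

instance : IsFiniteMeasure (volume.restrict (unitCube (0 : Fin n → ℝ))) :=
  ⟨by simp [volume_unitCube]⟩

lemma integrable_cell {φ : Rn n → ℂ} (hc : Continuous φ) (hφ : IsPeriodic φ) :
    Integrable (fun y => φ (scale y)) (volume.restrict (unitCube (0 : Fin n → ℝ))) := by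
  obtain ⟨M, hM⟩ := hφ.exists_bound hc
  exact .of_bound (hc.comp continuous_scale).aestronglyMeasurable M (.of_forall fun y => hM _)

lemma cellMean_character (ξ : Freq n) :
    cellMean (character ξ) = if ξ = 0 then 1 else 0 := by
  split_ifs with h
  · subst h
    simp [cellMean, character_zero, Measure.real, volume_unitCube]
  · obtain ⟨k, hk⟩ := Function.ne_iff.1 h
    have hk' : (ξ k : ℝ) ≠ 0 := by exact_mod_cast hk
    have h1 := cellMean_translate (continuous_character ξ) (isPeriodic_character ξ)
      (EuclideanSpace.single k (Real.pi / ξ k))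
    have h2 : (fun x => character ξ (x + EuclideanSpace.single k (Real.pi / ξ k))) =
        fun x => -character ξ x := by
      funext x
      rw [character_add_right, character_single, mul_div_cancel₀ _ hk', mul_comm Complex.I,
        Complex.exp_pi_mul_I]
      ring
    rw [h2] at h1
    have h3 : cellMean (fun x => -character ξ x) = -cellMean (character ξ) := by
      simp [cellMean, integral_neg]
    rw [h3] at h1
    exact self_eq_neg.1 h1.symm

/-- Synthesis inverts the Fourier coefficients: orthogonality of the characters. -/
lemma fourierCoefficient_synth {b : Freq n → ℂ} (hb : Summable fun ξ => ‖b ξ‖) (ξ : Freq n) :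
    fourierCoefficient (synth b) ξ = b ξ := by
  rw [fourierCoefficient_eq, cellMean]
  have h1 : ∀ y, synth b (scale y) * character (-ξ) (scale y) =
      ∑' η, b η * character (η - ξ) (scale y) := fun y => by
    rw [synth, ← tsum_mul_right]
    refine tsum_congr fun η => ?_
    rw [sub_eq_add_neg, character_add, smul_eq_mul]
    ring
  simp only [h1]
  have h2 := hasSum_integral_of_summable_integral_norm
    (μ := volume.restrict (unitCube (0 : Fin n → ℝ)))
    (F := fun (η : Freq n) y => b η * character (η - ξ) (scale y))
    (fun η => (integrable_cell (continuous_character _) (isPeriodic_character _)).const_mul _)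
    (by simpa [norm_character, Measure.real, volume_unitCube] using hb)
  refine h2.unique ?_
  have h3 : ∀ η, ∫ y in unitCube (0 : Fin n → ℝ), b η * character (η - ξ) (scale y) =
      if η = ξ then b ξ else 0 := fun η => by
    rw [integral_const_mul]
    change b η * cellMean (character (η - ξ)) = _
    rw [cellMean_character]
    simp only [sub_eq_zero]
    split_ifs with h <;> simp [h]
  simp only [h3]
  exact hasSum_ite_eq ξ (b ξ)

/-- Fourier inversion. -/
lemma synth_fourierCoefficient {φ : Rn n → ℂ} (hc : Continuous φ) (hφ : IsPeriodic φ)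
    (hs : Summable (fourierCoefficient φ)) : synth (fourierCoefficient φ) = φ := by
  obtain ⟨H, hH⟩ := exists_torus_lift hc hφ
  have hchar : ∀ (ξ : Freq n) y, UnitAddTorus.mFourier ξ (torusMk y) = character ξ (scale y) := by
    intro ξ y
    simp only [UnitAddTorus.mFourier, ContinuousMap.coe_mk, torusMk, fourier_coe_apply, character,
      ← Complex.exp_sum, scale]
    congr 1
    push_cast
    rw [Finset.mul_sum]
    exact Finset.sum_congr rfl fun k _ => by ring
  have hcoef : UnitAddTorus.mFourierCoeff H = fourierCoefficient φ := by
    funext ξ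
    rw [UnitAddTorus.mFourierCoeff_eq_integral H ξ 0, fourierCoefficient_eq, cellMean]
    refine integral_congr_ae (.of_forall fun y => ?_)
    change UnitAddTorus.mFourier (-ξ) (torusMk y) • H (torusMk y) = _
    rw [hchar, hH, smul_eq_mul, mul_comm]
  funext x
  obtain ⟨y, rfl⟩ := scale_surjective x
  have := UnitAddTorus.hasSum_mFourier_series_apply_of_summable (f := H) (by rwa [hcoef]) (torusMk y)
  rw [hcoef, hH] at this
  rw [← this.tsum_eq, synth]
  refine tsum_congr fun ξ => ?_
  rw [hchar, smul_eq_mul, smul_eq_mul, mul_comm]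

section Decay

/-- The partial derivative `∂/∂x_k` of a complex function. -/
def pderiv (k : Fin n) (φ : Rn n → ℂ) : Rn n → ℂ :=
  fun x => fderiv ℝ φ x (EuclideanSpace.single k 1)

lemma IsPeriodic.fderiv_apply {F : Type*} [NormedAddCommGroup F] [NormedSpace ℝ F]
    {φ : Rn n → F} (hφ : IsPeriodic φ) (v : Rn n) : IsPeriodic fun x => fderiv ℝ φ x v := by
  intro k x
  have : (fun y => φ (y + EuclideanSpace.single k (2 * Real.pi))) = φ := funext (hφ k)
  beta_reduce
  rw [← fderiv_comp_add_right, this]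

lemma contDiff_pderiv {φ : Rn n → ℂ} (hφ : ContDiff ℝ ∞ φ) (k : Fin n) :
    ContDiff ℝ ∞ (pderiv k φ) :=
  (hφ.fderiv_right (m := ∞) (by simp)).clm_apply contDiff_const

lemma isPeriodic_pderiv {φ : Rn n → ℂ} (hφ : IsPeriodic φ) (k : Fin n) :
    IsPeriodic (pderiv k φ) := hφ.fderiv_apply _

lemma cellMean_pderiv {φ : Rn n → ℂ} (hc : ContDiff ℝ ∞ φ) (hφ : IsPeriodic φ) (k : Fin n) :
    cellMean (pderiv k φ) = 0 := by
  obtain ⟨M, hM⟩ := (isPeriodic_pderiv hφ k).exists_bound (contDiff_pderiv hc k).continuous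
  let e : Rn n := EuclideanSpace.single k 1
  have hd : ∀ (y : Fin n → ℝ) (r : ℝ),
      HasDerivAt (fun r : ℝ => φ (scale y + r • e)) (pderiv k φ (scale y + r • e)) r := by
    intro y r
    have h1 : HasDerivAt (fun r : ℝ => scale y + r • e) e r := by
      simpa using ((hasDerivAt_id r).smul_const e).const_add (scale y)
    exact ((hc.differentiable (by simp)).differentiableAt.hasFDerivAt).comp_hasDerivAt r h1
  have hmeas : ∀ r : ℝ, Continuous fun y => φ (scale y + r • e) := fun r =>
    hc.continuous.comp (continuous_scale.add continuous_const)
  have h := (hasDerivAt_integral_of_dominated_loc_of_deriv_le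
    (μ := volume.restrict (unitCube (0 : Fin n → ℝ))) (bound := fun _ => M)
    (F := fun (r : ℝ) y => φ (scale y + r • e)) (x₀ := (0 : ℝ))
    (F' := fun r y => pderiv k φ (scale y + r • e)) Filter.univ_mem
    (.of_forall fun r => (hmeas r).aestronglyMeasurable)
    (by simpa using integrable_cell hc.continuous hφ)
    ((contDiff_pderiv hc k).continuous.comp
      (continuous_scale.add continuous_const)).aestronglyMeasurable
    (.of_forall fun y r _ => hM _) (integrable_const M) (.of_forall fun y r _ => hd y r)).2
  have h2 : (fun r : ℝ => ∫ y in unitCube (0 : Fin n → ℝ), φ (scale y + r • e)) =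
      fun _ => cellMean φ := funext fun r => cellMean_translate hc.continuous hφ (r • e)
  rw [h2] at h
  simpa [cellMean] using h.unique (hasDerivAt_const _ _)

/-- Integration by parts for Fourier coefficients. -/
lemma fourierCoefficient_pderiv {φ : Rn n → ℂ} (hc : ContDiff ℝ ∞ φ) (hφ : IsPeriodic φ)
    (k : Fin n) (ξ : Freq n) :
    fourierCoefficient (pderiv k φ) ξ = Complex.I * ξ k * fourierCoefficient φ ξ := by
  have hper : IsPeriodic fun x => φ x * character (-ξ) x := fun l x => by
    beta_reduce
    rw [hφ l x, isPeriodic_character _ l x]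
  have hcd : ContDiff ℝ ∞ fun x => φ x * character (-ξ) x := hc.mul (contDiff_character _)
  have h1 := cellMean_pderiv hcd hper k
  have h2 : pderiv k (fun x => φ x * character (-ξ) x) =
      fun x => pderiv k φ x * character (-ξ) x -
        Complex.I * ξ k * (φ x * character (-ξ) x) := by
    funext x
    have := ((hc.differentiable (by simp)).differentiableAt.hasFDerivAt (x := x)).mul
      (hasFDerivAt_character (-ξ) x)
    change fderiv ℝ (φ * character (-ξ)) x _ = _
    rw [this.fderiv]
    simp only [FunLike.coe_add, FunLike.coe_smul, Pi.add_apply, Pi.smul_apply, smul_eq_mul,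
      ContinuousLinearMap.smulRight_apply, freqForm_single, pderiv, Complex.real_smul]
    push_cast
    simp
    ring
  rw [h2, cellMean, integral_sub, integral_const_mul] at h1
  · rw [fourierCoefficient_eq, fourierCoefficient_eq]
    exact sub_eq_zero.1 h1
  · refine integrable_cell ((contDiff_pderiv hc k).mul (contDiff_character _)).continuous ?_
    intro l x
    beta_reduce
    rw [isPeriodic_pderiv hφ k l x, isPeriodic_character _ l x]
  · exact (integrable_cell hcd.continuous hper).const_mul _

lemma contDiff_pderiv_iterate {φ : Rn n → ℂ} (hφ : ContDiff ℝ ∞ φ) (k : Fin n) (s : ℕ) :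
    ContDiff ℝ ∞ ((pderiv k)^[s] φ) := by
  induction s with
  | zero => exact hφ
  | succ s ih =>
    rw [Function.iterate_succ_apply']
    exact contDiff_pderiv ih k

lemma isPeriodic_pderiv_iterate {φ : Rn n → ℂ} (hφ : IsPeriodic φ) (k : Fin n) (s : ℕ) :
    IsPeriodic ((pderiv k)^[s] φ) := by
  induction s with
  | zero => exact hφ
  | succ s ih =>
    rw [Function.iterate_succ_apply']
    exact isPeriodic_pderiv ih k

lemma fourierCoefficient_pderiv_iterate {φ : Rn n → ℂ} (hc : ContDiff ℝ ∞ φ) (hφ : IsPeriodic φ)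
    (k : Fin n) (s : ℕ) (ξ : Freq n) : fourierCoefficient ((pderiv k)^[s] φ) ξ =
      (Complex.I * ξ k) ^ s * fourierCoefficient φ ξ := by
  induction s with
  | zero => simp
  | succ s ih =>
    rw [Function.iterate_succ_apply', fourierCoefficient_pderiv (contDiff_pderiv_iterate hc k s)
      (isPeriodic_pderiv_iterate hφ k s), ih, pow_succ']
    ring

lemma weight_le_sum (ξ : Freq n) (s : ℕ) :
    (1 + ‖ξ‖) ^ s ≤ 2 ^ s * (1 + ∑ k, |(ξ k : ℝ)| ^ s) := by
  have hsum : 0 ≤ ∑ k, |(ξ k : ℝ)| ^ s := Finset.sum_nonneg fun _ _ => by positivity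
  rcases le_total ‖ξ‖ 1 with h | h
  · calc (1 + ‖ξ‖) ^ s ≤ 2 ^ s := pow_le_pow_left₀ (by positivity) (by linarith) s
      _ ≤ _ := le_mul_of_one_le_right (by positivity) (by linarith)
  · have hne : Nonempty (Fin n) := by
      by_contra hcon
      rw [not_nonempty_iff] at hcon
      have : ξ = 0 := Subsingleton.elim _ _
      rw [this, norm_zero] at h
      linarith
    obtain ⟨k, hk⟩ : ∃ k, ‖ξ k‖ = ‖ξ‖ := by
      by_contra! hcon
      exact lt_irrefl _ ((pi_norm_lt_iff (zero_lt_one.trans_le h)).2 fun k =>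
        lt_of_le_of_ne (norm_le_pi_norm ξ k) (hcon k))
    have hk' : |(ξ k : ℝ)| = ‖ξ‖ := by rw [← hk, Int.norm_eq_abs]
    calc (1 + ‖ξ‖) ^ s ≤ (2 * ‖ξ‖) ^ s := pow_le_pow_left₀ (by positivity) (by linarith) s
      _ = 2 ^ s * |(ξ k : ℝ)| ^ s := by rw [mul_pow, hk']
      _ ≤ 2 ^ s * (1 + ∑ k, |(ξ k : ℝ)| ^ s) := by
        gcongr
        have := Finset.single_le_sum (f := fun k => |(ξ k : ℝ)| ^ s) (fun _ _ => by positivity)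
          (Finset.mem_univ k)
        linarith

/-- Uniform bounds on all pure derivatives give uniformly rapid decay of the coefficients. -/
lemma rapidOn_fourierCoefficient {T : Type*} {S : Set T} {φ : T → Rn n → ℂ}
    (hc : ∀ t ∈ S, ContDiff ℝ ∞ (φ t)) (hφ : ∀ t ∈ S, IsPeriodic (φ t))
    (hb : ∀ k s, ∃ M, ∀ t ∈ S, ∀ x, ‖(pderiv k)^[s] (φ t) x‖ ≤ M)
    (hb0 : ∃ M, ∀ t ∈ S, ∀ x, ‖φ t x‖ ≤ M) :
    RapidOn S fun t => fourierCoefficient (φ t) := by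
  intro s
  choose M hM using fun k => hb k s
  obtain ⟨M₀, hM₀⟩ := hb0
  refine ⟨2 ^ s * (M₀ + ∑ k, M k), fun t ht ξ => ?_⟩
  have h1 : ∀ k, |(ξ k : ℝ)| ^ s * ‖fourierCoefficient (φ t) ξ‖ ≤ M k := fun k => by
    have := norm_fourierCoefficient_le (hM k t ht) ξ
    rw [fourierCoefficient_pderiv_iterate (hc t ht) (hφ t ht), norm_mul, norm_pow, norm_mul,
      Complex.norm_I, one_mul, Complex.norm_intCast] at this
    exact this
  calc _ ≤ 2 ^ s * (1 + ∑ k, |(ξ k : ℝ)| ^ s) * ‖fourierCoefficient (φ t) ξ‖ := by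
        gcongr
        exact weight_le_sum ξ s
    _ = 2 ^ s * (‖fourierCoefficient (φ t) ξ‖ +
        ∑ k, |(ξ k : ℝ)| ^ s * ‖fourierCoefficient (φ t) ξ‖) := by
        rw [mul_assoc, add_mul, one_mul, Finset.sum_mul]
    _ ≤ _ := by
        gcongr with k
        · exact norm_fourierCoefficient_le (hM₀ t ht) ξ
        · exact h1 k

lemma rapid_fourierCoefficient {φ : Rn n → ℂ} (hc : ContDiff ℝ ∞ φ) (hφ : IsPeriodic φ) :
    Rapid (fourierCoefficient φ) := by
  refine rapidOn_unit.1 (rapidOn_fourierCoefficient (fun _ _ => hc) (fun _ _ => hφ) ?_ ?_)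
  · intro k s
    obtain ⟨M, hM⟩ := (isPeriodic_pderiv_iterate hφ k s).exists_bound
      (contDiff_pderiv_iterate hc k s).continuous
    exact ⟨M, fun _ _ => hM⟩
  · obtain ⟨M, hM⟩ := hφ.exists_bound hc.continuous
    exact ⟨M, fun _ _ => hM⟩

end Decay

end PeriodicModel

namespace PeriodicModel

/-! ### Supremum bounds for Fourier multipliers -/

variable {n : ℕ}

/-- Multiplication of the coefficients by the bounded symbol `m` maps absolutely convergent Fourier
series with values in `F` to such series and increases the supremum norm at most by the
factor `C`. -/
structure IsMultiplier (F : Type*) [NormedAddCommGroup F] [NormedSpace ℂ F] (m : Freq n → ℂ)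
    (C : ℝ) : Prop where
  bounded : ∃ K, ∀ ξ, ‖m ξ‖ ≤ K
  bound : ∀ b : Freq n → F, (Summable fun ξ => ‖b ξ‖) → ∀ M, (∀ x, ‖synth b x‖ ≤ M) →
    ∀ x, ‖synth (fun ξ => m ξ • b ξ) x‖ ≤ C * M

/-- The symbol `e^{-t|ξ|²}` of the heat semigroup. -/
def heat (t : ℝ) (ξ : Freq n) : ℂ := (Real.exp (-t * lenSq ξ) : ℂ)

/-- The symbol `∏ i ξ_k` of an iterated partial derivative, the product being over the entries of
the word `w`. -/
def wordSymbol (w : List (Fin n)) (ξ : Freq n) : ℂ := (w.map fun k => Complex.I * (ξ k : ℂ)).prod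

section

variable {F : Type*} [NormedAddCommGroup F] [NormedSpace ℂ F]

lemma summable_norm_smul {m : Freq n → ℂ} {K : ℝ} (hm : ∀ ξ, ‖m ξ‖ ≤ K) {b : Freq n → F}
    (hb : Summable fun ξ => ‖b ξ‖) : Summable fun ξ => ‖m ξ • b ξ‖ := by
  refine .of_nonneg_of_le (fun _ => norm_nonneg _) (fun ξ => ?_) (hb.mul_left K)
  rw [norm_smul]
  exact mul_le_mul_of_nonneg_right (hm ξ) (norm_nonneg _)

lemma IsMultiplier.summable {m : Freq n → ℂ} {C : ℝ} (h : IsMultiplier F m C) {b : Freq n → F}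
    (hb : Summable fun ξ => ‖b ξ‖) : Summable fun ξ => ‖m ξ • b ξ‖ := by
  obtain ⟨K, hK⟩ := h.bounded
  exact summable_norm_smul hK hb

lemma IsMultiplier.mul {m m' : Freq n → ℂ} {C C' : ℝ} (h : IsMultiplier F m C)
    (h' : IsMultiplier F m' C') : IsMultiplier F (fun ξ => m ξ * m' ξ) (C * C') where
  bounded := by
    obtain ⟨K, hK⟩ := h.bounded
    obtain ⟨K', hK'⟩ := h'.bounded
    refine ⟨K * K', fun ξ => ?_⟩
    rw [norm_mul]
    exact mul_le_mul (hK ξ) (hK' ξ) (norm_nonneg _) ((norm_nonneg _).trans (hK ξ))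
  bound b hb M hM x := by
    simp only [mul_smul, mul_assoc]
    exact h.bound _ (h'.summable hb) _ (h'.bound b hb M hM) x

lemma IsMultiplier.one : IsMultiplier F (fun _ : Freq n => 1) 1 where
  bounded := ⟨1, fun _ => by simp⟩
  bound b _ M hM x := by simpa using hM x

lemma IsMultiplier.congr {m m' : Freq n → ℂ} {C C' : ℝ} (h : IsMultiplier F m C)
    (hm : ∀ ξ, m ξ = m' ξ) (hC : C = C') : IsMultiplier F m' C' := by
  rw [← funext hm, ← hC]
  exact h

lemma IsMultiplier.prod {ι : Type*} (s : Finset ι) {m : ι → Freq n → ℂ}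
    (h : ∀ k ∈ s, IsMultiplier F (m k) 1) : IsMultiplier F (fun ξ => ∏ k ∈ s, m k ξ) 1 := by
  classical
  induction s using Finset.induction_on with
  | empty => simpa using IsMultiplier.one
  | insert k s hk ih =>
    simp only [Finset.prod_insert hk]
    exact ((h k (Finset.mem_insert_self k s)).mul
      (ih fun l hl => h l (Finset.mem_insert_of_mem hl))).congr (fun _ => rfl) (mul_one 1)

variable [CompleteSpace F]

/-- The symbol of an average over translations in the `k`-th direction is a multiplier. -/
lemma isMultiplier_average {μ : Measure ℝ} {w : ℝ → ℝ} (hw : Integrable w μ) (ρ : ℝ) (k : Fin n) :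
    IsMultiplier F (fun ξ => ∫ y, (w y : ℂ) * Complex.exp (Complex.I * ((ξ k * (ρ * y) : ℝ) : ℂ)) ∂μ)
      (∫ y, |w y| ∂μ) where
  bounded := by
    refine ⟨∫ y, |w y| ∂μ, fun ξ => norm_integral_le_of_norm_le hw.abs (.of_forall fun y => ?_)⟩
    rw [norm_mul, mul_comm Complex.I, Complex.norm_exp_ofReal_mul_I, mul_one, Complex.norm_real,
      Real.norm_eq_abs]
  bound b hb M hM x := by
    let s : ℝ → Rn n := fun y => x + EuclideanSpace.single k (ρ * y)
    have hs : Continuous s := by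
      have : s = fun y => x + (ρ * y) • EuclideanSpace.single k (1 : ℝ) := by
        funext y
        ext l
        simp [s]
      rw [this]
      fun_prop
    have hi : ∀ ξ, Integrable (fun y => ((w y : ℂ) * character ξ (s y)) • b ξ) μ := fun ξ => by
      refine Integrable.smul_const ?_ _
      refine hw.ofReal.mul_of_top_left ?_
      refine memLp_top_of_bound ((continuous_character ξ).comp hs).aestronglyMeasurable 1
        (.of_forall fun y => ?_)
      simp [norm_character]
    have hsum := hasSum_integral_of_summable_integral_norm hi (by
      have : ∀ ξ, ∫ y, ‖((w y : ℂ) * character ξ (s y)) • b ξ‖ ∂μ = (∫ y, |w y| ∂μ) * ‖b ξ‖ := by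
        intro ξ
        rw [← integral_mul_const]
        refine integral_congr_ae (.of_forall fun y => ?_)
        beta_reduce
        rw [norm_smul, norm_mul, norm_character, mul_one, Complex.norm_real, Real.norm_eq_abs]
      simp only [this]
      exact hb.mul_left _)
    have h1 : synth (fun ξ => (∫ y, (w y : ℂ) *
        Complex.exp (Complex.I * ((ξ k * (ρ * y) : ℝ) : ℂ)) ∂μ) • b ξ) x =
        ∫ y, (w y : ℂ) • synth b (s y) ∂μ := by
      rw [synth]
      refine Eq.trans ?_ (hsum.tsum_eq.trans ?_)
      · refine tsum_congr fun ξ => ?_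
        rw [integral_smul_const, smul_smul, ← integral_const_mul]
        congr 2
        funext y
        rw [character_add_right, character_single]
        ring
      · refine integral_congr_ae (.of_forall fun y => ?_)
        beta_reduce
        simp only [mul_smul]
        rw [tsum_const_smul'']
        rfl
    rw [h1, ← integral_mul_const]
    refine norm_integral_le_of_norm_le (hw.abs.mul_const M) (.of_forall fun y => ?_)
    rw [norm_smul, Complex.norm_real, Real.norm_eq_abs]
    gcongr
    exact hM _

end

section Gaussian

open ProbabilityTheory

lemma integral_gaussian_exp (t : ℝ) :
    ∫ y, Complex.exp (Complex.I * ((t * y : ℝ) : ℂ)) ∂gaussianReal 0 1 =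
      Complex.exp (-(t : ℂ) ^ 2 / 2) := by
  have h := complexMGF_id_gaussianReal (μ := 0) (v := 1) (Complex.I * t)
  rw [complexMGF] at h
  simp only [id] at h
  convert h using 2
  · funext y
    push_cast
    ring_nf
  · simp [mul_pow]

lemma integral_gaussian_mul_exp (t : ℝ) :
    ∫ y, (y : ℂ) * Complex.exp (Complex.I * ((t * y : ℝ) : ℂ)) ∂gaussianReal 0 1 =
      Complex.I * t * Complex.exp (-(t : ℂ) ^ 2 / 2) := by
  have h := hasDerivAt_complexMGF (X := id) (μ := gaussianReal 0 1) (z := Complex.I * t)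
    (by simp [integrableExpSet_id_gaussianReal])
  have h2 : complexMGF id (gaussianReal 0 1) = fun z => Complex.exp (z ^ 2 / 2) := by
    funext z
    rw [complexMGF_id_gaussianReal]
    simp
  rw [h2] at h
  have h3 : HasDerivAt (fun z : ℂ => Complex.exp (z ^ 2 / 2))
      (Complex.exp ((Complex.I * t) ^ 2 / 2) * (2 * (Complex.I * t) / 2)) (Complex.I * t) := by
    have := (((hasDerivAt_id (Complex.I * (t : ℂ))).pow 2).div_const 2).cexp
    simpa using this
  have h4 := h.unique h3
  simp only [id] at h4
  convert h4 using 1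
  · refine integral_congr_ae (.of_forall fun y => ?_)
    push_cast
    ring_nf
  · rw [mul_pow, Complex.I_sq, neg_one_mul]
    ring

lemma integral_gaussian_abs_le : ∫ y, |y| ∂gaussianReal 0 1 ≤ 1 := by
  have h2 : MemLp id 2 (gaussianReal 0 1) := by
    simpa using memLp_id_gaussianReal (μ := 0) (v := 1) 2
  have hsq : Integrable (fun y : ℝ => y ^ 2) (gaussianReal 0 1) := h2.integrable_sq
  have hv : ∫ y, y ^ 2 ∂gaussianReal 0 1 = 1 := by
    have := variance_eq_integral (X := id) (μ := gaussianReal 0 1) aemeasurable_id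
    rw [variance_id_gaussianReal] at this
    simpa [integral_id_gaussianReal] using this.symm
  have habs : Integrable (fun y : ℝ => |y|) (gaussianReal 0 1) :=
    (h2.integrable one_le_two).abs
  calc ∫ y, |y| ∂gaussianReal 0 1 ≤ ∫ y, (1 + y ^ 2) / 2 ∂gaussianReal 0 1 := by
        refine integral_mono habs (((integrable_const 1).add hsq).div_const 2) fun y => ?_
        beta_reduce
        nlinarith [sq_nonneg (|y| - 1), sq_abs y]
    _ = 1 := by
        rw [integral_div, integral_add (integrable_const 1) hsq, hv]
        simp

variable {F : Type*} [NormedAddCommGroup F] [NormedSpace ℂ F] [CompleteSpace F]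

lemma isMultiplier_exp_sq {r : ℝ} (hr : 0 ≤ r) (k : Fin n) :
    IsMultiplier F (fun ξ : Freq n => (Real.exp (-r * (ξ k : ℝ) ^ 2) : ℂ)) 1 := by
  refine (isMultiplier_average (μ := gaussianReal 0 1) (w := fun _ => 1) (integrable_const 1)
    (√(2 * r)) k).congr (fun ξ => ?_) (by simp)
  have := integral_gaussian_exp (ξ k * √(2 * r))
  simp only [Complex.ofReal_one, one_mul]
  simp only [mul_assoc] at this ⊢
  rw [this, ← Complex.ofReal_pow, mul_pow, Real.sq_sqrt (by positivity), Complex.ofReal_exp]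
  congr 1
  push_cast
  ring

lemma isMultiplier_mul_exp_sq {r : ℝ} (hr : 0 < r) (k : Fin n) :
    IsMultiplier F (fun ξ : Freq n => Complex.I * ξ k * (Real.exp (-r * (ξ k : ℝ) ^ 2) : ℂ))
      (√r)⁻¹ := by
  have hi : Integrable (fun y : ℝ => y) (gaussianReal 0 1) := by
    have : MemLp id 1 (gaussianReal 0 1) := by
      simpa using memLp_id_gaussianReal (μ := 0) (v := 1) 1
    exact this.integrable le_rfl
  have h := isMultiplier_average (F := F) hi (√(2 * r)) k
  have hρ : 0 < √(2 * r) := by positivity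
  have h1 : ∀ ξ : Freq n, ∫ y, (y : ℂ) * Complex.exp (Complex.I *
      ((ξ k * (√(2 * r) * y) : ℝ) : ℂ)) ∂gaussianReal 0 1 =
      (√(2 * r) : ℂ) * (Complex.I * ξ k * (Real.exp (-r * (ξ k : ℝ) ^ 2) : ℂ)) := fun ξ => by
    have := integral_gaussian_mul_exp (ξ k * √(2 * r))
    simp only [mul_assoc] at this ⊢
    rw [this, ← Complex.ofReal_pow, mul_pow, Real.sq_sqrt (by positivity), Complex.ofReal_exp]
    have h2 : (-(((ξ k : ℝ) ^ 2 * (2 * r) : ℝ) : ℂ) / 2) = ((-r * (ξ k : ℝ) ^ 2 : ℝ) : ℂ) := by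
      push_cast
      ring
    rw [h2]
    push_cast
    ring
  simp only [h1] at h
  have hρ' : (√(2 * r) : ℂ) ≠ 0 := by exact_mod_cast hρ.ne'
  constructor
  · obtain ⟨K, hK⟩ := h.bounded
    refine ⟨(√(2 * r))⁻¹ * K, fun ξ => ?_⟩
    have := hK ξ
    rw [norm_mul, Complex.norm_real, Real.norm_of_nonneg hρ.le] at this
    rwa [inv_mul_eq_div, le_div_iff₀' hρ]
  · intro b hb M hM x
    have h0 : 0 ≤ M := (norm_nonneg _).trans (hM 0)
    have h2 := h.bound b hb M hM x
    simp only [mul_smul (√(2 * r) : ℂ)] at h2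
    have h3 : synth (fun ξ => (√(2 * r) : ℂ) •
        (Complex.I * ξ k * (Real.exp (-r * (ξ k : ℝ) ^ 2) : ℂ)) • b ξ) x =
        (√(2 * r) : ℂ) • synth (fun ξ =>
          (Complex.I * ξ k * (Real.exp (-r * (ξ k : ℝ) ^ 2) : ℂ)) • b ξ) x := by
      rw [synth, synth, ← tsum_const_smul'']
      exact tsum_congr fun ξ => smul_comm _ _ _
    rw [h3, norm_smul, Complex.norm_real, Real.norm_of_nonneg hρ.le] at h2
    have h4 : √(2 * r) * ‖synth (fun ξ =>
          (Complex.I * ξ k * (Real.exp (-r * (ξ k : ℝ) ^ 2) : ℂ)) • b ξ) x‖ ≤ M :=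
      h2.trans ((mul_le_mul_of_nonneg_right integral_gaussian_abs_le h0).trans_eq (one_mul M))
    have h5 : √r ≤ √(2 * r) := Real.sqrt_le_sqrt (by linarith)
    rw [inv_mul_eq_div, le_div_iff₀' (by positivity)]
    exact (mul_le_mul_of_nonneg_right h5 (norm_nonneg _)).trans h4

lemma heat_eq_prod (r : ℝ) (ξ : Freq n) :
    heat r ξ = ∏ k, (Real.exp (-r * (ξ k : ℝ) ^ 2) : ℂ) := by
  rw [heat, lenSq, Finset.mul_sum, Real.exp_sum, Complex.ofReal_prod]

lemma heat_add (r t : ℝ) (ξ : Freq n) : heat (r + t) ξ = heat r ξ * heat t ξ := by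
  rw [heat, heat, heat, ← Complex.ofReal_mul, ← Real.exp_add]
  congr 2
  ring

lemma norm_heat (t : ℝ) (ξ : Freq n) : ‖heat t ξ‖ = Real.exp (-t * lenSq ξ) := by
  rw [heat, Complex.norm_real, Real.norm_of_nonneg (Real.exp_pos _).le]

lemma norm_heat_le {t : ℝ} (ht : 0 ≤ t) (ξ : Freq n) : ‖heat t ξ‖ ≤ 1 := by
  rw [norm_heat, Real.exp_le_one_iff]
  nlinarith [lenSq_nonneg ξ]

/-- The heat semigroup is a contraction for the supremum norm. -/
lemma isMultiplier_heat {r : ℝ} (hr : 0 ≤ r) : IsMultiplier F (heat (n := n) r) 1 :=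
  (IsMultiplier.prod Finset.univ fun k _ => isMultiplier_exp_sq hr k).congr
    (fun ξ => (heat_eq_prod r ξ).symm) rfl

/-- `‖D_k e^{rΔ}‖ ≤ r^{-1/2}` for the supremum norm. -/
lemma isMultiplier_deriv_heat {r : ℝ} (hr : 0 < r) (k : Fin n) :
    IsMultiplier F (fun ξ : Freq n => Complex.I * ξ k * heat r ξ) (√r)⁻¹ := by
  classical
  refine ((isMultiplier_mul_exp_sq hr k).mul (IsMultiplier.prod (Finset.univ.erase k)
    fun l _ => isMultiplier_exp_sq hr.le l)).congr (fun ξ => ?_) (mul_one _)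
  rw [heat_eq_prod, ← Finset.mul_prod_erase _ _ (Finset.mem_univ k), mul_assoc]

lemma isMultiplier_word_heat {r : ℝ} (hr : 0 < r) (w : List (Fin n)) :
    IsMultiplier F (fun ξ : Freq n => wordSymbol w ξ * heat (w.length * r) ξ)
      ((√r)⁻¹ ^ w.length) := by
  induction w with
  | nil => exact IsMultiplier.one.congr (fun ξ => by simp [wordSymbol, heat]) (by simp)
  | cons k w ih =>
    refine ((isMultiplier_deriv_heat hr k).mul ih).congr (fun ξ => ?_) ?_
    · have : ((k :: w).length : ℝ) * r = r + w.length * r := by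
        push_cast [List.length_cons]
        ring
      rw [this, heat_add, wordSymbol, wordSymbol, List.map_cons, List.prod_cons]
      ring
    · rw [List.length_cons, pow_succ']

lemma norm_wordSymbol_le (w : List (Fin n)) (ξ : Freq n) :
    ‖wordSymbol w ξ‖ ≤ √(lenSq ξ) ^ w.length := by
  induction w with
  | nil => simp [wordSymbol]
  | cons k w ih =>
    rw [wordSymbol, List.map_cons, List.prod_cons, norm_mul, List.length_cons, pow_succ', norm_mul,
      Complex.norm_I, one_mul, Complex.norm_intCast]
    exact mul_le_mul (Real.abs_le_sqrt (sq_le_lenSq ξ k)) ih (norm_nonneg _) (Real.sqrt_nonneg _)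

lemma wordSymbol_zero {w : List (Fin n)} (hw : w ≠ []) : wordSymbol w (0 : Freq n) = 0 := by
  cases w with
  | nil => exact absurd rfl hw
  | cons k w => simp [wordSymbol]

lemma sqrt_mul_exp_le {t : ℝ} (ht : 0 < t) {a : ℝ} (ha : 0 ≤ a) :
    √a * Real.exp (-t * a) ≤ 1 + t⁻¹ := by
  have h1 : √a ≤ 1 + a := by
    nlinarith [Real.sq_sqrt ha, sq_nonneg (√a - 1), Real.sqrt_nonneg a]
  have h2 : Real.exp (-t * a) ≤ 1 := by
    rw [Real.exp_le_one_iff]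
    nlinarith
  have h3 : a * Real.exp (-t * a) ≤ t⁻¹ := by
    rw [neg_mul, Real.exp_neg, ← div_eq_mul_inv, div_le_iff₀ (Real.exp_pos _), inv_mul_eq_div,
      le_div_iff₀ ht]
    linarith [Real.add_one_le_exp (t * a)]
  calc √a * Real.exp (-t * a) ≤ (1 + a) * Real.exp (-t * a) := by gcongr
    _ = Real.exp (-t * a) + a * Real.exp (-t * a) := by ring
    _ ≤ _ := add_le_add h2 h3

/-- Third derivatives of `Δ⁻¹ e^{tΔ}`: since `|ξ|⁻² e^{-t|ξ|²} = ∫_t^∞ e^{-s|ξ|²} ds`, the bound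
`s^{-3/2}` for third derivatives of `e^{sΔ}` can be integrated. -/
lemma isMultiplier_word_div_heat {t : ℝ} (ht : 0 < t) {w : List (Fin n)} (hw : w.length = 3) :
    IsMultiplier F (fun ξ : Freq n => wordSymbol w ξ / lenSq ξ * heat t ξ) (12 * (√t)⁻¹) := by
  have hnil : w ≠ [] := fun h => by simp [h] at hw
  have hint : ∀ ξ : Freq n, ξ ≠ 0 → ∫ s in Ioi t, Real.exp (-s * lenSq ξ) =
      Real.exp (-t * lenSq ξ) / lenSq ξ := fun ξ hξ => by
    have hpos : 0 < lenSq ξ := (lenSq_nonneg ξ).lt_of_ne' (lenSq_eq_zero.not.2 hξ)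
    have h : ∀ s, -s * lenSq ξ = -lenSq ξ * s := fun s => by ring
    simp only [h]
    rw [integral_exp_mul_Ioi (neg_lt_zero.2 hpos) t, neg_div_neg_eq]
  have hintegrable : ∀ ξ : Freq n, ξ ≠ 0 →
      IntegrableOn (fun s => Real.exp (-s * lenSq ξ)) (Ioi t) := fun ξ hξ => by
    have hpos : 0 < lenSq ξ := (lenSq_nonneg ξ).lt_of_ne' (lenSq_eq_zero.not.2 hξ)
    have h : ∀ s, -s * lenSq ξ = -lenSq ξ * s := fun s => by ring
    simp only [h]
    exact integrableOn_exp_mul_Ioi (neg_lt_zero.2 hpos) t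
  have hK : ∀ ξ : Freq n, ‖wordSymbol w ξ‖ * (Real.exp (-t * lenSq ξ) / lenSq ξ) ≤ 1 + t⁻¹ := by
    intro ξ
    rcases eq_or_ne ξ 0 with rfl | hξ
    · simp only [wordSymbol_zero hnil, norm_zero, zero_mul]
      positivity
    have hpos : 0 < lenSq ξ := (lenSq_nonneg ξ).lt_of_ne' (lenSq_eq_zero.not.2 hξ)
    refine le_trans ?_ (sqrt_mul_exp_le ht hpos.le)
    have h1 := norm_wordSymbol_le w ξ
    rw [hw, pow_succ', Real.sq_sqrt hpos.le] at h1
    calc _ ≤ √(lenSq ξ) * lenSq ξ * (Real.exp (-t * lenSq ξ) / lenSq ξ) := by gcongr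
      _ = _ := by field_simp
  constructor
  · refine ⟨1 + t⁻¹, fun ξ => le_trans (le_of_eq ?_) (hK ξ)⟩
    rw [norm_mul, norm_div, norm_heat, Complex.norm_real, Real.norm_of_nonneg (lenSq_nonneg ξ)]
    ring
  intro b hb M hM x
  have h0 : 0 ≤ M := (norm_nonneg _).trans (hM 0)
  let G : Freq n → ℝ → F := fun ξ s =>
    Real.exp (-s * lenSq ξ) • (character ξ x • wordSymbol w ξ • b ξ)
  have hG0 : ∀ s, G 0 s = 0 := fun s => by simp [G, wordSymbol_zero hnil]
  have hi : ∀ ξ, Integrable (G ξ) (volume.restrict (Ioi t)) := fun ξ => by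
    rcases eq_or_ne ξ 0 with rfl | hξ
    · rw [funext hG0]
      exact integrable_zero _ _ _
    · exact (hintegrable ξ hξ).integrable.smul_const _
  have hn : ∀ ξ, ∫ s in Ioi t, ‖G ξ s‖ ≤ (1 + t⁻¹) * ‖b ξ‖ := fun ξ => by
    rcases eq_or_ne ξ 0 with rfl | hξ
    · simp only [hG0, norm_zero, integral_zero]
      positivity
    · have : ∀ s, ‖G ξ s‖ = Real.exp (-s * lenSq ξ) * (‖wordSymbol w ξ‖ * ‖b ξ‖) := fun s => by
        rw [norm_smul, norm_smul, norm_smul, norm_character, one_mul,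
          Real.norm_of_nonneg (Real.exp_pos _).le]
      simp only [this]
      rw [integral_mul_const, hint ξ hξ]
      calc _ = ‖wordSymbol w ξ‖ * (Real.exp (-t * lenSq ξ) / lenSq ξ) * ‖b ξ‖ := by ring
        _ ≤ _ := by
          gcongr
          exact hK ξ
  have hsum := hasSum_integral_of_summable_integral_norm hi
    (.of_nonneg_of_le (fun ξ => integral_nonneg fun s => norm_nonneg _) hn (hb.mul_left _))
  have h1 : synth (fun ξ => (wordSymbol w ξ / lenSq ξ * heat t ξ) • b ξ) x =
      ∫ s in Ioi t, ∑' ξ, G ξ s := by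
    rw [← hsum.tsum_eq, synth]
    refine tsum_congr fun ξ => ?_
    rcases eq_or_ne ξ 0 with rfl | hξ
    · simp [hG0, wordSymbol_zero hnil]
    · rw [integral_smul_const, hint ξ hξ, ← Complex.coe_smul, smul_smul, smul_smul, smul_smul, heat]
      congr 1
      push_cast
      ring
  have h2 : ∀ s ∈ Ioi t, ‖∑' ξ, G ξ s‖ ≤ 6 * M * s ^ (-3 / 2 : ℝ) := by
    intro s hs
    have hs0 : 0 < s := ht.trans hs
    have h3 := (isMultiplier_word_heat (F := F) (by positivity : 0 < s / 3) w).bound b hb M hM x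
    have h4 : synth (fun ξ => (wordSymbol w ξ * heat (w.length * (s / 3)) ξ) • b ξ) x =
        ∑' ξ, G ξ s := by
      rw [synth]
      refine tsum_congr fun ξ => ?_
      have : ((w.length : ℕ) : ℝ) * (s / 3) = s := by
        rw [hw]
        push_cast
        ring
      simp only [this, G]
      rw [← Complex.coe_smul, smul_smul, smul_smul, smul_smul, heat]
      congr 1
      ring
    rw [h4, hw] at h3
    refine h3.trans ?_
    have h5 : s ^ (-3 / 2 : ℝ) = (√s)⁻¹ ^ 3 := by
      rw [Real.sqrt_eq_rpow, ← Real.rpow_neg hs0.le, ← Real.rpow_natCast, ← Real.rpow_mul hs0.le]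
      norm_num
    have h6 : (√(s / 3))⁻¹ ^ 3 ≤ 6 * (√s)⁻¹ ^ 3 := by
      rw [Real.sqrt_div hs0.le, inv_div, div_eq_mul_inv, mul_pow]
      gcongr
      have h7 : √3 ≤ 1.8 := by
        rw [Real.sqrt_le_left (by norm_num)]
        norm_num
      calc √3 ^ 3 ≤ (1.8 : ℝ) ^ 3 := by gcongr
        _ ≤ 6 := by norm_num
    rw [h5]
    nlinarith
  rw [h1]
  refine (norm_integral_le_of_norm_le
    ((integrableOn_Ioi_rpow_of_lt (by norm_num : (-3 / 2 : ℝ) < -1) ht).integrable.const_mul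
      (6 * M)) ((ae_restrict_iff' measurableSet_Ioi).2 (.of_forall h2))).trans_eq ?_
  rw [integral_const_mul, integral_Ioi_rpow_of_lt (by norm_num) ht]
  have h8 : t ^ (-3 / 2 + 1 : ℝ) = (√t)⁻¹ := by
    rw [Real.sqrt_eq_rpow, ← Real.rpow_neg ht.le]
    norm_num
  rw [h8]
  ring

end Gaussian

section Leray

/-- The symbol `v ↦ v - |ξ|⁻² (ξ·v) ξ` of the Leray projector; at `ξ = 0` it is the identity, since
`0⁻¹ = 0`. -/
def lerayCoef (ξ : Freq n) (v : Cn n) : Cn n :=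
  WithLp.toLp 2 fun k => v k - (∑ l, (ξ l : ℂ) * v l) / (lenSq ξ : ℂ) * ξ k

/-- The matrix unit `v ↦ v_l e_k`. -/
def matrixUnit (k l : Fin n) : Cn n →L[ℂ] Cn n :=
  (EuclideanSpace.proj l : Cn n →L[ℂ] ℂ).smulRight (EuclideanSpace.single k (1 : ℂ))

lemma matrixUnit_apply (k l : Fin n) (v : Cn n) :
    matrixUnit k l v = EuclideanSpace.single k (v l) := by
  ext m
  simp [matrixUnit]

lemma norm_matrixUnit_le (k l : Fin n) (v : Cn n) : ‖matrixUnit k l v‖ ≤ ‖v‖ := by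
  rw [matrixUnit_apply, PiLp.norm_single]
  exact PiLp.norm_apply_le v l

lemma lerayCoef_eq (ξ : Freq n) (v : Cn n) : lerayCoef ξ v =
    v - ∑ k, ∑ l, ((ξ k : ℂ) * ξ l / (lenSq ξ : ℂ)) • matrixUnit k l v := by
  ext m
  simp only [lerayCoef, matrixUnit_apply, PiLp.sub_apply, WithLp.ofLp_sum, Finset.sum_apply,
    PiLp.smul_apply, PiLp.single_apply, smul_eq_mul, mul_ite, mul_zero]
  rw [Finset.sum_comm]
  simp only [Finset.sum_ite_eq, Finset.mem_univ, if_true]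
  rw [Finset.sum_div, Finset.sum_mul]
  congr 1
  exact Finset.sum_congr rfl fun l _ => by ring

lemma norm_coef_div_le (ξ : Freq n) (k l : Fin n) :
    ‖(ξ k : ℂ) * ξ l / (lenSq ξ : ℂ)‖ ≤ 1 := by
  rw [norm_div, norm_mul, Complex.norm_intCast, Complex.norm_intCast, Complex.norm_real,
    Real.norm_of_nonneg (lenSq_nonneg ξ)]
  refine div_le_one_of_le₀ ?_ (lenSq_nonneg ξ)
  calc |(ξ k : ℝ)| * |(ξ l : ℝ)| ≤ √(lenSq ξ) * √(lenSq ξ) :=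
        mul_le_mul (Real.abs_le_sqrt (sq_le_lenSq ξ k)) (Real.abs_le_sqrt (sq_le_lenSq ξ l))
          (abs_nonneg _) (Real.sqrt_nonneg _)
    _ = lenSq ξ := Real.mul_self_sqrt (lenSq_nonneg ξ)

lemma norm_lerayCoef_le (ξ : Freq n) (v : Cn n) : ‖lerayCoef ξ v‖ ≤ (1 + n ^ 2) * ‖v‖ := by
  rw [lerayCoef_eq]
  refine (norm_sub_le _ _).trans ?_
  have : ∀ k ∈ Finset.univ, ‖∑ l, ((ξ k : ℂ) * ξ l / (lenSq ξ : ℂ)) • matrixUnit k l v‖ ≤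
      n * ‖v‖ := fun k _ => by
    refine (norm_sum_le_of_le (f := fun l => _) (n := fun _ => ‖v‖) _ fun l _ => ?_).trans_eq
      (by simp)
    rw [norm_smul]
    exact (mul_le_mul (norm_coef_div_le ξ k l) (norm_matrixUnit_le k l v) (norm_nonneg _)
      zero_le_one).trans_eq (one_mul _)
  have h2 := norm_sum_le_of_le _ this
  rw [Finset.sum_const, Finset.card_univ, Fintype.card_fin, nsmul_eq_mul] at h2
  linarith

/-- The symbol of `D_i ℙ`. -/
def lerayDeriv (i : Fin n) (ξ : Freq n) (v : Cn n) : Cn n :=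
  (Complex.I * ξ i) • lerayCoef ξ v

/-- The constant in the bound for `D_i ℙ e^{tΔ}`. -/
def lerayConst (n : ℕ) : ℝ := 1 + 12 * n ^ 2

lemma lerayConst_pos (n : ℕ) : 0 < lerayConst n := by
  unfold lerayConst
  positivity

/-- `‖D_i ℙ e^{tΔ}‖ ≤ C t^{-1/2}` for the supremum norm. -/
lemma norm_synth_lerayDeriv_heat_le {t : ℝ} (ht : 0 < t) (i : Fin n) {b : Freq n → Cn n}
    (hb : Summable fun ξ => ‖b ξ‖) {M : ℝ} (hM : ∀ x, ‖synth b x‖ ≤ M) (x : Rn n) :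
    ‖synth (fun ξ => heat t ξ • lerayDeriv i ξ (b ξ)) x‖ ≤ lerayConst n * (√t)⁻¹ * M := by
  have hA : ∀ k l, Summable fun ξ => ‖matrixUnit k l (b ξ)‖ := fun k l =>
    .of_nonneg_of_le (fun _ => norm_nonneg _) (fun ξ => norm_matrixUnit_le k l (b ξ)) hb
  have hAM : ∀ k l x, ‖synth (fun ξ => matrixUnit k l (b ξ)) x‖ ≤ M := fun k l x => by
    rw [← clm_synth _ hb]
    exact (norm_matrixUnit_le k l _).trans (hM x)
  have h1 := isMultiplier_deriv_heat (F := Cn n) ht i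
  have h2 := fun k l => isMultiplier_word_div_heat (F := Cn n) ht (w := [i, k, l]) rfl
  have key : synth (fun ξ => heat t ξ • lerayDeriv i ξ (b ξ)) x =
      synth (fun ξ => (Complex.I * ξ i * heat t ξ) • b ξ) x + ∑ k, ∑ l,
        synth (fun ξ => (wordSymbol [i, k, l] ξ / lenSq ξ * heat t ξ) • matrixUnit k l (b ξ)) x := by
    have hs := fun k l => summable_synth ((h2 k l).summable (hA k l)) x
    have e1 : ∀ k, ∑ l, synth (fun ξ => (wordSymbol [i, k, l] ξ / lenSq ξ * heat t ξ) •
        matrixUnit k l (b ξ)) x = ∑' ξ, ∑ l, character ξ x •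
          (wordSymbol [i, k, l] ξ / lenSq ξ * heat t ξ) • matrixUnit k l (b ξ) := fun k =>
      (Summable.tsum_finsetSum fun l _ => hs k l).symm
    simp only [e1]
    rw [← Summable.tsum_finsetSum fun k _ => summable_sum fun l _ => hs k l, synth, synth,
      ← (summable_synth (h1.summable hb) x).tsum_add
        (summable_sum fun k _ => summable_sum fun l _ => hs k l)]
    refine tsum_congr fun ξ => ?_
    simp only [← Finset.smul_sum, ← smul_add]
    congr 1
    rw [lerayDeriv, lerayCoef_eq, smul_sub, smul_sub, sub_eq_add_neg]
    congr 1
    · rw [smul_smul, mul_comm]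
    · simp only [Finset.smul_sum, ← Finset.sum_neg_distrib]
      refine Finset.sum_congr rfl fun k _ => Finset.sum_congr rfl fun l _ => ?_
      rw [smul_smul, smul_smul, ← neg_smul]
      congr 1
      simp only [wordSymbol, List.map_cons, List.map_nil, List.prod_cons, List.prod_nil, mul_one]
      linear_combination (heat t ξ * (Complex.I * ξ i) * (ξ k * ξ l / lenSq ξ)) *
        (-Complex.I_sq)
  rw [key]
  refine (norm_add_le _ _).trans ?_
  have h3 : ∀ k ∈ Finset.univ, ‖∑ l, synth (fun ξ => (wordSymbol [i, k, l] ξ / lenSq ξ *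
      heat t ξ) • matrixUnit k l (b ξ)) x‖ ≤ n * (12 * (√t)⁻¹ * M) := fun k _ => by
    refine (norm_sum_le_of_le (n := fun _ => 12 * (√t)⁻¹ * M) _ fun l _ => ?_).trans_eq (by simp)
    exact (h2 k l).bound _ (hA k l) M (hAM k l) x
  have h4 := norm_sum_le_of_le _ h3
  rw [Finset.sum_const, Finset.card_univ, Fintype.card_fin, nsmul_eq_mul] at h4
  have h5 := h1.bound b hb M hM x
  calc _ ≤ (√t)⁻¹ * M + n * (n * (12 * (√t)⁻¹ * M)) := add_le_add h5 h4
    _ = _ := by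
      rw [lerayConst]
      ring

end Leray

end PeriodicModel

namespace PeriodicModel

/-! ### The evolution equation for the Fourier coefficients -/

variable {n : ℕ}

/-- The coefficients of the iterated partial derivative given by the word `w`. -/
def wordCoef {F : Type*} [NormedAddCommGroup F] [NormedSpace ℂ F] (w : List (Fin n))
    (b : Freq n → F) : Freq n → F := fun ξ => wordSymbol w ξ • b ξ

lemma norm_wordSymbol_le_pow (w : List (Fin n)) (ξ : Freq n) :
    ‖wordSymbol w ξ‖ ≤ (1 + ‖ξ‖) ^ w.length := by
  induction w with
  | nil => simp [wordSymbol]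
  | cons k w ih =>
    rw [wordSymbol, List.map_cons, List.prod_cons, norm_mul, List.length_cons, pow_succ', norm_mul,
      Complex.norm_I, one_mul, Complex.norm_intCast]
    exact mul_le_mul ((abs_le_norm ξ k).trans (by linarith)) ih (norm_nonneg _) (by positivity)

section

variable {F : Type*} [NormedAddCommGroup F] [NormedSpace ℂ F] {T : Type*}

lemma RapidOn.wordCoef {S : Set T} {a : T → Freq n → F} (ha : RapidOn S a) (w : List (Fin n)) :
    RapidOn S (fun t => PeriodicModel.wordCoef w (a t)) :=
  ha.of_le 1 w.length fun t _ ξ => by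
    rw [PeriodicModel.wordCoef, norm_smul, one_mul]
    exact mul_le_mul_of_nonneg_right (norm_wordSymbol_le_pow w ξ) (norm_nonneg _)

lemma Rapid.wordCoef {b : Freq n → F} (hb : Rapid b) (w : List (Fin n)) :
    Rapid (wordCoef w b) := rapidOn_unit.1 <| (rapidOn_unit.2 hb).wordCoef w

lemma wordCoef_cons (k : Fin n) (w : List (Fin n)) (b : Freq n → F) :
    wordCoef (k :: w) b = wordCoef w (derivCoef k b) := by
  funext ξ
  simp only [wordCoef, derivCoef, wordSymbol, List.map_cons, List.prod_cons, smul_smul, mul_comm]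

lemma wordCoef_nil (b : Freq n → F) : wordCoef [] b = b := by
  funext ξ
  simp [wordCoef, wordSymbol]

/-- Leibniz' rule for supremum norms. -/
lemma norm_synth_wordCoef_conv_le [CompleteSpace F] (B : F →L[ℂ] F →L[ℂ] F) (w : List (Fin n))
    {a b : Freq n → F} (ha : Rapid a) (hb : Rapid b) (V W : ℕ → ℝ)
    (hV : ∀ v : List (Fin n), v.length ≤ w.length → ∀ x, ‖synth (wordCoef v a) x‖ ≤ V v.length)
    (hW : ∀ v : List (Fin n), v.length ≤ w.length → ∀ x, ‖synth (wordCoef v b) x‖ ≤ W v.length)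
    (x : Rn n) : ‖synth (wordCoef w (conv B a b)) x‖ ≤
      ‖B‖ * ∑ p ∈ Finset.range (w.length + 1), (w.length.choose p : ℝ) *
        (V p * W (w.length - p)) := by
  induction w generalizing a b V W with
  | nil =>
    have h1 := hV [] le_rfl x
    have h2 := hW [] le_rfl x
    rw [wordCoef_nil] at h1 h2 ⊢
    rw [synth_conv B ha.summable_norm hb.summable_norm]
    refine (B.le_opNorm₂ _ _).trans ?_
    simp only [List.length_nil, zero_add, Finset.range_one, Finset.sum_singleton, Nat.choose_self,
      Nat.cast_one, one_mul, Nat.sub_self]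
    rw [mul_assoc]
    refine mul_le_mul_of_nonneg_left ?_ B.opNorm_nonneg
    exact mul_le_mul h1 h2 (norm_nonneg _) ((norm_nonneg _).trans h1)
  | cons k w ih =>
    have hlen : (k :: w).length = w.length + 1 := List.length_cons
    have e : wordCoef (k :: w) (conv B a b) = fun ξ => wordCoef w (conv B (derivCoef k a) b) ξ +
        wordCoef w (conv B a (derivCoef k b)) ξ := by
      rw [wordCoef_cons, derivCoef_conv B ha hb]
      funext ξ
      simp only [wordCoef, smul_add]
    have hVk : ∀ v : List (Fin n), v.length ≤ w.length → ∀ x,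
        ‖synth (wordCoef v (derivCoef k a)) x‖ ≤ V (v.length + 1) := fun v hv x => by
      rw [← wordCoef_cons]
      exact hV (k :: v) (by simpa using hv) x
    have hWk : ∀ v : List (Fin n), v.length ≤ w.length → ∀ x,
        ‖synth (wordCoef v (derivCoef k b)) x‖ ≤ W (v.length + 1) := fun v hv x => by
      rw [← wordCoef_cons]
      exact hW (k :: v) (by simpa using hv) x
    have h1 := ih (ha.derivCoef k) hb (fun p => V (p + 1)) W hVk fun v hv => hW v (by omega)
    have h2 := ih ha (hb.derivCoef k) V (fun p => W (p + 1)) (fun v hv => hV v (by omega)) hWk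
    rw [e, synth_add (((ha.derivCoef k).conv B hb).wordCoef w).summable_norm
      ((ha.conv B (hb.derivCoef k)).wordCoef w).summable_norm]
    refine (norm_add_le _ _).trans ((add_le_add h1 h2).trans_eq ?_)
    rw [hlen, Finset.sum_choose_succ_mul (fun p q => V p * W q) w.length, mul_add, add_comm]
    congr 2
    refine Finset.sum_congr rfl fun p hp => ?_
    have : w.length + 1 - p = w.length - p + 1 := by
      have := Finset.mem_range.1 hp
      omega
    rw [this]

end

lemma lerayDeriv_smul (i : Fin n) (ξ : Freq n) (c : ℂ) (v : Cn n) :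
    lerayDeriv i ξ (c • v) = c • lerayDeriv i ξ v := by
  simp only [lerayDeriv, lerayCoef_eq, map_smul, smul_sub, Finset.smul_sum, smul_smul, mul_comm,
    mul_left_comm]

lemma continuous_lerayDeriv (i : Fin n) (ξ : Freq n) : Continuous (lerayDeriv i ξ) := by
  unfold lerayDeriv
  simp only [lerayCoef_eq]
  fun_prop

lemma norm_lerayDeriv_le (i : Fin n) (ξ : Freq n) (v : Cn n) :
    ‖lerayDeriv i ξ v‖ ≤ (1 + n ^ 2) * (1 + ‖ξ‖) ^ 1 * ‖v‖ := by
  rw [lerayDeriv, norm_smul, norm_mul, Complex.norm_I, one_mul, Complex.norm_intCast, pow_one,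
    mul_comm (1 + (n : ℝ) ^ 2), mul_assoc]
  exact mul_le_mul ((abs_le_norm ξ i).trans (by linarith)) (norm_lerayCoef_le ξ v) (norm_nonneg _)
    (by positivity)

/-- Complex conjugation of the coordinates. -/
def conjC : Cn n →L[ℝ] Cn n :=
  LinearMap.toContinuousLinearMap
    { toFun := fun v => WithLp.toLp 2 fun k => (starRingEnd ℂ) (v k)
      map_add' := fun v w => by
        ext k
        simp
      map_smul' := fun c v => by
        ext k
        simp }

lemma conjC_apply (v : Cn n) (k : Fin n) : conjC v k = (starRingEnd ℂ) (v k) := rfl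

lemma conjC_smul (c : ℂ) (v : Cn n) : conjC (c • v) = (starRingEnd ℂ) c • conjC v := by
  ext k
  simp [conjC_apply]

/-- The coefficients of `D_i ℙ B(u, u)` in terms of the coefficients of `u`. -/
def nonlinearity (B : Cn n →L[ℂ] Cn n →L[ℂ] Cn n) (i : Fin n) (b : Freq n → Cn n) : Freq n → Cn n :=
  fun ξ => lerayDeriv i ξ (conv B b b ξ)

/-- The coefficients `a t ξ` of a smooth real solution of `u_t = Δu + D_i ℙ B(u, u)` on the closed
time interval `[0, τ]`, with one-sided time derivatives at the end points. The condition `real` says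
that `u` takes values in `ℝⁿ`. -/
structure IsMild (B : Cn n →L[ℂ] Cn n →L[ℂ] Cn n) (i : Fin n) (τ : ℝ) (a : ℝ → Freq n → Cn n) :
    Prop where
  rapid : RapidOn (Icc 0 τ) a
  deriv : ∀ ξ, ∀ t ∈ Icc 0 τ, HasDerivWithinAt (fun s => a s ξ)
    ((-(lenSq ξ : ℂ)) • a t ξ + nonlinearity B i (a t) ξ) (Icc 0 τ) t
  real : ∀ t ∈ Icc 0 τ, ∀ ξ, a t (-ξ) = conjC (a t ξ)

section Continuity

variable {F : Type*} [NormedAddCommGroup F] [NormedSpace ℂ F] [CompleteSpace F]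

lemma continuousOn_conv (B : F →L[ℂ] F →L[ℂ] F) {S : Set ℝ} {a b : ℝ → Freq n → F}
    (ha : RapidOn S a) (hb : RapidOn S b) (hac : ∀ ξ, ContinuousOn (fun s => a s ξ) S)
    (hbc : ∀ ξ, ContinuousOn (fun s => b s ξ) S) (ξ : Freq n) :
    ContinuousOn (fun s => conv B (a s) (b s) ξ) S := by
  obtain ⟨u, hu, hu0, hau⟩ := ha.exists_summable_norm
  obtain ⟨M, hM⟩ := hb 0
  refine continuousOn_tsum (u := fun η => ‖B‖ * u η * M) (fun η => ?_)
    ((hu.mul_left _).mul_right _) fun η s hs => ?_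
  · exact (B.continuous.comp_continuousOn (hac η)).clm_apply (hbc _)
  · refine (B.le_opNorm₂ _ _).trans ?_
    have h1 := hau s hs η
    have h2 := hM s hs (ξ - η)
    rw [pow_zero, one_mul] at h2
    have := hu0 η
    gcongr

lemma continuousOn_synth {S : Set ℝ} {a : ℝ → Freq n → F} (ha : RapidOn S a)
    (hac : ∀ ξ, ContinuousOn (fun s => a s ξ) S) :
    ContinuousOn (fun p : ℝ × Rn n => synth (a p.1) p.2) (S ×ˢ univ) := by
  obtain ⟨u, hu, hu0, hau⟩ := ha.exists_summable_norm
  refine continuousOn_tsum (u := u) (fun ξ => ?_) hu fun ξ p hp => ?_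
  · refine ((continuous_character ξ).comp continuous_snd).continuousOn.smul ?_
    exact (hac ξ).comp continuous_fst.continuousOn fun p hp => hp.1
  · rw [norm_smul, norm_character, one_mul]
    exact hau _ hp.1 ξ

end Continuity

section Duhamel

variable {B : Cn n →L[ℂ] Cn n →L[ℂ] Cn n} {i : Fin n} {τ : ℝ} {a : ℝ → Freq n → Cn n}

lemma IsMild.continuousOn (h : IsMild B i τ a) (ξ : Freq n) :
    ContinuousOn (fun s => a s ξ) (Icc 0 τ) := fun t ht => (h.deriv ξ t ht).continuousWithinAt

lemma RapidOn.nonlinearity {S : Set ℝ} {a : ℝ → Freq n → Cn n} (ha : RapidOn S a) :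
    RapidOn S fun t => PeriodicModel.nonlinearity B i (a t) :=
  (ha.conv B ha).of_le (1 + (n : ℝ) ^ 2) 1 fun _ _ ξ => norm_lerayDeriv_le i ξ _

lemma continuousOn_nonlinearity {S : Set ℝ} (ha : RapidOn S a)
    (hac : ∀ ξ, ContinuousOn (fun s => a s ξ) S) (ξ : Freq n) :
    ContinuousOn (fun s => nonlinearity B i (a s) ξ) S :=
  (continuous_lerayDeriv i ξ).comp_continuousOn (continuousOn_conv B ha ha hac hac ξ)

lemma hasDerivAt_heat (t : ℝ) (ξ : Freq n) (s : ℝ) :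
    HasDerivAt (fun s => heat (t - s) ξ) ((lenSq ξ : ℂ) * heat (t - s) ξ) s := by
  have h1 : HasDerivAt (fun s : ℝ => -(t - s) * lenSq ξ) (lenSq ξ) s := by
    simpa using ((hasDerivAt_id s).const_sub t).neg.mul_const (lenSq ξ)
  have h2 := h1.exp.ofReal_comp
  refine h2.congr_deriv ?_
  simp only [heat]
  push_cast
  ring

lemma continuous_heat (t : ℝ) (ξ : Freq n) : Continuous fun s => heat (t - s) ξ :=
  continuous_iff_continuousAt.2 fun s => (hasDerivAt_heat t ξ s).continuousAt

/-- Duhamel's formula, started at time `t₀`. -/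
lemma IsMild.duhamel (h : IsMild B i τ a) {t₀ t : ℝ} (h₀ : 0 ≤ t₀) (h₁ : t₀ ≤ t) (h₂ : t ≤ τ)
    (ξ : Freq n) : a t ξ = heat (t - t₀) ξ • a t₀ ξ +
      ∫ s in t₀..t, heat (t - s) ξ • nonlinearity B i (a s) ξ := by
  have hsub : Icc t₀ t ⊆ Icc 0 τ := Icc_subset_Icc h₀ h₂
  have hN := (continuousOn_nonlinearity (B := B) (i := i) h.rapid h.continuousOn ξ).mono hsub
  have hh := (continuous_heat t ξ).continuousOn (s := Icc t₀ t)
  have := intervalIntegral.integral_eq_sub_of_hasDerivAt_of_le h₁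
    (f := fun s => heat (t - s) ξ • a s ξ)
    (f' := fun s => heat (t - s) ξ • nonlinearity B i (a s) ξ)
    (hh.smul ((h.continuousOn ξ).mono hsub)) (fun s hs => ?_)
    ((hh.smul hN).intervalIntegrable_of_Icc h₁)
  · rw [this]
    simp [heat]
  · have hs' : Icc 0 τ ∈ nhds s := Icc_mem_nhds (h₀.trans_lt hs.1) (hs.2.trans_le h₂)
    have := (hasDerivAt_heat t ξ s).smul
      ((h.deriv ξ s (hsub (Ioo_subset_Icc_self hs))).hasDerivAt hs')
    refine this.congr_deriv ?_
    rw [smul_add, smul_smul]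
    module

lemma integral_inv_sqrt_sub {t₀ t : ℝ} (h : t₀ ≤ t) :
    IntervalIntegrable (fun s => (√(t - s))⁻¹) volume t₀ t ∧
      ∫ s in t₀..t, (√(t - s))⁻¹ = 2 * √(t - t₀) := by
  have e : ∀ r ∈ Icc 0 (t - t₀), (√r)⁻¹ = r ^ (-1 / 2 : ℝ) := fun r hr => by
    rw [Real.sqrt_eq_rpow, ← Real.rpow_neg hr.1]
    norm_num
  have hi : IntervalIntegrable (fun r => (√r)⁻¹) volume 0 (t - t₀) := by
    refine (intervalIntegral.intervalIntegrable_rpow' (r := -1 / 2) (by norm_num)).congr ?_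
    intro r hr
    rw [uIoc_of_le (by linarith)] at hr
    exact (e r (Ioc_subset_Icc_self hr)).symm
  constructor
  · have := (hi.comp_sub_left t).symm
    simpa using this
  · rw [intervalIntegral.integral_comp_sub_left (fun r => (√r)⁻¹) t, sub_self,
      intervalIntegral.integral_congr (g := fun r => r ^ (-1 / 2 : ℝ)),
      integral_rpow (Or.inl (by norm_num)), Real.sqrt_eq_rpow]
    · norm_num
      ring
    · intro r hr
      rw [uIcc_of_le (by linarith)] at hr
      exact e r hr

/-- The basic estimate: the singularity `(t - s)^{-1/2}` in Duhamel's formula is integrable. -/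
lemma IsMild.norm_synth_wordCoef_le (h : IsMild B i τ a) {t₀ t : ℝ} (h₀ : 0 ≤ t₀) (h₁ : t₀ ≤ t)
    (h₂ : t ≤ τ) (w : List (Fin n)) {A M : ℝ}
    (hA : ∀ x, ‖synth (fun ξ => (wordSymbol w ξ * heat (t - t₀) ξ) • a t₀ ξ) x‖ ≤ A)
    (hM : ∀ s ∈ Ioo t₀ t, ∀ x, ‖synth (wordCoef w (conv B (a s) (a s))) x‖ ≤ M) (x : Rn n) :
    ‖synth (wordCoef w (a t)) x‖ ≤ A + lerayConst n * (2 * √(t - t₀)) * M := by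
  have hsub : Icc t₀ t ⊆ Icc 0 τ := Icc_subset_Icc h₀ h₂
  have hΙ : Set.uIoc t₀ t ⊆ Icc 0 τ := by
    rw [uIoc_of_le h₁]
    exact Ioc_subset_Icc_self.trans hsub
  obtain ⟨u, hu, hu0, hNu⟩ :=
    ((h.rapid.nonlinearity (B := B) (i := i)).wordCoef w).exists_summable_norm
  let G : Freq n → ℝ → Cn n := fun ξ s =>
    character ξ x • wordSymbol w ξ • heat (t - s) ξ • nonlinearity B i (a s) ξ
  have hGc : ∀ ξ, ContinuousOn (G ξ) (Icc t₀ t) := fun ξ => by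
    have h3 : ContinuousOn (fun s => heat (t - s) ξ • nonlinearity B i (a s) ξ) (Icc t₀ t) :=
      (continuous_heat t ξ).continuousOn.smul
        ((continuousOn_nonlinearity h.rapid h.continuousOn ξ).mono hsub)
    exact (h3.const_smul (wordSymbol w ξ)).const_smul (character ξ x)
  have hGn : ∀ ξ, ∀ s ∈ uIoc t₀ t, ‖G ξ s‖ ≤ u ξ := fun ξ s hs => by
    have h3 := hNu s (hΙ hs) ξ
    rw [wordCoef, norm_smul] at h3
    have hts : 0 ≤ t - s := by
      rw [uIoc_of_le h₁] at hs
      linarith [hs.2]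
    rw [norm_smul, norm_character, one_mul, norm_smul, norm_smul]
    refine le_trans ?_ h3
    gcongr
    exact mul_le_of_le_one_left (norm_nonneg _) (norm_heat_le hts ξ)
  have hsum := intervalIntegral.hasSum_integral_of_dominated_convergence (μ := volume)
    (a := t₀) (b := t) (F := G) (f := fun s => ∑' ξ, G ξ s) (fun ξ _ => u ξ)
    (fun ξ => by
      rw [uIoc_of_le h₁]
      exact ((hGc ξ).mono Ioc_subset_Icc_self).aestronglyMeasurable measurableSet_Ioc)
    (fun ξ => .of_forall fun s hs => hGn ξ s hs) (.of_forall fun s _ => hu)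
    intervalIntegrable_const
    (.of_forall fun s hs => (Summable.of_norm_bounded hu fun ξ => hGn ξ s hs).hasSum)
  have hlin : Summable fun ξ => ‖(wordSymbol w ξ * heat (t - t₀) ξ) • a t₀ ξ‖ := by
    refine .of_nonneg_of_le (fun _ => norm_nonneg _) (fun ξ => ?_)
      ((h.rapid.rapid ⟨h₀, h₁.trans h₂⟩).wordCoef w).summable_norm
    rw [mul_smul, wordCoef, norm_smul, norm_smul, norm_smul]
    gcongr
    exact mul_le_of_le_one_left (norm_nonneg _) (norm_heat_le (by linarith) ξ)
  have key : synth (wordCoef w (a t)) x =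
      synth (fun ξ => (wordSymbol w ξ * heat (t - t₀) ξ) • a t₀ ξ) x +
        ∫ s in t₀..t, ∑' ξ, G ξ s := by
    rw [← hsum.tsum_eq, synth, synth, ← (summable_synth hlin x).tsum_add hsum.summable]
    refine tsum_congr fun ξ => ?_
    simp only [G]
    rw [intervalIntegral.integral_smul, intervalIntegral.integral_smul, ← smul_add, wordCoef,
      mul_smul, ← smul_add, ← h.duhamel h₀ h₁ h₂ ξ]
  rw [key]
  refine (norm_add_le _ _).trans (add_le_add (hA x) ?_)
  obtain ⟨hi, hv⟩ := integral_inv_sqrt_sub h₁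
  have h3 : ∀ᵐ s : ℝ, s ∈ Ioc t₀ t → ‖∑' ξ, G ξ s‖ ≤ (lerayConst n * M) * (√(t - s))⁻¹ := by
    filter_upwards [Measure.ae_ne volume t] with s hst hs
    have hs' : s ∈ Ioo t₀ t := ⟨hs.1, lt_of_le_of_ne hs.2 hst⟩
    have hr := h.rapid.rapid (hsub (Ioo_subset_Icc_self hs'))
    have h4 := norm_synth_lerayDeriv_heat_le (sub_pos.2 hs'.2) i
      (((hr.conv B hr).wordCoef w).summable_norm) (hM s hs') x
    have h5 : synth (fun ξ => heat (t - s) ξ •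
        lerayDeriv i ξ (wordCoef w (conv B (a s) (a s)) ξ)) x = ∑' ξ, G ξ s := by
      rw [synth]
      refine tsum_congr fun ξ => ?_
      simp only [G, wordCoef, lerayDeriv_smul, nonlinearity]
      rw [smul_comm (heat (t - s) ξ)]
    rw [h5] at h4
    linarith
  refine (intervalIntegral.norm_integral_le_of_norm_le h₁ h3 (hi.const_mul _)).trans_eq ?_
  rw [intervalIntegral.integral_const_mul, hv]
  ring

end Duhamel

end PeriodicModel

namespace PeriodicModel

/-! ### A priori estimates -/

variable {n : ℕ} {B : Cn n →L[ℂ] Cn n →L[ℂ] Cn n} {i : Fin n} {τ : ℝ} {a : ℝ → Freq n → Cn n}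

/-- The bound for `√t |f|_∞` up to which the a priori estimates hold. -/
def smallness (B : Cn n →L[ℂ] Cn n →L[ℂ] Cn n) : ℝ := (16 * lerayConst n * (‖B‖ + 1))⁻¹

lemma smallness_pos (B : Cn n →L[ℂ] Cn n →L[ℂ] Cn n) : 0 < smallness B := by
  have := lerayConst_pos n
  have := B.opNorm_nonneg
  unfold smallness
  positivity

lemma lerayConst_mul_smallness_le (B : Cn n →L[ℂ] Cn n →L[ℂ] Cn n) :
    lerayConst n * ‖B‖ * smallness B ≤ 1 / 16 := by
  have h1 := lerayConst_pos n
  have h2 := B.opNorm_nonneg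
  rw [smallness, ← div_eq_mul_inv, div_le_div_iff₀ (by positivity) (by norm_num)]
  nlinarith

lemma exists_unitCube_representative (x : Rn n) : ∃ y ∈ Icc (0 : Fin n → ℝ) 1, ∃ m : Fin n → ℤ,
    x = scale y + scale fun k => (m k : ℝ) := by
  obtain ⟨z, rfl⟩ := scale_surjective x
  refine ⟨fun k => Int.fract (z k), ⟨fun k => Int.fract_nonneg _, fun k => (Int.fract_lt_one _).le⟩,
    fun k => ⌊z k⌋, ?_⟩
  rw [← scale_add]
  congr 1
  funext k
  exact (Int.fract_add_floor (z k)).symm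

/-- The supremum norm at most doubles. At the first time at which it would be reached, the value
`2R` contradicts Duhamel's formula. -/
lemma IsMild.norm_synth_le (h : IsMild B i τ a) {R : ℝ} (hR : 0 < R)
    (h₀ : ∀ x, ‖synth (a 0) x‖ ≤ R) {t : ℝ} (ht : t ∈ Icc 0 τ) (hts : √t * R ≤ smallness B)
    (x : Rn n) : ‖synth (a t) x‖ ≤ 2 * R := by
  by_contra! hcon
  let f : ℝ × (Fin n → ℝ) → ℝ := fun p => ‖synth (a p.1) (scale p.2)‖
  have hf : ContinuousOn f (Icc 0 t ×ˢ Icc 0 1) := by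
    have h1 : Continuous fun p : ℝ × (Fin n → ℝ) => ((p.1, scale p.2) : ℝ × Rn n) :=
      continuous_fst.prodMk (continuous_scale.comp continuous_snd)
    have h2 : MapsTo (fun p : ℝ × (Fin n → ℝ) => ((p.1, scale p.2) : ℝ × Rn n))
        (Icc 0 t ×ˢ Icc 0 1) (Icc 0 τ ×ˢ univ) :=
      fun p hp => ⟨⟨hp.1.1, hp.1.2.trans ht.2⟩, trivial⟩
    exact ((continuousOn_synth h.rapid h.continuousOn).comp h1.continuousOn h2).norm
  let K : Set (ℝ × (Fin n → ℝ)) := (Icc 0 t ×ˢ Icc 0 1) ∩ f ⁻¹' Ici (2 * R)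
  have hK : IsCompact K :=
    (isCompact_Icc.prod isCompact_Icc).of_isClosed_subset
      (hf.preimage_isClosed_of_isClosed (isClosed_Icc.prod isClosed_Icc) isClosed_Ici)
      inter_subset_left
  have hmem : ∀ s ∈ Icc 0 t, ∀ x, 2 * R ≤ ‖synth (a s) x‖ → s ∈ Prod.fst '' K := by
    intro s hs x hx
    obtain ⟨y, hy, m, rfl⟩ := exists_unitCube_representative x
    rw [(isPeriodic_synth (a s)).scale_int] at hx
    exact ⟨(s, y), ⟨⟨hs, hy⟩, hx⟩, rfl⟩
  obtain ⟨s₀, hs₀, hmin⟩ := (hK.image continuous_fst).exists_isLeast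
    ⟨t, hmem t ⟨ht.1, le_rfl⟩ x hcon.le⟩
  obtain ⟨⟨s, y⟩, ⟨⟨hs, -⟩, hy⟩, rfl⟩ := hs₀
  change s ∈ Icc 0 t at hs
  change 2 * R ≤ ‖synth (a s) (scale y)‖ at hy
  have hbefore : ∀ r ∈ Ioo 0 s, ∀ x, ‖synth (a r) x‖ ≤ 2 * R := by
    intro r hr x
    by_contra! hlt
    exact absurd (hmin (hmem r ⟨hr.1.le, hr.2.le.trans hs.2⟩ x hlt.le)) (not_le.2 hr.2)
  have hsτ : s ≤ τ := hs.2.trans ht.2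
  have hr0 := h.rapid.rapid (t := 0) ⟨le_rfl, hs.1.trans hsτ⟩
  have key := h.norm_synth_wordCoef_le le_rfl hs.1 hsτ [] (A := R) (M := ‖B‖ * (2 * R) * (2 * R))
    (fun x => by
      have := (isMultiplier_heat hs.1).bound _ hr0.summable_norm R h₀ x
      simpa [wordSymbol] using this)
    (fun r hr x => by
      have hrap := (h.rapid.rapid (t := r) ⟨hr.1.le, hr.2.le.trans hsτ⟩).summable_norm
      rw [wordCoef_nil, synth_conv B hrap hrap]
      refine (B.le_opNorm₂ _ _).trans ?_
      gcongr <;> exact hbefore r hr x) (scale y)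
  rw [wordCoef_nil, sub_zero] at key
  have h1 : √s * R ≤ smallness B :=
    (mul_le_mul_of_nonneg_right (Real.sqrt_le_sqrt hs.2) hR.le).trans hts
  have h2 : lerayConst n * ‖B‖ * (√s * R) ≤ 1 / 16 :=
    (mul_le_mul_of_nonneg_left h1 (mul_nonneg (lerayConst_pos n).le B.opNorm_nonneg)).trans
      (lerayConst_mul_smallness_le B)
  nlinarith [key, hy, h2, hR]

lemma bddAbove_synth_wordCoef (h : IsMild B i τ a) (j : ℕ) :
    ∃ C, ∀ s ∈ Icc 0 τ, ∀ w : List (Fin n), w.length = j → ∀ x,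
      ‖synth (wordCoef w (a s)) x‖ ≤ C := by
  obtain ⟨u, hu, -, hau⟩ := h.rapid.exists_summable j
  refine ⟨∑' ξ, u ξ, fun s hs w hw x => ?_⟩
  have hrap := ((h.rapid.rapid hs).wordCoef w).summable_norm
  refine (norm_synth_le hrap x).trans (hrap.tsum_le_tsum (fun ξ => ?_) hu)
  rw [wordCoef, norm_smul]
  refine le_trans ?_ (hau s hs ξ)
  gcongr
  rw [← hw]
  exact norm_wordSymbol_le_pow w ξ

/-- One step of the estimate for derivatives of order `m + 1`: with derivatives of lower order under
control, a bound `M` for the weighted derivatives of order `m + 1` improves to a constant plus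
`M / 2`. The length `4^{-(m+1)} s` of the time interval in Duhamel's formula is chosen so that the
nonlinear term contributes no more than `M / 2`, whatever `m` is. -/
lemma IsMild.weighted_step (h : IsMild B i τ a) {R : ℝ} (hR : 0 < R)
    (h₀ : ∀ x, ‖synth (a 0) x‖ ≤ R) (m : ℕ) {K : ℕ → ℝ} (hK0 : ∀ p ≤ m, 0 ≤ K p)
    {s : ℝ} (hs : 0 < s) (hsτ : s ≤ τ) (hsR : √s * R ≤ smallness B) {M : ℝ} (hM0 : 0 ≤ M)
    (hK : ∀ p ≤ m, ∀ r ∈ Ioc 0 s, ∀ w : List (Fin n), w.length = p → ∀ x,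
      √r ^ p * ‖synth (wordCoef w (a r)) x‖ ≤ K p * R)
    (hM : ∀ r ∈ Ioc 0 s, ∀ w : List (Fin n), w.length = m + 1 → ∀ x,
      √r ^ (m + 1) * ‖synth (wordCoef w (a r)) x‖ ≤ M)
    (w : List (Fin n)) (hw : w.length = m + 1) (x : Rn n) :
    √s ^ (m + 1) * ‖synth (wordCoef w (a s)) x‖ ≤
      (2 * (√((1 / 4) ^ (m + 1) / (m + 1)))⁻¹ ^ (m + 1) +
        ∑ p ∈ Finset.range m, ((m + 1).choose (p + 1) : ℝ) * (K (p + 1) * K (m - p))) * R +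
        M / 2 := by
  set ε : ℝ := (1 / 4) ^ (m + 1) with hε
  have hε0 : 0 < ε := by positivity
  have hε1 : ε ≤ 1 / 4 := by
    rw [hε, pow_succ]
    exact mul_le_of_le_one_left (by norm_num) (pow_le_one₀ (by norm_num) (by norm_num))
  have hsqε : √ε * 2 ^ (m + 1) = 1 := by
    have : ε = ((1 / 2) ^ (m + 1)) ^ 2 := by
      rw [hε, ← pow_mul, mul_comm, pow_mul]
      norm_num
    rw [this, Real.sqrt_sq (by positivity), ← mul_pow]
    norm_num
  set t₀ : ℝ := s - ε * s with ht₀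
  have ht₀0 : s / 4 ≤ t₀ := by nlinarith
  have ht₀s : t₀ ≤ s := by nlinarith
  have hst₀ : s - t₀ = ε * s := by rw [ht₀]; ring
  have hsq : 0 < √s := Real.sqrt_pos.2 hs
  -- the bounds for the derivatives of order at most `m + 1` at time `r`
  let κ : ℕ → ℝ := fun p => if p = 0 then 2 * R else if p ≤ m then K p * R else M
  have hκ0 : ∀ p, 0 ≤ κ p := fun p => by
    simp only [κ]
    split_ifs with h1 h2
    · positivity
    · exact mul_nonneg (hK0 p h2) hR.le
    · exact hM0
  have hκ : ∀ r ∈ Ioo t₀ s, ∀ v : List (Fin n), v.length ≤ w.length → ∀ x,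
      ‖synth (wordCoef v (a r)) x‖ ≤ κ v.length * (2 * (√s)⁻¹) ^ v.length := by
    intro r hr v hv x
    have hr0 : 0 < r := by linarith [hr.1]
    have hrs : r ∈ Ioc 0 s := ⟨hr0, hr.2.le⟩
    have hsqr : 0 < √r := Real.sqrt_pos.2 hr0
    have h1 : √r ^ v.length * ‖synth (wordCoef v (a r)) x‖ ≤ κ v.length := by
      simp only [κ]
      split_ifs with h2 h3
      · obtain rfl := List.length_eq_zero_iff.1 h2
        rw [wordCoef_nil, List.length_nil, pow_zero, one_mul]
        exact h.norm_synth_le hR h₀ ⟨hr0.le, hr.2.le.trans hsτ⟩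
          ((mul_le_mul_of_nonneg_right (Real.sqrt_le_sqrt hr.2.le) hR.le).trans hsR) x
      · exact hK _ h3 r hrs v rfl x
      · have h4 : v.length = m + 1 := by omega
        rw [h4]
        exact hM r hrs v h4 x
    have h2 : (√r)⁻¹ ≤ 2 * (√s)⁻¹ := by
      have h3 : √s ≤ 2 * √r := by
        rw [Real.sqrt_le_left (by positivity), mul_pow, Real.sq_sqrt hr0.le]
        linarith [hr.1]
      rw [← div_eq_mul_inv, le_div_iff₀ hsq, inv_mul_le_iff₀ hsqr]
      linarith
    rw [← le_div_iff₀' (by positivity)] at h1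
    refine h1.trans ?_
    rw [div_eq_mul_inv, ← inv_pow]
    have := hκ0 v.length
    gcongr
  -- the nonlinear term
  let S : ℝ := ∑ p ∈ Finset.range m, ((m + 1).choose (p + 1) : ℝ) * (K (p + 1) * K (m - p))
  have hS0 : 0 ≤ S := Finset.sum_nonneg fun p hp => by
    have := Finset.mem_range.1 hp
    have h1 := hK0 (p + 1) (by omega)
    have h2 := hK0 (m - p) (by omega)
    positivity
  have hsum : ∑ p ∈ Finset.range (w.length + 1), (w.length.choose p : ℝ) *
      (κ p * (2 * (√s)⁻¹) ^ p * (κ (w.length - p) * (2 * (√s)⁻¹) ^ (w.length - p))) =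
      (2 * (√s)⁻¹) ^ (m + 1) * (S * R ^ 2 + 4 * R * M) := by
    have h1 : ∀ p ∈ Finset.range (w.length + 1), (w.length.choose p : ℝ) *
        (κ p * (2 * (√s)⁻¹) ^ p * (κ (w.length - p) * (2 * (√s)⁻¹) ^ (w.length - p))) =
        (2 * (√s)⁻¹) ^ (m + 1) * ((w.length.choose p : ℝ) * (κ p * κ (w.length - p))) := by
      intro p hp
      have h2 : p + (w.length - p) = m + 1 := by
        have := Finset.mem_range.1 hp
        omega
      rw [← h2, pow_add]
      ring
    rw [Finset.sum_congr rfl h1, ← Finset.mul_sum, hw]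
    congr 1
    rw [Finset.sum_range_succ, Finset.sum_range_succ']
    have h3 : ∑ p ∈ Finset.range m, ((m + 1).choose (p + 1) : ℝ) *
        (κ (p + 1) * κ (m + 1 - (p + 1))) = S * R ^ 2 := by
      rw [Finset.sum_mul]
      refine Finset.sum_congr rfl fun p hp => ?_
      have := Finset.mem_range.1 hp
      have e1 : κ (p + 1) = K (p + 1) * R := by
        simp only [κ]
        rw [if_neg (by omega), if_pos (by omega)]
      have e2 : κ (m + 1 - (p + 1)) = K (m - p) * R := by
        simp only [κ]
        rw [Nat.add_sub_add_right, if_neg (by omega), if_pos (by omega)]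
      rw [e1, e2]
      ring
    rw [h3]
    simp [κ]
    ring
  have hA : ∀ x, ‖synth (fun ξ => (wordSymbol w ξ * heat (s - t₀) ξ) • a t₀ ξ) x‖ ≤
      (√(ε / (m + 1)))⁻¹ ^ (m + 1) * (√s)⁻¹ ^ (m + 1) * (2 * R) := by
    intro x
    have hr : 0 < ε * s / (m + 1) := by positivity
    have h1 := (isMultiplier_word_heat (F := Cn n) hr w).bound (a t₀)
      (h.rapid.rapid ⟨by linarith, ht₀s.trans hsτ⟩).summable_norm (2 * R)
      (h.norm_synth_le hR h₀ ⟨by linarith, ht₀s.trans hsτ⟩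
          ((mul_le_mul_of_nonneg_right (Real.sqrt_le_sqrt ht₀s) hR.le).trans hsR)) x
    have h2 : ((w.length : ℕ) : ℝ) * (ε * s / (m + 1)) = s - t₀ := by
      rw [hw, hst₀]
      push_cast
      field_simp
    have h3 : √(ε * s / (m + 1)) = √(ε / (m + 1)) * √s := by
      rw [← Real.sqrt_mul (by positivity)]
      congr 1
      ring
    rwa [h2, h3, hw, mul_inv, mul_pow] at h1
  have hconv : ∀ r ∈ Ioo t₀ s, ∀ x, ‖synth (wordCoef w (conv B (a r) (a r))) x‖ ≤
      ‖B‖ * ((2 * (√s)⁻¹) ^ (m + 1) * (S * R ^ 2 + 4 * R * M)) := by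
    intro r hr x
    have hrap := h.rapid.rapid (t := r) ⟨by linarith [hr.1], hr.2.le.trans hsτ⟩
    have := norm_synth_wordCoef_conv_le B w hrap hrap
      (fun p => κ p * (2 * (√s)⁻¹) ^ p) (fun p => κ p * (2 * (√s)⁻¹) ^ p) (hκ r hr) (hκ r hr) x
    rwa [hsum] at this
  have key := h.norm_synth_wordCoef_le (by linarith) ht₀s hsτ w hA hconv x
  rw [hst₀, Real.sqrt_mul hε0.le] at key
  have hsm := lerayConst_mul_smallness_le B
  have hCB : 0 ≤ lerayConst n * ‖B‖ := mul_nonneg (lerayConst_pos n).le B.opNorm_nonneg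
  have h2 : lerayConst n * ‖B‖ * (√s * R) ≤ 1 / 16 :=
    (mul_le_mul_of_nonneg_left hsR hCB).trans hsm
  have e1 : √s ^ (m + 1) * (√s)⁻¹ ^ (m + 1) = 1 := by
    rw [← mul_pow, mul_inv_cancel₀ hsq.ne', one_pow]
  calc √s ^ (m + 1) * ‖synth (wordCoef w (a s)) x‖
      ≤ √s ^ (m + 1) * ((√(ε / (m + 1)))⁻¹ ^ (m + 1) * (√s)⁻¹ ^ (m + 1) * (2 * R) +
        lerayConst n * (2 * (√ε * √s)) *
          (‖B‖ * ((2 * (√s)⁻¹) ^ (m + 1) * (S * R ^ 2 + 4 * R * M)))) := by gcongr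
    _ = (√s ^ (m + 1) * (√s)⁻¹ ^ (m + 1)) * ((√(ε / (m + 1)))⁻¹ ^ (m + 1) * (2 * R) +
        2 * (√ε * 2 ^ (m + 1)) * (lerayConst n * ‖B‖ * (√s * R)) * (S * R + 4 * M)) := by
        rw [mul_pow]
        ring
    _ = (√(ε / (m + 1)))⁻¹ ^ (m + 1) * (2 * R) +
        2 * (lerayConst n * ‖B‖ * (√s * R)) * (S * R + 4 * M) := by
        rw [e1, hsqε]
        ring
    _ ≤ (√(ε / (m + 1)))⁻¹ ^ (m + 1) * (2 * R) + 2 * (1 / 16) * (S * R + 4 * M) := by gcongr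
    _ ≤ _ := by nlinarith [mul_nonneg hS0 hR.le]

/-- The bound `t^{j/2} |D^j u(t)| ≤ K_j |f|`, by induction on `j`. -/
lemma exists_weighted_bound (B : Cn n →L[ℂ] Cn n →L[ℂ] Cn n) (i : Fin n) (j : ℕ) :
    ∃ K, 0 ≤ K ∧ ∀ τ a, IsMild B i τ a → ∀ R, 0 < R → (∀ x, ‖synth (a 0) x‖ ≤ R) →
      ∀ t ∈ Ioc 0 τ, √t * R ≤ smallness B → ∀ w : List (Fin n), w.length = j → ∀ x,
        √t ^ j * ‖synth (wordCoef w (a t)) x‖ ≤ K * R := by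
  induction j using Nat.strong_induction_on with
  | _ j ih =>
    rcases j with _ | m
    · refine ⟨2, zero_le_two, fun τ a h R hR h₀ t ht hts w hw x => ?_⟩
      obtain rfl := List.length_eq_zero_iff.1 hw
      rw [wordCoef_nil, pow_zero, one_mul]
      exact h.norm_synth_le hR h₀ ⟨ht.1.le, ht.2⟩ hts x
    choose! K hK0 hK using ih
    let A : ℝ := 2 * (√((1 / 4) ^ (m + 1) / (m + 1)))⁻¹ ^ (m + 1) +
        ∑ p ∈ Finset.range m, ((m + 1).choose (p + 1) : ℝ) * (K (p + 1) * K (m - p))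
    have hA0 : 0 ≤ A := by
      refine add_nonneg (by positivity) (Finset.sum_nonneg fun p hp => ?_)
      have := Finset.mem_range.1 hp
      have h1 := hK0 (p + 1) (by omega)
      have h2 := hK0 (m - p) (by omega)
      positivity
    refine ⟨2 * A, by positivity, fun τ a h R hR h₀ t ht hts w hw x => ?_⟩
    let V : Set ℝ := {v | ∃ s ∈ Ioc 0 t, ∃ w : List (Fin n), w.length = m + 1 ∧ ∃ x,
      v = √s ^ (m + 1) * ‖synth (wordCoef w (a s)) x‖}
    have hsτ : ∀ s ∈ Ioc 0 t, s ≤ τ := fun s hs => hs.2.trans ht.2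
    have hVb : BddAbove V := by
      obtain ⟨C, hC⟩ := bddAbove_synth_wordCoef h (m + 1)
      refine ⟨√t ^ (m + 1) * C, ?_⟩
      rintro v ⟨s, hs, w, hw, x, rfl⟩
      have := hC s ⟨hs.1.le, hsτ s hs⟩ w hw x
      gcongr
      exact hs.2
    have hmem : √t ^ (m + 1) * ‖synth (wordCoef w (a t)) x‖ ∈ V := ⟨t, ⟨ht.1, le_rfl⟩, w, hw, x, rfl⟩
    have hV0 : 0 ≤ sSup V := le_csSup_of_le hVb hmem (by positivity)
    have hVle : sSup V ≤ A * R + sSup V / 2 := by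
      refine csSup_le ⟨_, hmem⟩ ?_
      rintro v ⟨s, hs, w, hw, x, rfl⟩
      have hsR : ∀ r ∈ Ioc 0 s, √r * R ≤ smallness B := fun r hr =>
        (mul_le_mul_of_nonneg_right (Real.sqrt_le_sqrt (hr.2.trans hs.2)) hR.le).trans hts
      refine h.weighted_step hR h₀ m (fun p hp => hK0 p (by omega)) hs.1 (hsτ s hs)
        (hsR s ⟨hs.1, le_rfl⟩) hV0 ?_ ?_ w hw x
      · intro p hp r hr w hw x
        exact hK p (by omega) τ a h R hR h₀ r ⟨hr.1, hr.2.trans (hsτ s hs)⟩ (hsR r hr) w hw x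
      · intro r hr w hw x
        exact le_csSup hVb ⟨r, ⟨hr.1, hr.2.trans hs.2⟩, w, hw, x, rfl⟩
    refine (le_csSup hVb hmem).trans ?_
    linarith

end PeriodicModel

namespace PeriodicModel

/-! ### Local existence -/

variable {n : ℕ}

section Majorants

/-- The convolution of two real lattice sequences. -/
def convReal (α β : Freq n → ℝ) : Freq n → ℝ := fun ξ => ∑' η, α η * β (ξ - η)

lemma convReal_summable {α β : Freq n → ℝ} (hα : Summable α) (hβ : Summable β) (hα0 : ∀ ξ, 0 ≤ α ξ)
    (hβ0 : ∀ ξ, 0 ≤ β ξ) : (∀ ξ, Summable fun η => α η * β (ξ - η)) ∧ Summable (convReal α β) ∧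
      ∑' ξ, convReal α β ξ = (∑' ξ, α ξ) * ∑' ξ, β ξ := by
  have hf : Summable fun p : Freq n × Freq n => α p.1 * β p.2 := hα.mul_of_nonneg hβ hα0 hβ0
  let e : Freq n × Freq n ≃ Freq n × Freq n :=
    { toFun := fun p => (p.2, p.1 - p.2)
      invFun := fun p => (p.1 + p.2, p.1)
      left_inv := fun p => by simp
      right_inv := fun p => by simp }
  have hg : Summable fun p : Freq n × Freq n => α p.2 * β (p.1 - p.2) := e.summable_iff.2 hf
  refine ⟨hg.prod_factor, hg.prod, ?_⟩
  rw [hα.tsum_mul_tsum hβ hf, ← e.tsum_eq (fun p : Freq n × Freq n => α p.1 * β p.2)]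
  exact hg.tsum_prod.symm

variable {F : Type*} [NormedAddCommGroup F] [NormedSpace ℂ F]

lemma norm_bilinear_le (B : F →L[ℂ] F →L[ℂ] F) {v w : F} {r s : ℝ} (hv : ‖v‖ ≤ r) (hw : ‖w‖ ≤ s) :
    ‖B v w‖ ≤ ‖B‖ * (r * s) := by
  refine (B.le_opNorm₂ _ _).trans ?_
  rw [mul_assoc]
  exact mul_le_mul_of_nonneg_left (mul_le_mul hv hw (norm_nonneg _) ((norm_nonneg _).trans hv))
    B.opNorm_nonneg

variable (B : F →L[ℂ] F →L[ℂ] F)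

lemma norm_conv_le {a b : Freq n → F} {α β : Freq n → ℝ} (hα : Summable α)
    (hβ : Summable β) (ha : ∀ ξ, ‖a ξ‖ ≤ α ξ) (hb : ∀ ξ, ‖b ξ‖ ≤ β ξ) (ξ : Freq n) :
    ‖conv B a b ξ‖ ≤ ‖B‖ * convReal α β ξ := by
  rw [convReal, ← tsum_mul_left]
  exact tsum_of_norm_bounded (((convReal_summable hα hβ (fun η => (norm_nonneg _).trans (ha η))
    (fun η => (norm_nonneg _).trans (hb η))).1 ξ).mul_left ‖B‖).hasSum
    fun η => norm_bilinear_le B (ha η) (hb _)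

/-- A convolution decays as fast as its less regular factor, with a constant that involves only the
absolute sum of the other factor. -/
lemma weight_mul_norm_conv_le {a : Freq n → F} {α : Freq n → ℝ} (hα : Summable α)
    (ha : ∀ ξ, ‖a ξ‖ ≤ α ξ) {p : ℕ} {M : ℝ} (hM : ∀ ξ, (1 + ‖ξ‖) ^ p * ‖a ξ‖ ≤ M) (ξ : Freq n) :
    (1 + ‖ξ‖) ^ p * ‖conv B a a ξ‖ ≤ ‖B‖ * 2 ^ (p + 1) * M * ∑' ξ, α ξ := by
  have hα0 : ∀ ξ, 0 ≤ α ξ := fun ξ => (norm_nonneg _).trans (ha ξ)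
  have hM0 : 0 ≤ M := (by positivity : (0 : ℝ) ≤ (1 + ‖ξ‖) ^ p * ‖a ξ‖).trans (hM ξ)
  have hα' : Summable fun η => α (ξ - η) := (Equiv.subLeft ξ).summable_iff.2 hα
  have hterm : ∀ η, ‖((1 + ‖ξ‖) ^ p : ℝ) • B (a η) (a (ξ - η))‖ ≤
      ‖B‖ * 2 ^ p * M * (α (ξ - η) + α η) := by
    intro η
    have hw : (1 + ‖ξ‖) ^ p ≤ 2 ^ p * ((1 + ‖η‖) ^ p + (1 + ‖ξ - η‖) ^ p) := by
      have h1 : ‖ξ‖ ≤ ‖η‖ + ‖ξ - η‖ := by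
        have := norm_add_le η (ξ - η)
        rwa [add_sub_cancel] at this
      rcases le_total ‖η‖ ‖ξ - η‖ with h2 | h2
      · calc (1 + ‖ξ‖) ^ p ≤ (2 * (1 + ‖ξ - η‖)) ^ p :=
              pow_le_pow_left₀ (by positivity) (by linarith) p
          _ = 2 ^ p * (1 + ‖ξ - η‖) ^ p := mul_pow _ _ _
          _ ≤ _ := by
            gcongr
            linarith [pow_nonneg (by positivity : 0 ≤ 1 + ‖η‖) p]
      · calc (1 + ‖ξ‖) ^ p ≤ (2 * (1 + ‖η‖)) ^ p :=
              pow_le_pow_left₀ (by positivity) (by linarith) p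
          _ = 2 ^ p * (1 + ‖η‖) ^ p := mul_pow _ _ _
          _ ≤ _ := by
            gcongr
            linarith [pow_nonneg (by positivity : 0 ≤ 1 + ‖ξ - η‖) p]
    rw [norm_smul, Real.norm_of_nonneg (by positivity)]
    calc (1 + ‖ξ‖) ^ p * ‖B (a η) (a (ξ - η))‖
        ≤ (2 ^ p * ((1 + ‖η‖) ^ p + (1 + ‖ξ - η‖) ^ p)) * (‖B‖ * (‖a η‖ * ‖a (ξ - η)‖)) := by
          gcongr
          exact norm_bilinear_le B le_rfl le_rfl
      _ = ‖B‖ * 2 ^ p * (((1 + ‖η‖) ^ p * ‖a η‖) * ‖a (ξ - η)‖ +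
          ((1 + ‖ξ - η‖) ^ p * ‖a (ξ - η)‖) * ‖a η‖) := by ring
      _ ≤ ‖B‖ * 2 ^ p * (M * α (ξ - η) + M * α η) := by
          have := B.opNorm_nonneg
          gcongr
          · exact hM η
          · exact ha _
          · exact hM _
          · exact ha _
      _ = _ := by ring
  have hsum := ((hα'.add hα).mul_left (‖B‖ * 2 ^ p * M)).hasSum
  have hshift : ∑' η, α (ξ - η) = ∑' η, α η := (Equiv.subLeft ξ).tsum_eq α
  rw [tsum_mul_left, Summable.tsum_add hα' hα, hshift] at hsum
  have := tsum_of_norm_bounded hsum hterm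
  rw [tsum_const_smul'', norm_smul, Real.norm_of_nonneg (by positivity)] at this
  refine this.trans_eq ?_
  rw [pow_succ]
  ring

variable [CompleteSpace F]

lemma summable_conv_of_le {a b : Freq n → F} {α β : Freq n → ℝ} (hα : Summable α)
    (hβ : Summable β) (ha : ∀ ξ, ‖a ξ‖ ≤ α ξ) (hb : ∀ ξ, ‖b ξ‖ ≤ β ξ) (ξ : Freq n) :
    Summable fun η => B (a η) (b (ξ - η)) :=
  .of_norm_bounded (((convReal_summable hα hβ (fun η => (norm_nonneg _).trans (ha η))
    (fun η => (norm_nonneg _).trans (hb η))).1 ξ).mul_left ‖B‖)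
    fun η => norm_bilinear_le B (ha η) (hb _)

lemma norm_conv_sub_conv_le {a b : Freq n → F} {α β δ : Freq n → ℝ} (hα : Summable α)
    (hβ : Summable β) (hδ : Summable δ) (ha : ∀ ξ, ‖a ξ‖ ≤ α ξ) (hb : ∀ ξ, ‖b ξ‖ ≤ β ξ)
    (hab : ∀ ξ, ‖a ξ - b ξ‖ ≤ δ ξ) (ξ : Freq n) :
    ‖conv B a a ξ - conv B b b ξ‖ ≤ ‖B‖ * (convReal δ α ξ + convReal β δ ξ) := by
  have h1 : conv B a a ξ - conv B b b ξ =
      conv B (fun η => a η - b η) a ξ + conv B b (fun η => a η - b η) ξ := by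
    simp only [conv]
    rw [← Summable.tsum_sub (summable_conv_of_le B hα hα ha ha ξ)
      (summable_conv_of_le B hβ hβ hb hb ξ), ← Summable.tsum_add
      (summable_conv_of_le B hδ hα hab ha ξ) (summable_conv_of_le B hβ hδ hb hab ξ)]
    refine tsum_congr fun η => ?_
    simp only [map_sub, FunLike.coe_sub, Pi.sub_apply]
    abel
  rw [h1, mul_add]
  exact (norm_add_le _ _).trans (add_le_add (norm_conv_le B hδ hα hab ha ξ)
    (norm_conv_le B hβ hδ hb hab ξ))

end Majorants

section DuhamelOperator

variable (i : Fin n) (ξ : Freq n)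

lemma lerayDeriv_sub (v w : Cn n) :
    lerayDeriv i ξ (v - w) = lerayDeriv i ξ v - lerayDeriv i ξ w := by
  simp only [lerayDeriv, lerayCoef_eq, map_sub, smul_sub, Finset.sum_sub_distrib]
  abel

lemma lerayDeriv_neg_conjC (v : Cn n) :
    lerayDeriv i (-ξ) (conjC v) = conjC (lerayDeriv i ξ v) := by
  ext k
  simp [lerayDeriv, lerayCoef, conjC_apply, lenSq_neg]
  left
  ring

/-- The solution of `v' = -|ξ|² v + (D_i ℙ g)_ξ` with initial value `v₀`. -/
def duhamel (v₀ : Cn n) (g : ℝ → Cn n) (t : ℝ) : Cn n :=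
  heat t ξ • (v₀ + ∫ s in 0..t, heat (-s) ξ • lerayDeriv i ξ (g s))

variable {i ξ}

lemma continuous_heat_neg_smul {g : ℝ → Cn n} (hg : Continuous g) :
    Continuous fun s => heat (-s) ξ • lerayDeriv i ξ (g s) := by
  have : Continuous fun s => heat (-s) ξ := by simpa using continuous_heat 0 ξ
  exact this.smul ((continuous_lerayDeriv i ξ).comp hg)

lemma hasDerivAt_duhamel (v₀ : Cn n) {g : ℝ → Cn n} (hg : Continuous g) (t : ℝ) :
    HasDerivAt (duhamel i ξ v₀ g)
      ((-(lenSq ξ : ℂ)) • duhamel i ξ v₀ g t + lerayDeriv i ξ (g t)) t := by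
  have hc := continuous_heat_neg_smul (i := i) (ξ := ξ) hg
  have h1 := intervalIntegral.integral_hasDerivAt_right (hc.intervalIntegrable 0 t)
    (hc.stronglyMeasurableAtFilter _ _) hc.continuousAt
  have h2 : HasDerivAt (fun t => heat t ξ) ((-(lenSq ξ : ℂ)) * heat t ξ) t := by
    have h3 := (((hasDerivAt_id t).neg.mul_const (lenSq ξ)).exp).ofReal_comp
    refine h3.congr_deriv ?_
    simp only [heat, Pi.neg_apply, id]
    push_cast
    ring
  refine (h2.smul (h1.const_add v₀)).congr_deriv ?_
  rw [smul_smul, ← heat_add, add_neg_cancel, duhamel, smul_smul, add_comm]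
  simp [heat]

lemma duhamel_eq (v₀ : Cn n) (g : ℝ → Cn n) (t : ℝ) : duhamel i ξ v₀ g t =
    heat t ξ • v₀ + ∫ s in 0..t, heat (t - s) ξ • lerayDeriv i ξ (g s) := by
  rw [duhamel, smul_add, ← intervalIntegral.integral_smul]
  congr 1
  refine intervalIntegral.integral_congr fun s _ => ?_
  beta_reduce
  rw [smul_smul, ← heat_add, sub_eq_add_neg]

lemma duhamel_sub (v₀ : Cn n) {g g' : ℝ → Cn n} (hg : Continuous g) (hg' : Continuous g') (t : ℝ) :
    duhamel i ξ v₀ g t - duhamel i ξ v₀ g' t = duhamel i ξ 0 (fun s => g s - g' s) t := by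
  simp only [duhamel, lerayDeriv_sub, smul_sub]
  rw [intervalIntegral.integral_sub ((continuous_heat_neg_smul hg).intervalIntegrable 0 t)
    ((continuous_heat_neg_smul hg').intervalIntegrable 0 t), ← smul_sub]
  congr 1
  abel

lemma integral_exp_weight_le {r l Λ t : ℝ} (hr : 0 ≤ r) (hl : r ^ 2 ≤ l) (hΛ : 0 < Λ) :
    ∫ s in 0..t, r * (Real.exp (-(t - s) * l) * Real.exp (Λ * s)) ≤
      Real.exp (Λ * t) / (2 * √Λ) := by
  have hpos : 0 < l + Λ := by nlinarith [sq_nonneg r]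
  have hd : ∀ s ∈ uIcc 0 t, HasDerivAt
      (fun s => r / (l + Λ) * Real.exp (-(t - s) * l + Λ * s))
      (r * (Real.exp (-(t - s) * l) * Real.exp (Λ * s))) s := by
    intro s _
    have h1 : HasDerivAt (fun s : ℝ => -(t - s) * l + Λ * s) (l + Λ) s := by
      refine ((((hasDerivAt_id s).const_sub t).neg.mul_const l).add
        ((hasDerivAt_id s).const_mul Λ)).congr_deriv ?_
      ring
    refine (h1.exp.const_mul _).congr_deriv ?_
    rw [Real.exp_add]
    field_simp
  rw [intervalIntegral.integral_eq_sub_of_hasDerivAt hd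
    ((by fun_prop : Continuous fun s : ℝ =>
      r * (Real.exp (-(t - s) * l) * Real.exp (Λ * s))).intervalIntegrable 0 t)]
  have h2 : r / (l + Λ) ≤ 1 / (2 * √Λ) := by
    have hs := Real.sqrt_pos.2 hΛ
    rw [div_le_div_iff₀ hpos (by positivity)]
    nlinarith [sq_nonneg (r - √Λ), Real.sq_sqrt hΛ.le]
  have h3 : 0 ≤ r / (l + Λ) * Real.exp (-(t - 0) * l + Λ * 0) := by positivity
  have h4 : -(t - t) * l + Λ * t = Λ * t := by ring
  rw [h4]
  calc _ ≤ r / (l + Λ) * Real.exp (Λ * t) := by linarith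
    _ ≤ 1 / (2 * √Λ) * Real.exp (Λ * t) := by gcongr
    _ = _ := by ring

/-- With an exponential weight in time, the smoothing of the heat semigroup absorbs the derivative
`D_i` at the price of the factor `Λ^{-1/2}`. -/
lemma norm_duhamel_le (v₀ : Cn n) {g : ℝ → Cn n} {Λ G t : ℝ} (hΛ : 0 < Λ)
    (ht : 0 ≤ t) (hG : ∀ s ∈ Icc 0 t, ‖g s‖ ≤ G * Real.exp (Λ * s)) :
    ‖duhamel i ξ v₀ g t‖ ≤ ‖v₀‖ + (1 + n ^ 2) * G * (Real.exp (Λ * t) / (2 * √Λ)) := by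
  have hG0 : 0 ≤ G := by
    have := (norm_nonneg _).trans (hG 0 ⟨le_rfl, ht⟩)
    simpa using this
  rw [duhamel_eq]
  refine (norm_add_le _ _).trans (add_le_add ?_ ?_)
  · rw [norm_smul]
    exact mul_le_of_le_one_left (norm_nonneg _) (norm_heat_le ht ξ)
  have hle : ∀ s ∈ Ioc 0 t, ‖heat (t - s) ξ • lerayDeriv i ξ (g s)‖ ≤ (1 + (n : ℝ) ^ 2) * G *
      (|(ξ i : ℝ)| * (Real.exp (-(t - s) * lenSq ξ) * Real.exp (Λ * s))) := by
    intro s hs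
    have h1 : ‖lerayDeriv i ξ (g s)‖ ≤ |(ξ i : ℝ)| * ((1 + (n : ℝ) ^ 2) * (G * Real.exp (Λ * s))) := by
      rw [lerayDeriv, norm_smul, norm_mul, Complex.norm_I, one_mul, Complex.norm_intCast]
      gcongr
      refine (norm_lerayCoef_le ξ _).trans ?_
      gcongr
      exact hG s ⟨hs.1.le, hs.2⟩
    rw [norm_smul, norm_heat]
    calc _ ≤ Real.exp (-(t - s) * lenSq ξ) *
          (|(ξ i : ℝ)| * ((1 + (n : ℝ) ^ 2) * (G * Real.exp (Λ * s)))) := by gcongr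
      _ = _ := by ring
  refine (intervalIntegral.norm_integral_le_of_norm_le ht (.of_forall hle)
    ((by fun_prop : Continuous fun s : ℝ => (1 + (n : ℝ) ^ 2) * G * (|(ξ i : ℝ)| *
      (Real.exp (-(t - s) * lenSq ξ) * Real.exp (Λ * s)))).intervalIntegrable 0 t)).trans ?_
  rw [intervalIntegral.integral_const_mul]
  gcongr
  exact integral_exp_weight_le (abs_nonneg _) (by rw [sq_abs]; exact sq_le_lenSq ξ i) hΛ

lemma duhamel_neg_conjC (v₀ : Cn n) {g : ℝ → Cn n} (hg : Continuous g) (t : ℝ) :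
    duhamel i (-ξ) (conjC v₀) (fun s => conjC (g s)) t = conjC (duhamel i ξ v₀ g t) := by
  have hh : ∀ s, heat s (-ξ) = (starRingEnd ℂ) (heat s ξ) := fun s => by
    rw [heat, heat, lenSq_neg, Complex.conj_ofReal]
  rw [duhamel, duhamel, conjC_smul, map_add, ← ContinuousLinearMap.intervalIntegral_comp_comm conjC
    ((continuous_heat_neg_smul hg).intervalIntegrable 0 t)]
  simp only [hh, lerayDeriv_neg_conjC, conjC_smul]

end DuhamelOperator

lemma conv_neg_of_real {B : Cn n →L[ℂ] Cn n →L[ℂ] Cn n}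
    (hB : ∀ v w, B (conjC v) (conjC w) = conjC (B v w)) {a : Freq n → Cn n}
    (ha : ∀ ξ, a (-ξ) = conjC (a ξ)) {ξ : Freq n} (hs : Summable fun η => B (a η) (a (ξ - η))) :
    conv B a a (-ξ) = conjC (conv B a a ξ) := by
  rw [conv, conv, conjC.map_tsum hs, ← (Equiv.neg (Freq n)).tsum_eq]
  refine tsum_congr fun η => ?_
  rw [Equiv.neg_apply, ha η, show -ξ - -η = -(ξ - η) by abel, ha (ξ - η), hB]

section PathSpace

/-- Sequences of continuous paths on `[0, τ]` whose supremum norms are summable. -/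
abbrev PathSpace (n : ℕ) (τ : ℝ) : Type := lp (fun _ : Freq n => C(Icc 0 τ, Cn n)) 1

variable {τ : ℝ}

lemma PathSpace.hasSum_norm (a : PathSpace n τ) : HasSum (fun ξ => ‖a ξ‖) ‖a‖ := by
  simpa using lp.hasSum_norm (by simp) a

/-- An element of the path space as a function of time, constant outside `[0, τ]`. -/
def PathSpace.eval (hτ : 0 ≤ τ) (a : PathSpace n τ) (s : ℝ) (ξ : Freq n) : Cn n :=
  a ξ (projIcc 0 τ hτ s)

variable (hτ : 0 ≤ τ)

lemma PathSpace.norm_eval_le (a : PathSpace n τ) (s : ℝ) (ξ : Freq n) : ‖a.eval hτ s ξ‖ ≤ ‖a ξ‖ :=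
  (a ξ).norm_coe_le_norm _

lemma PathSpace.continuous_eval (a : PathSpace n τ) (ξ : Freq n) :
    Continuous fun s => a.eval hτ s ξ :=
  (a ξ).continuous.comp continuous_projIcc

variable (B : Cn n →L[ℂ] Cn n →L[ℂ] Cn n)

lemma PathSpace.continuous_conv (a : PathSpace n τ) (ξ : Freq n) :
    Continuous fun s => conv B (a.eval hτ s) (a.eval hτ s) ξ := by
  have hs := a.hasSum_norm.summable
  refine continuous_tsum (u := fun η => ‖B‖ * (‖a η‖ * ‖a (ξ - η)‖)) (fun η => ?_)
    (((convReal_summable hs hs (fun _ => norm_nonneg _) (fun _ => norm_nonneg _)).1 ξ).mul_left _)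
    fun η s => norm_bilinear_le B (a.norm_eval_le hτ s η) (a.norm_eval_le hτ s _)
  exact (B.continuous.comp (a.continuous_eval hτ η)).clm_apply (a.continuous_eval hτ _)

variable (i : Fin n) (f : Freq n → Cn n)

/-- Duhamel's formula as a map of paths, at a fixed frequency. -/
def picardCoef (a : PathSpace n τ) (ξ : Freq n) : C(Icc 0 τ, Cn n) where
  toFun t := duhamel i ξ (f ξ) (fun s => conv B (a.eval hτ s) (a.eval hτ s) ξ) t
  continuous_toFun := (continuous_iff_continuousAt.2 fun t =>
    (hasDerivAt_duhamel (f ξ) (a.continuous_conv hτ B ξ) t).continuousAt).comp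
      continuous_subtype_val

/-- The gain of a factor `√τ` in Duhamel's formula on a short time interval. -/
lemma norm_duhamel_short_le {i : Fin n} {ξ : Freq n} (hτ0 : 0 < τ) (v₀ : Cn n) {g : ℝ → Cn n}
    {G t : ℝ} (ht : t ∈ Icc 0 τ) (hG : ∀ s, ‖g s‖ ≤ G) :
    ‖duhamel i ξ v₀ g t‖ ≤ ‖v₀‖ + 2 * (1 + n ^ 2) * √τ * G := by
  have hG0 : 0 ≤ G := (norm_nonneg _).trans (hG 0)
  have h1 := norm_duhamel_le (i := i) (ξ := ξ) v₀ (inv_pos.2 hτ0) ht.1 (G := G) (g := g)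
    fun s hs => (hG s).trans (le_mul_of_one_le_right hG0
      (Real.one_le_exp (mul_nonneg (inv_pos.2 hτ0).le hs.1)))
  refine h1.trans ?_
  have h2 : Real.exp (τ⁻¹ * t) ≤ 3 := by
    have : τ⁻¹ * t ≤ 1 := by
      rw [inv_mul_le_iff₀ hτ0, mul_one]
      exact ht.2
    exact (Real.exp_le_exp.2 this).trans (Real.exp_one_lt_three.le)
  have h3 : Real.exp (τ⁻¹ * t) / (2 * √τ⁻¹) ≤ 2 * √τ := by
    have hs := Real.sqrt_pos.2 hτ0
    rw [Real.sqrt_inv, div_le_iff₀ (by positivity)]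
    have : 2 * √τ * (2 * (√τ)⁻¹) = 4 := by
      field_simp
      norm_num
    linarith
  have h4 := mul_le_mul_of_nonneg_left h3 (by positivity : 0 ≤ (1 + (n : ℝ) ^ 2) * G)
  linarith

lemma norm_picardCoef_le (hτ0 : 0 < τ) (a : PathSpace n τ) (ξ : Freq n) :
    ‖picardCoef hτ B i f a ξ‖ ≤ ‖f ξ‖ + 2 * (1 + n ^ 2) * √τ *
      (‖B‖ * convReal (fun η => ‖a η‖) (fun η => ‖a η‖) ξ) := by
  have hs := a.hasSum_norm.summable
  have hb := fun s => norm_conv_le B hs hs (a.norm_eval_le hτ s) (a.norm_eval_le hτ s) ξ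
  have := (norm_nonneg _).trans (hb 0)
  refine (ContinuousMap.norm_le _ (by positivity)).2 fun t => ?_
  exact norm_duhamel_short_le hτ0 (f ξ) t.2 hb

variable {f}

lemma summable_picardCoef (hτ0 : 0 < τ) (hf : Summable fun ξ => ‖f ξ‖) (a : PathSpace n τ) :
    Summable fun ξ => ‖picardCoef hτ B i f a ξ‖ := by
  have hs := a.hasSum_norm.summable
  have hc := (convReal_summable hs hs (fun _ => norm_nonneg _) (fun _ => norm_nonneg _)).2.1
  exact .of_nonneg_of_le (fun _ => norm_nonneg _) (norm_picardCoef_le hτ B i f hτ0 a)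
    (hf.add ((hc.mul_left _).mul_left _))

/-- The Picard map on the path space. -/
def picard (hτ0 : 0 < τ) (hf : Summable fun ξ => ‖f ξ‖) (a : PathSpace n τ) : PathSpace n τ :=
  ⟨picardCoef hτ0.le B i f a, memℓp_gen (by simpa using summable_picardCoef hτ0.le B i hτ0 hf a)⟩

lemma norm_picard_le (hτ0 : 0 < τ) (hf : Summable fun ξ => ‖f ξ‖) (a : PathSpace n τ) :
    ‖picard B i hτ0 hf a‖ ≤ ∑' ξ, ‖f ξ‖ + 2 * (1 + n ^ 2) * √τ * (‖B‖ * (‖a‖ * ‖a‖)) := by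
  have hs := a.hasSum_norm.summable
  have hc := (convReal_summable hs hs (fun _ => norm_nonneg _) (fun _ => norm_nonneg _)).2
  rw [← (picard B i hτ0 hf a).hasSum_norm.tsum_eq, ← a.hasSum_norm.tsum_eq, ← hc.2,
    ← tsum_mul_left, ← tsum_mul_left,
    ← Summable.tsum_add hf ((hc.1.mul_left _).mul_left _)]
  exact Summable.tsum_le_tsum (norm_picardCoef_le hτ0.le B i f hτ0 a)
    (summable_picardCoef hτ0.le B i hτ0 hf a) (hf.add ((hc.1.mul_left _).mul_left _))

lemma norm_picard_sub_le (hτ0 : 0 < τ) (hf : Summable fun ξ => ‖f ξ‖) (a b : PathSpace n τ) :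
    ‖picard B i hτ0 hf a - picard B i hτ0 hf b‖ ≤
      2 * (1 + n ^ 2) * √τ * (‖B‖ * ((‖a‖ + ‖b‖) * ‖a - b‖)) := by
  have ha := a.hasSum_norm.summable
  have hb := b.hasSum_norm.summable
  have hd := (a - b).hasSum_norm.summable
  have h1 := (convReal_summable hd ha (fun _ => norm_nonneg _) (fun _ => norm_nonneg _)).2
  have h2 := (convReal_summable hb hd (fun _ => norm_nonneg _) (fun _ => norm_nonneg _)).2
  have hle : ∀ ξ, ‖(picard B i hτ0 hf a - picard B i hτ0 hf b) ξ‖ ≤ 2 * (1 + (n : ℝ) ^ 2) * √τ *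
      (‖B‖ * (convReal (fun η => ‖(a - b) η‖) (fun η => ‖a η‖) ξ +
        convReal (fun η => ‖b η‖) (fun η => ‖(a - b) η‖) ξ)) := by
    intro ξ
    have hbd : ∀ s, ‖conv B (a.eval hτ0.le s) (a.eval hτ0.le s) ξ -
        conv B (b.eval hτ0.le s) (b.eval hτ0.le s) ξ‖ ≤
        ‖B‖ * (convReal (fun η => ‖(a - b) η‖) (fun η => ‖a η‖) ξ +
        convReal (fun η => ‖b η‖) (fun η => ‖(a - b) η‖) ξ) := fun s =>
      norm_conv_sub_conv_le B ha hb hd (a.norm_eval_le hτ0.le s) (b.norm_eval_le hτ0.le s)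
        (fun η => (a - b).norm_eval_le hτ0.le s η) ξ
    have := (norm_nonneg _).trans (hbd 0)
    refine (ContinuousMap.norm_le _ (by positivity)).2 fun t => ?_
    change ‖duhamel i ξ (f ξ) _ t - duhamel i ξ (f ξ) _ t‖ ≤ _
    rw [duhamel_sub _ (a.continuous_conv hτ0.le B ξ) (b.continuous_conv hτ0.le B ξ)]
    have h3 := norm_duhamel_short_le (i := i) (ξ := ξ) hτ0 0 t.2 hbd
    rwa [norm_zero, zero_add] at h3
  have hsum := (((h1.1.add h2.1).mul_left ‖B‖).mul_left (2 * (1 + (n : ℝ) ^ 2) * √τ))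
  rw [← (picard B i hτ0 hf a - picard B i hτ0 hf b).hasSum_norm.tsum_eq]
  refine (Summable.tsum_le_tsum hle
    (picard B i hτ0 hf a - picard B i hτ0 hf b).hasSum_norm.summable hsum).trans_eq ?_
  rw [tsum_mul_left, tsum_mul_left, Summable.tsum_add h1.1 h2.1, h1.2, h2.2,
    a.hasSum_norm.tsum_eq, b.hasSum_norm.tsum_eq, (a - b).hasSum_norm.tsum_eq]
  ring

end PathSpace

section Existence

variable {B : Cn n →L[ℂ] Cn n →L[ℂ] Cn n}

/-- Local existence: the length of the time interval depends on the initial value only through an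
upper bound for the sum of its Fourier coefficients. The rapid decay of the coefficients persists on
the whole interval, because it is encoded in the closed set on which the Picard map contracts. -/
lemma exists_isMild (hB : ∀ v w, B (conjC v) (conjC w) = conjC (B v w)) (i : Fin n) {A : ℝ}
    (hA : 0 < A) {τ : ℝ} (hτ : 0 < τ) (hτA : 16 * (1 + n ^ 2) * √τ * ‖B‖ * A ≤ 1)
    {f : Freq n → Cn n} (hf : Rapid f) (hfr : ∀ ξ, f (-ξ) = conjC (f ξ)) (hfA : ∑' ξ, ‖f ξ‖ ≤ A) :
    ∃ a, IsMild B i τ a ∧ a 0 = f := by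
  have hfs := hf.summable_norm
  choose Fb hFb using hf
  let D : ℕ → ℝ := fun p => (1 + (n : ℝ) ^ 2) * ‖B‖ * 2 ^ (p + 1) * (2 * A)
  let Λ : ℕ → ℝ := fun p => (D p + 1) ^ 2
  have hD : ∀ p, 0 ≤ D p := fun p => by
    have := B.opNorm_nonneg
    positivity
  have hΛ : ∀ p, 0 < Λ p := fun p => by
    have := hD p
    positivity
  have hΛs : ∀ p, √(Λ p) = D p + 1 := fun p => Real.sqrt_sq (by linarith [hD p])
  have hF0 : ∀ p, 0 ≤ Fb p := fun p =>
    (by positivity : (0 : ℝ) ≤ (1 + ‖(0 : Freq n)‖) ^ p * ‖f 0‖).trans (hFb p 0)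
  let S : Set (PathSpace n τ) := {a | ‖a‖ ≤ 2 * A ∧ (∀ ξ t, a (-ξ) t = conjC (a ξ t)) ∧
    ∀ p ξ (t : Icc 0 τ), (1 + ‖ξ‖) ^ p * ‖a ξ t‖ ≤ 2 * Fb p * Real.exp (Λ p * t)}
  have hev : ∀ ξ (t : Icc 0 τ), Continuous fun a : PathSpace n τ => a ξ t := fun ξ t =>
    (continuous_eval_const t).comp
      (lp.lipschitzWith_one_eval (E := fun _ : Freq n => C(Icc 0 τ, Cn n)) 1 ξ).continuous
  have hSc : IsClosed S := by
    have h1 : IsClosed {a : PathSpace n τ | ∀ ξ t, a (-ξ) t = conjC (a ξ t)} := by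
      simp only [Set.ofPred_forall]
      exact isClosed_iInter fun ξ => isClosed_iInter fun t =>
        isClosed_eq (hev _ t) (conjC.continuous.comp (hev ξ t))
    have h2 : IsClosed {a : PathSpace n τ | ∀ p ξ (t : Icc 0 τ),
        (1 + ‖ξ‖) ^ p * ‖a ξ t‖ ≤ 2 * Fb p * Real.exp (Λ p * t)} := by
      simp only [Set.ofPred_forall]
      exact isClosed_iInter fun p => isClosed_iInter fun ξ => isClosed_iInter fun t =>
        isClosed_le (continuous_const.mul (hev ξ t).norm) continuous_const
    exact (isClosed_le continuous_norm continuous_const).inter (h1.inter h2)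
  have h0S : (0 : PathSpace n τ) ∈ S := by
    refine ⟨by simpa using hA.le, fun ξ t => ?_, fun p ξ t => ?_⟩
    · simp
    · have := hF0 p
      simpa using by positivity
  let P := picard B i hτ hfs
  have hmaps : MapsTo P S S := by
    rintro a ⟨ha, har, hap⟩
    have hs := a.hasSum_norm.summable
    refine ⟨?_, fun ξ t => ?_, fun p ξ t => ?_⟩
    · refine (norm_picard_le B i hτ hfs a).trans ?_
      have h1 : ‖a‖ * ‖a‖ ≤ 2 * A * (2 * A) := mul_le_mul ha ha (norm_nonneg _) (by positivity)
      have h2 : 2 * (1 + (n : ℝ) ^ 2) * √τ * (‖B‖ * (‖a‖ * ‖a‖)) ≤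
          2 * (1 + (n : ℝ) ^ 2) * √τ * (‖B‖ * (2 * A * (2 * A))) := by
        have := B.opNorm_nonneg
        gcongr
      nlinarith
    · change duhamel i (-ξ) (f (-ξ)) _ t = conjC (duhamel i ξ (f ξ) _ t)
      rw [← duhamel_neg_conjC _ (a.continuous_conv hτ.le B ξ), hfr]
      congr 1
      funext s
      exact conv_neg_of_real hB (fun ξ => har ξ _)
        (summable_conv_of_le B hs hs (a.norm_eval_le hτ.le s) (a.norm_eval_le hτ.le s) ξ)
    · have hw : 0 < (1 + ‖ξ‖) ^ p := by positivity
      have hconv : ∀ s ∈ Icc (0 : ℝ) t, ‖conv B (a.eval hτ.le s) (a.eval hτ.le s) ξ‖ ≤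
          (2 * Fb p * D p / ((1 + (n : ℝ) ^ 2) * (1 + ‖ξ‖) ^ p)) * Real.exp (Λ p * s) := by
        intro s hs'
        have hsI : s ∈ Icc 0 τ := ⟨hs'.1, hs'.2.trans t.2.2⟩
        have h1 := weight_mul_norm_conv_le B hs (a.norm_eval_le hτ.le s)
          (p := p) (M := 2 * Fb p * Real.exp (Λ p * s)) (fun η => by
            have := hap p η ⟨s, hsI⟩
            rwa [PathSpace.eval, projIcc_of_mem hτ.le hsI]) ξ
        rw [a.hasSum_norm.tsum_eq] at h1
        have h2 : (1 + ‖ξ‖) ^ p * ‖conv B (a.eval hτ.le s) (a.eval hτ.le s) ξ‖ ≤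
            ‖B‖ * 2 ^ (p + 1) * (2 * Fb p * Real.exp (Λ p * s)) * (2 * A) := by
          refine h1.trans ?_
          have := B.opNorm_nonneg
          have := hF0 p
          gcongr
        rw [← le_div_iff₀' hw] at h2
        refine h2.trans_eq ?_
        simp only [D]
        field_simp
      have h3 := norm_duhamel_le (i := i) (ξ := ξ) (f ξ) (hΛ p) t.2.1 hconv
      change (1 + ‖ξ‖) ^ p * ‖duhamel i ξ (f ξ) _ t‖ ≤ _
      have hD1 : D p / (D p + 1) ≤ 1 := div_le_one_of_le₀ (by linarith) (by linarith [hD p])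
      have hexp : 1 ≤ Real.exp (Λ p * t) := Real.one_le_exp (mul_nonneg (hΛ p).le t.2.1)
      calc _ ≤ (1 + ‖ξ‖) ^ p * (‖f ξ‖ + (1 + (n : ℝ) ^ 2) *
            (2 * Fb p * D p / ((1 + (n : ℝ) ^ 2) * (1 + ‖ξ‖) ^ p)) *
              (Real.exp (Λ p * t) / (2 * √(Λ p)))) := by gcongr
        _ = (1 + ‖ξ‖) ^ p * ‖f ξ‖ + Fb p * (D p / (D p + 1)) * Real.exp (Λ p * t) := by
            have : D p + 1 ≠ 0 := by linarith [hD p]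
            rw [hΛs]
            field_simp
        _ ≤ Fb p * Real.exp (Λ p * t) + Fb p * 1 * Real.exp (Λ p * t) := by
            have := hF0 p
            exact add_le_add ((hFb p ξ).trans (le_mul_of_one_le_right this hexp)) (by gcongr)
        _ = _ := by ring
  have hcontr : ContractingWith (1 / 2) (hmaps.restrict P S S) := by
    refine ⟨by norm_num, LipschitzWith.of_dist_le_mul ?_⟩
    rintro ⟨a, ha⟩ ⟨b, hb⟩
    change dist (P a) (P b) ≤ _ * dist a b
    rw [dist_eq_norm, dist_eq_norm]
    refine (norm_picard_sub_le B i hτ hfs a b).trans ?_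
    have h1 : 2 * (1 + (n : ℝ) ^ 2) * √τ * (‖B‖ * ((‖a‖ + ‖b‖) * ‖a - b‖)) ≤
        2 * (1 + (n : ℝ) ^ 2) * √τ * (‖B‖ * ((2 * A + 2 * A) * ‖a - b‖)) := by
      have := B.opNorm_nonneg
      gcongr
      · exact ha.1
      · exact hb.1
    refine h1.trans ?_
    have := mul_le_mul_of_nonneg_right hτA (norm_nonneg (a - b))
    push_cast
    linarith
  obtain ⟨a, ⟨-, har, hap⟩, hfix, -⟩ := hcontr.exists_fixedPoint' hSc.isComplete hmaps h0S
    (edist_ne_top _ _)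
  have hfix' : ∀ t ∈ Icc 0 τ, ∀ ξ, a.eval hτ.le t ξ =
      duhamel i ξ (f ξ) (fun s => conv B (a.eval hτ.le s) (a.eval hτ.le s) ξ) t := by
    intro t ht ξ
    have h1 : P a = a := hfix
    have h2 : (P a) ξ ⟨t, ht⟩ = a ξ ⟨t, ht⟩ := by rw [h1]
    rw [PathSpace.eval, projIcc_of_mem hτ.le ht, ← h2]
    rfl
  refine ⟨a.eval hτ.le, ⟨fun p => ?_, fun ξ t ht => ?_, fun t ht ξ => har ξ _⟩, ?_⟩
  · refine ⟨2 * Fb p * Real.exp (Λ p * τ), fun t ht ξ => ?_⟩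
    rw [PathSpace.eval, projIcc_of_mem hτ.le ht]
    refine (hap p ξ ⟨t, ht⟩).trans ?_
    have := hF0 p
    have := hΛ p
    gcongr
    exact ht.2
  · have h1 := (hasDerivAt_duhamel (i := i) (ξ := ξ) (f ξ) (a.continuous_conv hτ.le B ξ) t).hasDerivWithinAt
      (s := Icc 0 τ)
    rw [← hfix' t ht ξ] at h1
    exact h1.congr (fun s hs => hfix' s hs ξ) (hfix' t ht ξ)
  · funext ξ
    rw [hfix' 0 ⟨le_rfl, hτ.le⟩ ξ]
    simp [duhamel, heat]

end Existence

end PeriodicModel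

namespace PeriodicModel

/-! ### Smoothness in space and time -/

variable {n : ℕ} {F : Type*} [NormedAddCommGroup F] [NormedSpace ℂ F]

/-- A path of lattice sequences on `[0, τ]` that decays rapidly, together with its first `m` time
derivatives. The derivatives are one-sided at the end points. -/
def SmoothPath (τ : ℝ) : ℕ → (ℝ → Freq n → F) → Prop
  | 0, c => RapidOn (Icc 0 τ) c ∧ ∀ ξ, ContinuousOn (fun s => c s ξ) (Icc 0 τ)
  | m + 1, c => RapidOn (Icc 0 τ) c ∧ ∃ c', SmoothPath τ m c' ∧
      ∀ ξ, ∀ t ∈ Icc 0 τ, HasDerivWithinAt (fun s => c s ξ) (c' t ξ) (Icc 0 τ) t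

variable {τ : ℝ}

lemma SmoothPath.rapid {m : ℕ} {c : ℝ → Freq n → F} (h : SmoothPath τ m c) :
    RapidOn (Icc 0 τ) c := by
  cases m with
  | zero => exact h.1
  | succ m => exact h.1

lemma SmoothPath.continuousOn {m : ℕ} {c : ℝ → Freq n → F} (h : SmoothPath τ m c) (ξ : Freq n) :
    ContinuousOn (fun s => c s ξ) (Icc 0 τ) := by
  cases m with
  | zero => exact h.2 ξ
  | succ m =>
    obtain ⟨-, c', -, hd⟩ := h
    exact fun t ht => (hd ξ t ht).continuousWithinAt

lemma SmoothPath.pred {m : ℕ} {c : ℝ → Freq n → F} (h : SmoothPath τ (m + 1) c) :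
    SmoothPath τ m c := by
  induction m generalizing c with
  | zero => exact ⟨h.rapid, h.continuousOn⟩
  | succ m ih =>
    obtain ⟨hr, c', hc', hd⟩ := h
    exact ⟨hr, c', ih hc', hd⟩

lemma SmoothPath.add {m : ℕ} {a b : ℝ → Freq n → F} (ha : SmoothPath τ m a)
    (hb : SmoothPath τ m b) : SmoothPath τ m fun t ξ => a t ξ + b t ξ := by
  induction m generalizing a b with
  | zero => exact ⟨ha.1.add hb.1, fun ξ => (ha.2 ξ).add (hb.2 ξ)⟩
  | succ m ih =>
    obtain ⟨har, a', ha', had⟩ := ha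
    obtain ⟨hbr, b', hb', hbd⟩ := hb
    exact ⟨har.add hbr, _, ih ha' hb', fun ξ t ht => (had ξ t ht).add (hbd ξ t ht)⟩

/-- Fourier multipliers of polynomial growth preserve the smoothness of paths. -/
lemma SmoothPath.map {F' : Type*} [NormedAddCommGroup F'] [NormedSpace ℂ F']
    (L : Freq n → F →L[ℂ] F') (C : ℝ) (p : ℕ)
    (hL : ∀ ξ v, ‖L ξ v‖ ≤ C * (1 + ‖ξ‖) ^ p * ‖v‖) {m : ℕ} {a : ℝ → Freq n → F}
    (ha : SmoothPath τ m a) : SmoothPath τ m fun t ξ => L ξ (a t ξ) := by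
  induction m generalizing a with
  | zero =>
    exact ⟨ha.1.of_le C p fun t _ ξ => hL ξ _, fun ξ => (L ξ).continuous.comp_continuousOn (ha.2 ξ)⟩
  | succ m ih =>
    obtain ⟨har, a', ha', had⟩ := ha
    exact ⟨har.of_le C p fun t _ ξ => hL ξ _, _, ih ha', fun ξ t ht =>
      ((L ξ).restrictScalars ℝ).hasFDerivAt.comp_hasDerivWithinAt t (had ξ t ht)⟩

lemma SmoothPath.const {b : Freq n → F} (hb : Rapid b) (m : ℕ) : SmoothPath τ m fun _ => b := by
  induction m generalizing b with
  | zero => exact ⟨hb.rapidOn _, fun ξ => continuousOn_const⟩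
  | succ m ih =>
    exact ⟨hb.rapidOn _, fun _ _ => 0, ih fun s => ⟨0, fun ξ => by simp⟩, fun ξ t _ =>
      hasDerivWithinAt_const t _ (b ξ)⟩

lemma SmoothPath.derivCoef {m : ℕ} {a : ℝ → Freq n → F} (ha : SmoothPath τ m a) (k : Fin n) :
    SmoothPath τ m fun t => derivCoef k (a t) :=
  ha.map (fun ξ => (Complex.I * ξ k) • ContinuousLinearMap.id ℂ F) 1 1
    fun ξ v => norm_derivCoef_le k (fun _ => v) ξ

/-- The derivative of `(t, x) ↦ synth (c t) x`, where `c'` is the derivative of `c`. -/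
def synthDeriv (c c' : ℝ → Freq n → F) (p : ℝ × Rn n) : ℝ × Rn n →L[ℝ] F :=
  (ContinuousLinearMap.fst ℝ ℝ (Rn n)).smulRight (synth (c' p.1) p.2) +
    ∑ k, ((EuclideanSpace.proj k : Rn n →L[ℝ] ℝ).comp
      (ContinuousLinearMap.snd ℝ ℝ (Rn n))).smulRight (synth (derivCoef k (c p.1)) p.2)

lemma synthDeriv_apply (c c' : ℝ → Freq n → F) (p y : ℝ × Rn n) : synthDeriv c c' p y =
    y.1 • synth (c' p.1) p.2 + ∑ k, y.2 k • synth (derivCoef k (c p.1)) p.2 := by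
  simp [synthDeriv]

variable [CompleteSpace F]

/-- A continuously differentiable path extends past both end points of `[0, τ]`, so that theorems on
series of differentiable functions on open sets apply to it. -/
lemma exists_extension (hτ : 0 ≤ τ) {c c' : ℝ → Freq n → F} (hc : RapidOn (Icc 0 τ) c)
    (hc' : RapidOn (Icc 0 τ) c') (hcont : ∀ ξ, ContinuousOn (fun s => c' s ξ) (Icc 0 τ))
    (hd : ∀ ξ, ∀ t ∈ Icc 0 τ, HasDerivWithinAt (fun s => c s ξ) (c' t ξ) (Icc 0 τ) t) :
    ∃ e e' : ℝ → Freq n → F, (∀ t ∈ Icc 0 τ, e t = c t) ∧ (∀ t ∈ Icc 0 τ, e' t = c' t) ∧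
      (∀ ξ t, HasDerivAt (fun s => e s ξ) (e' t ξ) t) ∧ RapidOn (Ioo (-1) (τ + 1)) e ∧
      RapidOn (Ioo (-1) (τ + 1)) e' := by
  let e' : ℝ → Freq n → F := fun t ξ => c' (projIcc 0 τ hτ t) ξ
  let e : ℝ → Freq n → F := fun t ξ => c 0 ξ + ∫ s in 0..t, e' s ξ
  have h0 : (0 : ℝ) ∈ Icc 0 τ := ⟨le_rfl, hτ⟩
  have he' : ∀ ξ, Continuous fun s => e' s ξ := fun ξ =>
    (hcont ξ).comp_continuous (continuous_subtype_val.comp continuous_projIcc) fun t =>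
      (projIcc 0 τ hτ t).2
  have heq : ∀ t ∈ Icc 0 τ, e' t = c' t := fun t ht => by
    simp only [e', projIcc_of_mem hτ ht]
  refine ⟨e, e', fun t ht => ?_, heq, fun ξ t => ?_, fun s => ?_, fun s => ?_⟩
  · funext ξ
    have hsub : Icc 0 t ⊆ Icc 0 τ := Icc_subset_Icc le_rfl ht.2
    have := intervalIntegral.integral_eq_sub_of_hasDerivAt_of_le ht.1
      (f := fun s => c s ξ) (f' := fun s => e' s ξ)
      (fun s hs => ((hd ξ s (hsub hs)).continuousWithinAt).mono hsub)
      (fun s hs => by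
        have hs' := hsub (Ioo_subset_Icc_self hs)
        rw [heq s hs']
        exact (hd ξ s hs').hasDerivAt (Icc_mem_nhds hs.1 (hs.2.trans_le ht.2)))
      ((he' ξ).intervalIntegrable 0 t)
    simp only [e, this]
    abel
  · exact (intervalIntegral.integral_hasDerivAt_right ((he' ξ).intervalIntegrable 0 t)
      ((he' ξ).stronglyMeasurableAtFilter _ _) (he' ξ).continuousAt).const_add (c 0 ξ)
  · obtain ⟨M, hM⟩ := hc s
    obtain ⟨M', hM'⟩ := hc' s
    refine ⟨M + M' * (τ + 1), fun t ht ξ => ?_⟩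
    have hw : 0 < (1 + ‖ξ‖) ^ s := by positivity
    have hM0 : 0 ≤ M' := (by positivity : (0 : ℝ) ≤ (1 + ‖ξ‖) ^ s * ‖c' 0 ξ‖).trans (hM' 0 h0 ξ)
    have h1 : ‖∫ r in 0..t, e' r ξ‖ ≤ M' / (1 + ‖ξ‖) ^ s * |t - 0| :=
      intervalIntegral.norm_integral_le_of_norm_le_const fun r _ => by
        rw [le_div_iff₀' hw]
        exact hM' _ (projIcc 0 τ hτ r).2 ξ
    have h2 : |t - 0| ≤ τ + 1 := by
      rw [sub_zero, abs_le]
      constructor <;> linarith [ht.1, ht.2]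
    calc (1 + ‖ξ‖) ^ s * ‖e t ξ‖
        ≤ (1 + ‖ξ‖) ^ s * (‖c 0 ξ‖ + M' / (1 + ‖ξ‖) ^ s * (τ + 1)) := by
          gcongr
          exact (norm_add_le _ _).trans (add_le_add le_rfl (h1.trans (by gcongr)))
      _ = (1 + ‖ξ‖) ^ s * ‖c 0 ξ‖ + M' * (τ + 1) := by field_simp
      _ ≤ _ := by gcongr; exact hM 0 h0 ξ
  · obtain ⟨M', hM'⟩ := hc' s
    exact ⟨M', fun t _ ξ => hM' _ (projIcc 0 τ hτ t).2 ξ⟩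

lemma hasDerivWithinAt_conv (hτ : 0 ≤ τ) (B : F →L[ℂ] F →L[ℂ] F) {a a' b b' : ℝ → Freq n → F}
    {m : ℕ} (ha : RapidOn (Icc 0 τ) a) (ha' : SmoothPath τ m a')
    (had : ∀ ξ, ∀ t ∈ Icc 0 τ, HasDerivWithinAt (fun s => a s ξ) (a' t ξ) (Icc 0 τ) t)
    (hb : RapidOn (Icc 0 τ) b) (hb' : SmoothPath τ m b')
    (hbd : ∀ ξ, ∀ t ∈ Icc 0 τ, HasDerivWithinAt (fun s => b s ξ) (b' t ξ) (Icc 0 τ) t)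
    (ξ : Freq n) {t : ℝ} (ht : t ∈ Icc 0 τ) :
    HasDerivWithinAt (fun s => conv B (a s) (b s) ξ)
      (conv B (a t) (b' t) ξ + conv B (a' t) (b t) ξ) (Icc 0 τ) t := by
  obtain ⟨e, e', he, he', hed, her, her'⟩ :=
    exists_extension hτ ha ha'.rapid ha'.continuousOn had
  obtain ⟨f, f', hf, hf', hfd, hfr, hfr'⟩ :=
    exists_extension hτ hb hb'.rapid hb'.continuousOn hbd
  obtain ⟨u, hu, hu0, heu⟩ := her.exists_summable_norm
  obtain ⟨u', hu', hu0', heu'⟩ := her'.exists_summable_norm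
  obtain ⟨M, hM⟩ := hfr 0
  obtain ⟨M', hM'⟩ := hfr' 0
  simp only [pow_zero, one_mul] at hM hM'
  have htI : t ∈ Ioo (-1) (τ + 1) := ⟨by linarith [ht.1], by linarith [ht.2]⟩
  have h1 := hasDerivAt_tsum_of_isPreconnected (𝕜 := ℝ)
    (g := fun η s => B (e s η) (f s (ξ - η)))
    (g' := fun η s => B (e s η) (f' s (ξ - η)) + B (e' s η) (f s (ξ - η)))
    (u := fun η => ‖B‖ * (u η * M') + ‖B‖ * (u' η * M))
    (((hu.mul_right M').mul_left _).add ((hu'.mul_right M).mul_left _)) isOpen_Ioo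
    (isPreconnected_Ioo (a := -1) (b := τ + 1))
    (fun η s _ => (ContinuousLinearMap.bilinearRestrictScalars ℝ B).hasDerivAt_of_bilinear
      (fun _ => hed η s) (fun _ => hfd (ξ - η) s))
    (fun η s hs => (norm_add_le _ _).trans (add_le_add
      (norm_bilinear_le B (heu s hs η) (hM' s hs _)) (norm_bilinear_le B (heu' s hs η) (hM s hs _))))
    htI (summable_conv B (her.rapid htI).summable_norm (hfr.rapid htI) ξ) htI
  rw [Summable.tsum_add (summable_conv B (her.rapid htI).summable_norm (hfr'.rapid htI) ξ)
    (summable_conv B (her'.rapid htI).summable_norm (hfr.rapid htI) ξ)] at h1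
  simp only [he t ht, he' t ht, hf t ht, hf' t ht] at h1
  refine h1.hasDerivWithinAt.congr (fun s hs => ?_) ?_
  · simp only [he s hs, hf s hs, conv]
  · simp only [he t ht, hf t ht, conv]

lemma SmoothPath.conv (hτ : 0 ≤ τ) (B : F →L[ℂ] F →L[ℂ] F) {m : ℕ} {a b : ℝ → Freq n → F}
    (ha : SmoothPath τ m a) (hb : SmoothPath τ m b) :
    SmoothPath τ m fun t => conv B (a t) (b t) := by
  induction m generalizing a b with
  | zero => exact ⟨ha.1.conv B hb.1, continuousOn_conv B ha.1 hb.1 ha.2 hb.2⟩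
  | succ m ih =>
    have ha0 := ha.pred
    have hb0 := hb.pred
    obtain ⟨har, a', ha', had⟩ := ha
    obtain ⟨hbr, b', hb', hbd⟩ := hb
    exact ⟨har.conv B hbr, _, (ih ha0 hb').add (ih ha' hb0), fun ξ t ht =>
      hasDerivWithinAt_conv hτ B har ha' had hbr hb' hbd ξ ht⟩

lemma hasFDerivWithinAt_synth (hτ : 0 ≤ τ) {c c' : ℝ → Freq n → F} {m : ℕ}
    (hc : RapidOn (Icc 0 τ) c) (hc' : SmoothPath τ m c')
    (hd : ∀ ξ, ∀ t ∈ Icc 0 τ, HasDerivWithinAt (fun s => c s ξ) (c' t ξ) (Icc 0 τ) t)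
    {p : ℝ × Rn n} (hp : p ∈ Icc 0 τ ×ˢ (univ : Set (Rn n))) :
    HasFDerivWithinAt (fun p : ℝ × Rn n => synth (c p.1) p.2) (synthDeriv c c' p)
      (Icc 0 τ ×ˢ univ) p := by
  obtain ⟨e, e', he, he', hed, her, her'⟩ :=
    exists_extension hτ hc hc'.rapid hc'.continuousOn hd
  obtain ⟨u, hu, hu0, heu⟩ := her.exists_summable 1
  obtain ⟨u', hu', hu0', heu'⟩ := her'.exists_summable_norm
  let D : Freq n → ℝ × Rn n → ℝ × Rn n →L[ℝ] F := fun ξ q =>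
    (ContinuousLinearMap.fst ℝ ℝ (Rn n)).smulRight (character ξ q.2 • e' q.1 ξ) +
      (characterDeriv ξ (e q.1 ξ) q.2).comp (ContinuousLinearMap.snd ℝ ℝ (Rn n))
  have hD : ∀ ξ q, HasFDerivAt (fun q : ℝ × Rn n => character ξ q.2 • e q.1 ξ) (D ξ q) q := by
    intro ξ q
    have h1 := (hasFDerivAt_character ξ q.2).comp q (hasFDerivAt_snd (𝕜 := ℝ) (p := q))
    have h2 := (hed ξ q.1).hasFDerivAt.comp q (hasFDerivAt_fst (𝕜 := ℝ) (p := q))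
    refine (h1.smul h2).congr_fderiv ?_
    refine ContinuousLinearMap.ext fun y => ?_
    change character ξ q.2 • (y.1 • e' q.1 ξ) +
      (freqForm ξ y.2 • (Complex.I * character ξ q.2)) • e q.1 ξ =
      y.1 • (character ξ q.2 • e' q.1 ξ) +
      freqForm ξ y.2 • ((Complex.I * character ξ q.2) • e q.1 ξ)
    rw [smul_comm, smul_assoc]
  have hDle : ∀ ξ q, q ∈ Ioo (-1) (τ + 1) ×ˢ (univ : Set (Rn n)) → ‖D ξ q‖ ≤ u' ξ + n * u ξ := by
    intro ξ q hq
    refine (norm_add_le _ _).trans (add_le_add ?_ ?_)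
    · rw [ContinuousLinearMap.norm_smulRight_apply, norm_smul, norm_character, one_mul]
      exact (mul_le_of_le_one_left (norm_nonneg _) (ContinuousLinearMap.norm_fst_le ..)).trans
        (heu' _ hq.1 ξ)
    · refine (ContinuousLinearMap.opNorm_comp_le _ _).trans ((mul_le_of_le_one_right (norm_nonneg _)
        (ContinuousLinearMap.norm_snd_le ..)).trans ((norm_characterDeriv_le _ _ _).trans ?_))
      gcongr
      exact heu _ hq.1 ξ
  have hpI : p ∈ Ioo (-1) (τ + 1) ×ˢ (univ : Set (Rn n)) :=
    ⟨⟨by linarith [hp.1.1], by linarith [hp.1.2]⟩, trivial⟩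
  have hsum := hu'.add (hu.mul_left (n : ℝ))
  have h1 := hasFDerivAt_tsum_of_isPreconnected hsum (isOpen_Ioo.prod isOpen_univ)
    (isPreconnected_Ioo.prod isPreconnected_univ) (fun ξ q _ => hD ξ q) hDle hpI
    (summable_synth (her.rapid hpI.1).summable_norm p.2) hpI
  have h2 : ∑' ξ, D ξ p = synthDeriv c c' p := by
    refine ContinuousLinearMap.ext fun y => ?_
    have hs : Summable fun ξ => D ξ p := .of_norm_bounded hsum fun ξ => hDle ξ p hpI
    have h3 := (ContinuousLinearMap.apply ℝ F y).hasSum hs.hasSum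
    refine h3.unique ?_
    rw [synthDeriv_apply]
    have h4 := (summable_synth (hc'.rapid.rapid hp.1).summable_norm p.2).hasSum.const_smul y.1
    have h5 := hasSum_sum (s := Finset.univ) fun k _ =>
      (summable_synth ((hc.rapid hp.1).derivCoef k).summable_norm p.2).hasSum.const_smul (y.2 k)
    have h6 : ∀ ξ, ContinuousLinearMap.apply ℝ F y (D ξ p) = y.1 • character ξ p.2 • c' p.1 ξ +
        ∑ k, y.2 k • character ξ p.2 • derivCoef k (c p.1) ξ := by
      intro ξ
      change y.1 • (character ξ p.2 • e' p.1 ξ) +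
        freqForm ξ y.2 • ((Complex.I * character ξ p.2) • e p.1 ξ) = _
      rw [he p.1 hp.1, he' p.1 hp.1, freqForm_apply, Finset.sum_smul]
      congr 1
      refine Finset.sum_congr rfl fun k _ => ?_
      simp only [derivCoef, ← ofReal_smul_eq, smul_smul]
      congr 1
      push_cast
      ring
    simp only [h6]
    exact h4.add h5
  rw [h2] at h1
  refine h1.hasFDerivWithinAt.congr (fun q hq => ?_) ?_
  · simp only [synth, he q.1 hq.1]
  · simp only [synth, he p.1 hp.1]

lemma SmoothPath.contDiffOn (hτ : 0 < τ) {m : ℕ} {c : ℝ → Freq n → F} (hc : SmoothPath τ m c) :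
    ContDiffOn ℝ m (fun p : ℝ × Rn n => synth (c p.1) p.2) (Icc 0 τ ×ˢ univ) := by
  induction m generalizing c with
  | zero =>
    rw [Nat.cast_zero, contDiffOn_zero]
    exact continuousOn_synth hc.1 hc.2
  | succ m ih =>
    have hc0 := hc.pred
    obtain ⟨hr, c', hc', hd⟩ := hc
    rw [Nat.cast_succ, contDiffOn_succ_iff_hasFDerivWithinAt_of_uniqueDiffOn
      ((uniqueDiffOn_Icc hτ).prod uniqueDiffOn_univ)]
    refine ⟨fun h => absurd h (by simp), synthDeriv c c', contDiffOn_clm_apply.2 fun y => ?_,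
      fun p hp => hasFDerivWithinAt_synth hτ.le hr hc' hd hp⟩
    simp only [synthDeriv_apply]
    exact (contDiffOn_const.smul (ih hc')).add
      (ContDiffOn.sum fun k _ => contDiffOn_const.smul (ih (hc0.derivCoef k)))

lemma contDiff_synth {b : Freq n → F} (hb : Rapid b) : ContDiff ℝ ∞ (synth b) := by
  refine contDiff_infty.2 fun m => ?_
  have h := (SmoothPath.const (τ := 1) hb m).contDiffOn one_pos
  exact contDiffOn_univ.1 (h.comp (g := fun p : ℝ × Rn n => synth b p.2)
    (f := fun x : Rn n => ((0 : ℝ), x)) (contDiff_const.prodMk contDiff_id).contDiffOn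
    fun x _ => ⟨⟨le_rfl, zero_le_one⟩, trivial⟩)

lemma SmoothPath.hasDerivAt_synth {m : ℕ} {c c' : ℝ → Freq n → F}
    (hc : RapidOn (Icc 0 τ) c) (hc' : SmoothPath τ m c')
    (hd : ∀ ξ, ∀ t ∈ Icc 0 τ, HasDerivWithinAt (fun s => c s ξ) (c' t ξ) (Icc 0 τ) t)
    {t : ℝ} (ht : t ∈ Ioo 0 τ) (x : Rn n) :
    HasDerivAt (fun s => synth (c s) x) (synth (c' t) x) t := by
  have hp : (t, x) ∈ Icc 0 τ ×ˢ (univ : Set (Rn n)) := ⟨Ioo_subset_Icc_self ht, trivial⟩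
  have h1 := (hasFDerivWithinAt_synth (ht.1.trans ht.2).le hc hc' hd hp).hasFDerivAt
    (prod_mem_nhds (Icc_mem_nhds ht.1 ht.2) Filter.univ_mem)
  have h2 := h1.comp_hasDerivAt t ((hasDerivAt_id t).prodMk (hasDerivAt_const t x))
  refine h2.congr_deriv ?_
  simp [synthDeriv_apply]

section Mild

variable {B : Cn n →L[ℂ] Cn n →L[ℂ] Cn n} {i : Fin n} {a : ℝ → Freq n → Cn n}

/-- `D_i ℙ` at a fixed frequency, as a continuous linear map. -/
def lerayDerivCLM (i : Fin n) (ξ : Freq n) : Cn n →L[ℂ] Cn n where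
  toFun := lerayDeriv i ξ
  map_add' v w := by
    simp only [lerayDeriv, lerayCoef_eq, map_add, smul_add, Finset.sum_add_distrib, smul_sub]
    abel
  map_smul' c v := lerayDeriv_smul i ξ c v
  cont := continuous_lerayDeriv i ξ

lemma SmoothPath.nonlinearity (hτ : 0 ≤ τ) {m : ℕ} (ha : SmoothPath τ m a) :
    SmoothPath τ m fun t => nonlinearity B i (a t) :=
  (ha.conv hτ B ha).map (lerayDerivCLM i) (1 + n ^ 2) 1 (norm_lerayDeriv_le i)

lemma SmoothPath.laplacian {m : ℕ} (ha : SmoothPath τ m a) :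
    SmoothPath τ m fun t ξ => (-(lenSq ξ : ℂ)) • a t ξ :=
  ha.map (fun ξ => (-(lenSq ξ : ℂ)) • ContinuousLinearMap.id ℂ (Cn n)) n 2 fun ξ v => by
    rw [FunLike.coe_smul, Pi.smul_apply, norm_smul, norm_neg, Complex.norm_real,
      Real.norm_of_nonneg (lenSq_nonneg ξ)]
    refine mul_le_mul_of_nonneg_right ((lenSq_le ξ).trans ?_) (norm_nonneg _)
    gcongr
    linarith

/-- The equation gives all time derivatives of the coefficients, by induction. -/
lemma IsMild.smoothPath (hτ : 0 ≤ τ) (h : IsMild B i τ a) (m : ℕ) : SmoothPath τ m a := by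
  induction m with
  | zero => exact ⟨h.rapid, h.continuousOn⟩
  | succ m ih => exact ⟨h.rapid, _, ih.laplacian.add (ih.nonlinearity hτ), h.deriv⟩

end Mild

end PeriodicModel

namespace PeriodicModel

/-! ### Real vector fields and their complexification -/

variable {n : ℕ}

/-- The inclusion of `ℝⁿ` into `ℂⁿ`. -/
def complexify : Rn n →L[ℝ] Cn n :=
  LinearMap.toContinuousLinearMap
    { toFun := fun v => WithLp.toLp 2 fun k => (v k : ℂ)
      map_add' := fun v w => by
        ext k
        simp
      map_smul' := fun c v => by
        ext k
        simp }

lemma complexify_apply (v : Rn n) (k : Fin n) : complexify v k = (v k : ℂ) := rfl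

/-- The componentwise real part. -/
def realPart : Cn n →L[ℝ] Rn n :=
  LinearMap.toContinuousLinearMap
    { toFun := fun v => WithLp.toLp 2 fun k => (v k).re
      map_add' := fun v w => by
        ext k
        simp
      map_smul' := fun c v => by
        ext k
        simp }

lemma realPart_apply (v : Cn n) (k : Fin n) : realPart v k = (v k).re := rfl

lemma norm_complexify (v : Rn n) : ‖complexify v‖ = ‖v‖ := by
  simp [EuclideanSpace.norm_eq, complexify_apply]

lemma realPart_complexify (v : Rn n) : realPart (complexify v) = v := by
  ext k
  simp [realPart_apply, complexify_apply]

lemma complexify_realPart {v : Cn n} (hv : conjC v = v) : complexify (realPart v) = v := by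
  ext k
  have : (starRingEnd ℂ) (v k) = v k := by rw [← conjC_apply, hv]
  rw [complexify_apply, realPart_apply]
  exact Complex.conj_eq_iff_re.1 this

lemma conjC_complexify (v : Rn n) : conjC (complexify v) = complexify v := by
  ext k
  simp [conjC_apply, complexify_apply]

lemma conjC_conjC (v : Cn n) : conjC (conjC v) = v := by
  ext k
  simp [conjC_apply]

lemma conjC_synth {b : Freq n → Cn n} (hb : Summable fun ξ => ‖b ξ‖)
    (hr : ∀ ξ, b (-ξ) = conjC (b ξ)) (x : Rn n) : conjC (synth b x) = synth b x := by
  rw [synth, conjC.map_tsum (summable_synth hb x), ← (Equiv.neg (Freq n)).tsum_eq]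
  refine tsum_congr fun ξ => ?_
  rw [Equiv.neg_apply, conjC_smul, character_neg, hr, Complex.conj_conj, conjC_conjC]

section Quadratic

variable (g : QuadraticMap ℝ (Rn n) (Rn n))

/-- The complex bilinear extension of the symmetric bilinear map of a quadratic map. -/
def complexBilin : Cn n →L[ℂ] Cn n →L[ℂ] Cn n :=
  ∑ p, ∑ q, (EuclideanSpace.proj p : Cn n →L[ℂ] ℂ).smulRight
    ((EuclideanSpace.proj q : Cn n →L[ℂ] ℂ).smulRight (complexify ((1 / 2 : ℝ) •
      QuadraticMap.polar g (EuclideanSpace.single p 1) (EuclideanSpace.single q 1))))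

lemma complexBilin_apply (v w : Cn n) : complexBilin g v w = ∑ p, ∑ q, v p • w q •
    complexify ((1 / 2 : ℝ) •
      QuadraticMap.polar g (EuclideanSpace.single p 1) (EuclideanSpace.single q 1)) := by
  simp [complexBilin]

lemma complexBilin_conjC (v w : Cn n) :
    complexBilin g (conjC v) (conjC w) = conjC (complexBilin g v w) := by
  simp only [complexBilin_apply, map_sum, conjC_smul, conjC_complexify, conjC_apply]

/-- The factor `1 / 2` in the definition of `complexBilin` compensates for `polar g v v = 2 g v`. -/
lemma complexBilin_complexify (v : Rn n) :
    complexBilin g (complexify v) (complexify v) = complexify (g v) := by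
  have h1 : ∑ p, v p • EuclideanSpace.single p (1 : ℝ) = v := by
    ext k
    simp [Finset.sum_apply, Pi.single_apply]
  have h2 : g v = (1 / 2 : ℝ) • QuadraticMap.polarBilin g v v := by
    rw [QuadraticMap.polarBilin_apply_apply, QuadraticMap.polar_self]
    module
  have h3 : QuadraticMap.polarBilin g v v = ∑ p, ∑ q, v p • v q •
      QuadraticMap.polar g (EuclideanSpace.single p 1) (EuclideanSpace.single q 1) := by
    conv_lhs => rw [← h1]
    simp only [map_sum, LinearMap.sum_apply, map_smul, LinearMap.smul_apply,
      QuadraticMap.polarBilin_apply_apply, Finset.smul_sum]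
    rw [Finset.sum_comm]
    refine Finset.sum_congr rfl fun p _ => Finset.sum_congr rfl fun q _ => smul_comm _ _ _
  rw [h2, h3, complexBilin_apply]
  simp only [Finset.smul_sum, map_sum, map_smul, complexify_apply, ofReal_smul_eq]
  refine Finset.sum_congr rfl fun p _ => Finset.sum_congr rfl fun q _ => ?_
  module

end Quadratic

section Operators

lemma partialD_realPart_synth {b : Freq n → Cn n} (hb : Rapid b) (k : Fin n) :
    partialD k (fun x => realPart (synth b x)) = fun x => realPart (synth (derivCoef k b) x) := by
  funext x
  have h := realPart.hasFDerivAt.comp x ((contDiff_synth hb).differentiable (by simp) x).hasFDerivAt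
  rw [partialD, ← fderiv_synth_single hb x k]
  exact congrArg (fun L => L (EuclideanSpace.single k 1)) h.fderiv

lemma partialD_iterate_realPart_synth {b : Freq n → Cn n} (hb : Rapid b) (k : Fin n) (m : ℕ) :
    (partialD k)^[m] (fun x => realPart (synth b x)) =
      fun x => realPart (synth (wordCoef (List.replicate m k) b) x) := by
  induction m generalizing b with
  | zero => simp [wordCoef_nil]
  | succ m ih =>
    rw [Function.iterate_succ_apply, partialD_realPart_synth hb, ih (hb.derivCoef k),
      List.replicate_succ, wordCoef_cons]

lemma wordCoef_append {F : Type*} [NormedAddCommGroup F] [NormedSpace ℂ F] (v w : List (Fin n))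
    (b : Freq n → F) : wordCoef (v ++ w) b = wordCoef v (wordCoef w b) := by
  induction v generalizing b with
  | nil => rw [List.nil_append, wordCoef_nil]
  | cons k v ih =>
    rw [List.cons_append, wordCoef_cons, wordCoef_cons, ih]
    congr 1
    funext ξ
    simp only [wordCoef, derivCoef, smul_comm (wordSymbol w ξ)]

/-- The derivative `D^α` acts on Fourier coefficients through a word of length `|α|`. -/
lemma exists_word_multiD (α : Fin n → ℕ) : ∃ w : List (Fin n), w.length = ∑ k, α k ∧
    ∀ b : Freq n → Cn n, Rapid b → multiD α (fun x => realPart (synth b x)) =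
      fun x => realPart (synth (wordCoef w b) x) := by
  have h : ∀ l : List (Fin n), ∃ w : List (Fin n), w.length = (l.map α).sum ∧
      ∀ b : Freq n → Cn n, Rapid b →
        l.foldr (fun k w => (partialD k)^[α k] w) (fun x => realPart (synth b x)) =
          fun x => realPart (synth (wordCoef w b) x) := by
    intro l
    induction l with
    | nil => exact ⟨[], rfl, fun b _ => by simp [wordCoef_nil]⟩
    | cons k l ih =>
      obtain ⟨w, hw, hw'⟩ := ih
      refine ⟨List.replicate (α k) k ++ w, by simp [hw], fun b hb => ?_⟩
      rw [List.foldr_cons, hw' b hb, partialD_iterate_realPart_synth (hb.wordCoef w),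
        wordCoef_append]
  obtain ⟨w, hw, hw'⟩ := h (List.finRange n)
  exact ⟨w, by rw [hw, ← List.ofFn_eq_map, List.sum_ofFn], hw'⟩

lemma laplacian_realPart_synth {b : Freq n → Cn n} (hb : Rapid b) (x : Rn n) :
    Laplacian.laplacian (fun x => realPart (synth b x)) x =
      realPart (synth (fun ξ => (-(lenSq ξ : ℂ)) • b ξ) x) := by
  have hf : ContDiff ℝ ∞ fun x => realPart (synth b x) := realPart.contDiff.comp (contDiff_synth hb)
  have hd : Differentiable ℝ (fderiv ℝ fun x => realPart (synth b x)) :=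
    (hf.fderiv_right (m := ∞) (by simp)).differentiable (by simp)
  have h2 : ∀ k, iteratedFDeriv ℝ 2 (fun x => realPart (synth b x)) x
      ![EuclideanSpace.basisFun (Fin n) ℝ k, EuclideanSpace.basisFun (Fin n) ℝ k] =
      realPart (synth (derivCoef k (derivCoef k b)) x) := by
    intro k
    rw [iteratedFDeriv_two_apply]
    have h3 := congrFun (partialD_realPart_synth (hb.derivCoef k) k) x
    rw [← h3, ← partialD_realPart_synth hb k]
    have h4 : partialD k (fun x => realPart (synth b x)) = fun y =>
        fderiv ℝ (fun x => realPart (synth b x)) y (EuclideanSpace.single k 1) := rfl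
    simp only [EuclideanSpace.basisFun_apply, Matrix.cons_val_zero, Matrix.cons_val_one]
    rw [h4, partialD]
    rw [fderiv_clm_apply (hd x) (differentiableAt_const _)]
    simp
  rw [InnerProductSpace.laplacian_eq_iteratedFDeriv_orthonormalBasis _
    (EuclideanSpace.basisFun (Fin n) ℝ)]
  simp only [h2, ← map_sum]
  congr 1
  simp only [synth]
  rw [← Summable.tsum_finsetSum fun k _ =>
    summable_synth ((hb.derivCoef k).derivCoef k).summable_norm x]
  refine tsum_congr fun ξ => ?_
  rw [← Finset.smul_sum]
  congr 1
  simp only [derivCoef, smul_smul, ← Finset.sum_smul]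
  congr 1
  simp only [lenSq]
  push_cast
  rw [← Finset.sum_neg_distrib]
  refine Finset.sum_congr rfl fun k _ => ?_
  linear_combination (ξ k : ℂ) ^ 2 * Complex.I_sq

lemma norm_rieszSymbol_le (k : Fin n) (ξ : Freq n) : ‖rieszSymbol k ξ‖ ≤ 1 := by
  unfold rieszSymbol
  split_ifs with h
  · simp
  · rw [norm_div, norm_mul, Complex.norm_I, one_mul, Complex.norm_intCast, Complex.norm_real,
      Real.norm_of_nonneg (Real.sqrt_nonneg _)]
    refine div_le_one_of_le₀ ?_ (Real.sqrt_nonneg _)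
    rw [← Real.sqrt_sq_eq_abs]
    exact Real.sqrt_le_sqrt (sq_le_lenSq ξ k)

lemma rieszSymbol_mul (k l : Fin n) (ξ : Freq n) :
    rieszSymbol k ξ * rieszSymbol l ξ = -((ξ k : ℂ) * ξ l / (lenSq ξ : ℂ)) := by
  unfold rieszSymbol
  split_ifs with h
  · simp [h]
  · have h1 : ((Real.sqrt (lenSq ξ) : ℝ) : ℂ) ^ 2 = (lenSq ξ : ℂ) := by
      rw [← Complex.ofReal_pow, Real.sq_sqrt (lenSq_nonneg ξ)]
    change Complex.I * (ξ k : ℂ) / (Real.sqrt (lenSq ξ) : ℂ) *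
      (Complex.I * (ξ l : ℂ) / (Real.sqrt (lenSq ξ) : ℂ)) = _
    rw [← h1, div_mul_div_comm, ← sq, ← neg_div]
    congr 1
    linear_combination (ξ k : ℂ) * ξ l * Complex.I_sq

lemma riesz_synth {b : Freq n → ℂ} (hb : Summable fun ξ => ‖b ξ‖) (k : Fin n) :
    riesz k (synth b) = synth fun ξ => rieszSymbol k ξ * b ξ := by
  funext x
  simp only [riesz, synth, fourierCoefficient_synth hb, smul_eq_mul]
  exact tsum_congr fun ξ => by ring

/-- The Leray projector, defined by Riesz transforms, acts on Fourier coefficients by the matrices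
`lerayCoef ξ`. -/
lemma leray_realPart_synth {b : Freq n → Cn n} (hb : Rapid b)
    (hr : ∀ ξ, b (-ξ) = conjC (b ξ)) :
    leray (fun x => realPart (synth b x)) =
      fun x => realPart (synth (fun ξ => lerayCoef ξ (b ξ)) x) := by
  have hs := hb.summable_norm
  have hcomp : ∀ l, Summable fun ξ => ‖b ξ l‖ := fun l =>
    .of_nonneg_of_le (fun _ => norm_nonneg _) (fun ξ => PiLp.norm_apply_le (b ξ) l) hs
  have happ : ∀ (c : Freq n → Cn n), (Summable fun ξ => ‖c ξ‖) → ∀ l x,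
      synth c x l = synth (fun ξ => c ξ l) x := fun c hc l x =>
    clm_synth (EuclideanSpace.proj l : Cn n →L[ℂ] ℂ) hc x
  have hreal : ∀ l, (fun y => ((realPart (synth b y) l : ℝ) : ℂ)) = synth fun ξ => b ξ l := by
    intro l
    funext y
    rw [← happ b hs, ← complexify_apply, complexify_realPart (conjC_synth hs hr y)]
  have hR : ∀ l, Summable fun ξ => ‖rieszSymbol l ξ * b ξ l‖ := fun l =>
    .of_nonneg_of_le (fun _ => norm_nonneg _) (fun ξ => by
      rw [norm_mul]
      exact mul_le_of_le_one_left (norm_nonneg _) (norm_rieszSymbol_le l ξ)) (hcomp l)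
  have hRR : ∀ k l, Summable fun ξ => ‖rieszSymbol k ξ * (rieszSymbol l ξ * b ξ l)‖ := fun k l =>
    .of_nonneg_of_le (fun _ => norm_nonneg _) (fun ξ => by
      rw [norm_mul]
      exact mul_le_of_le_one_left (norm_nonneg _) (norm_rieszSymbol_le k ξ)) (hR l)
  have hL : Summable fun ξ => ‖lerayCoef ξ (b ξ)‖ :=
    .of_nonneg_of_le (fun _ => norm_nonneg _) (fun ξ => norm_lerayCoef_le ξ (b ξ)) (hs.mul_left _)
  funext x
  ext k
  simp only [leray, hreal, riesz_synth (hcomp _), riesz_synth (hR _)]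
  rw [realPart_apply, realPart_apply, happ b hs, happ _ hL, ← Complex.re_sum, ← Complex.add_re]
  congr 1
  simp only [synth]
  rw [← Summable.tsum_finsetSum fun l _ => summable_synth (hRR k l) x,
    ← (summable_synth (hcomp k) x).tsum_add (summable_sum fun l _ => summable_synth (hRR k l) x)]
  refine tsum_congr fun ξ => ?_
  simp only [← mul_assoc, rieszSymbol_mul, ← Finset.smul_sum, ← smul_add]
  congr 1
  simp only [lerayCoef, Finset.sum_div, Finset.sum_mul, sub_eq_add_neg, ← Finset.sum_neg_distrib]
  congr 1
  exact Finset.sum_congr rfl fun l _ => by ring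

end Operators

section RightHandSide

variable (g : QuadraticMap ℝ (Rn n) (Rn n)) (i : Fin n) {b : Freq n → Cn n}

lemma conv_complexBilin_neg (hb : Rapid b) (hr : ∀ ξ, b (-ξ) = conjC (b ξ)) (ξ : Freq n) :
    conv (complexBilin g) b b (-ξ) = conjC (conv (complexBilin g) b b ξ) :=
  conv_neg_of_real (complexBilin_conjC g) hr (summable_conv _ hb.summable_norm hb ξ)

lemma Rapid.rightHandSide (hb : Rapid b) : (Rapid fun ξ => (-(lenSq ξ : ℂ)) • b ξ) ∧
    Rapid (nonlinearity (complexBilin g) i b) :=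
  ⟨((SmoothPath.const (τ := 0) hb 0).laplacian.rapid).rapid ⟨le_rfl, le_rfl⟩,
    (((SmoothPath.const (τ := 0) hb 0).nonlinearity le_rfl).rapid).rapid ⟨le_rfl, le_rfl⟩⟩

lemma rightHandSide_neg (hb : Rapid b) (hr : ∀ ξ, b (-ξ) = conjC (b ξ)) (ξ : Freq n) :
    (-(lenSq (-ξ) : ℂ)) • b (-ξ) + nonlinearity (complexBilin g) i b (-ξ) =
      conjC ((-(lenSq ξ : ℂ)) • b ξ + nonlinearity (complexBilin g) i b ξ) := by
  rw [map_add, conjC_smul, hr, lenSq_neg, map_neg, Complex.conj_ofReal, nonlinearity,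
    conv_complexBilin_neg g hb hr, lerayDeriv_neg_conjC, nonlinearity]

/-- The right-hand side of the differential equation in terms of Fourier coefficients. -/
lemma rightHandSide_realPart_synth (hb : Rapid b) (hr : ∀ ξ, b (-ξ) = conjC (b ξ)) (x : Rn n) :
    Laplacian.laplacian (fun x => realPart (synth b x)) x +
      partialD i (leray fun y => g (realPart (synth b y))) x =
      realPart (synth (fun ξ => (-(lenSq ξ : ℂ)) • b ξ + nonlinearity (complexBilin g) i b ξ) x) := by
  have hconv : Rapid (conv (complexBilin g) b b) := hb.conv _ hb
  have hg : (fun y => g (realPart (synth b y))) =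
      fun y => realPart (synth (conv (complexBilin g) b b) y) := by
    funext y
    rw [synth_conv _ hb.summable_norm hb.summable_norm]
    conv_rhs => rw [← complexify_realPart (conjC_synth hb.summable_norm hr y)]
    rw [complexBilin_complexify, realPart_complexify]
  have hL : Rapid fun ξ => lerayCoef ξ (conv (complexBilin g) b b ξ) :=
    hconv.of_le (1 + (n : ℝ) ^ 2) 0 fun ξ => by
      rw [pow_zero, mul_one]
      exact norm_lerayCoef_le ξ _
  rw [laplacian_realPart_synth hb, hg, leray_realPart_synth hconv (conv_complexBilin_neg g hb hr),
    partialD_realPart_synth hL, ← map_add, synth_add (hb.rightHandSide g i).1.summable_norm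
      (hb.rightHandSide g i).2.summable_norm]
  rfl

end RightHandSide

/-- A smooth real solution of the equation for the Fourier coefficients gives a solution of the
partial differential equation. -/
lemma IsMild.isSolution {g : QuadraticMap ℝ (Rn n) (Rn n)} {i : Fin n} {τ : ℝ} (hτ : 0 < τ)
    {a : ℝ → Freq n → Cn n} (h : IsMild (complexBilin g) i τ a) {f : Rn n → Rn n}
    (hf : ∀ x, synth (a 0) x = complexify (f x)) :
    IsSolution g i f (τ : EReal) fun t x => realPart (synth (a t) x) := by
  have hsub : timeInterval (τ : EReal) ⊆ Icc 0 τ := fun t ht =>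
    ⟨ht.1, (EReal.coe_lt_coe_iff.1 ht.2).le⟩
  refine ⟨?_, fun t _ k x => ?_, ?_, fun t ht ht0 x => ?_⟩
  · refine realPart.contDiff.comp_contDiffOn (ContDiffOn.mono ?_ (prod_mono hsub Subset.rfl))
    exact contDiffOn_infty.2 fun m => (h.smoothPath hτ.le m).contDiffOn hτ
  · exact congrArg realPart (isPeriodic_synth (a t) k x)
  · funext x
    rw [hf, realPart_complexify]
  · have h0 := h.smoothPath hτ.le 0
    have h1 := SmoothPath.hasDerivAt_synth h.rapid (h0.laplacian.add (h0.nonlinearity hτ.le)) h.deriv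
      ⟨ht0, EReal.coe_lt_coe_iff.1 ht.2⟩ x
    rw [rightHandSide_realPart_synth g i (h.rapid.rapid (hsub ht)) (h.real t (hsub ht))]
    exact realPart.hasFDerivAt.comp_hasDerivAt t h1

end PeriodicModel

namespace PeriodicModel

/-! ### The Fourier coefficients of a solution -/

variable {n : ℕ}

section Joint

variable {F : Type*} [NormedAddCommGroup F] {τ : ℝ}

/-- A continuous function on `[0, τ] × ℝⁿ` that is periodic in space is bounded. -/
lemma exists_bound_of_continuousOn {Φ : ℝ → Rn n → F}
    (hc : ContinuousOn (fun p : ℝ × Rn n => Φ p.1 p.2) (Icc 0 τ ×ˢ univ))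
    (hp : ∀ t ∈ Icc 0 τ, IsPeriodic (Φ t)) : ∃ M, ∀ t ∈ Icc 0 τ, ∀ x, ‖Φ t x‖ ≤ M := by
  have hK : IsCompact (Icc 0 τ ×ˢ (scale '' Icc (0 : Fin n → ℝ) 1)) :=
    isCompact_Icc.prod (isCompact_Icc.image continuous_scale)
  obtain ⟨M, hM⟩ := hK.exists_bound_of_continuousOn (hc.mono (prod_mono Subset.rfl (subset_univ _)))
  refine ⟨M, fun t ht x => ?_⟩
  obtain ⟨y, hy, m, rfl⟩ := exists_unitCube_representative x
  rw [(hp t ht).scale_int]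
  exact hM (t, scale y) ⟨ht, y, hy, rfl⟩

variable [NormedSpace ℝ F]

lemma ContDiffOn.contDiff_slice {S : Set ℝ} {Φ : ℝ → Rn n → F}
    (h : ContDiffOn ℝ ∞ (fun p : ℝ × Rn n => Φ p.1 p.2) (S ×ˢ univ)) {t : ℝ} (ht : t ∈ S) :
    ContDiff ℝ ∞ (Φ t) :=
  contDiffOn_univ.1 (h.comp (f := fun x : Rn n => (t, x))
    (contDiff_const.prodMk contDiff_id).contDiffOn fun _ _ => ⟨ht, trivial⟩)

/-- Spatial derivatives of a function on `[0, τ] × ℝⁿ` are smooth jointly in space and time. -/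
lemma ContDiffOn.fderiv_slice (hτ : 0 < τ) {Φ : ℝ → Rn n → F}
    (h : ContDiffOn ℝ ∞ (fun p : ℝ × Rn n => Φ p.1 p.2) (Icc 0 τ ×ˢ univ)) (v : Rn n) :
    ContDiffOn ℝ ∞ (fun p : ℝ × Rn n => fderiv ℝ (Φ p.1) p.2 v) (Icc 0 τ ×ˢ univ) := by
  have hu : UniqueDiffOn ℝ (Icc 0 τ ×ˢ (univ : Set (Rn n))) :=
    (uniqueDiffOn_Icc hτ).prod uniqueDiffOn_univ
  refine ((h.fderivWithin (m := ∞) hu (by simp)).clm_apply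
    (contDiffOn_const (c := ((0 : ℝ), v)))).congr fun p hp => ?_
  have h1 := ((h.differentiableOn (by simp)) p hp).hasFDerivWithinAt
  have h2 : HasFDerivWithinAt (fun x : Rn n => (p.1, x))
      (ContinuousLinearMap.inr ℝ ℝ (Rn n)) univ p.2 :=
    (hasFDerivAt_prodMk_right p.1 p.2).hasFDerivWithinAt
  have hm : MapsTo (fun x : Rn n => (p.1, x)) univ (Icc 0 τ ×ˢ univ) := fun x _ => ⟨hp.1, trivial⟩
  have h3 := h1.comp p.2 h2 hm
  rw [hasFDerivWithinAt_univ] at h3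
  exact congrArg (fun L => L v) h3.fderiv

/-- The time derivative of a function on `[0, τ] × ℝⁿ`, one-sided at the end points. -/
def timeDeriv (τ : ℝ) (Φ : ℝ → Rn n → F) (t : ℝ) (x : Rn n) : F :=
  derivWithin (fun s => Φ s x) (Icc 0 τ) t

lemma ContDiffOn.hasDerivWithinAt_timeDeriv {Φ : ℝ → Rn n → F}
    (h : ContDiffOn ℝ ∞ (fun p : ℝ × Rn n => Φ p.1 p.2) (Icc 0 τ ×ˢ univ)) {t : ℝ}
    (ht : t ∈ Icc 0 τ) (x : Rn n) :
    HasDerivWithinAt (fun s => Φ s x) (timeDeriv τ Φ t x) (Icc 0 τ) t :=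
  ((h.comp (f := fun s : ℝ => (s, x)) (contDiff_id.prodMk contDiff_const).contDiffOn
    fun _ hs => ⟨hs, trivial⟩).differentiableOn (by simp) t ht).hasDerivWithinAt

lemma ContDiffOn.continuousOn_timeDeriv (hτ : 0 < τ) {Φ : ℝ → Rn n → F}
    (h : ContDiffOn ℝ ∞ (fun p : ℝ × Rn n => Φ p.1 p.2) (Icc 0 τ ×ˢ univ)) :
    ContinuousOn (fun p : ℝ × Rn n => timeDeriv τ Φ p.1 p.2) (Icc 0 τ ×ˢ univ) := by
  have hu : UniqueDiffOn ℝ (Icc 0 τ ×ˢ (univ : Set (Rn n))) :=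
    (uniqueDiffOn_Icc hτ).prod uniqueDiffOn_univ
  refine ((h.continuousOn_fderivWithin hu (by simp)).clm_apply
    (continuousOn_const (c := ((1 : ℝ), (0 : Rn n))))).congr fun p hp => ?_
  have h1 := ((h.differentiableOn (by simp)) p hp).hasFDerivWithinAt
  have h2 : HasDerivWithinAt (fun s : ℝ => (s, p.2)) ((1 : ℝ), (0 : Rn n)) (Icc 0 τ) p.1 :=
    ((hasDerivAt_id p.1).prodMk (hasDerivAt_const p.1 p.2)).hasDerivWithinAt
  have hm : MapsTo (fun s : ℝ => (s, p.2)) (Icc 0 τ) (Icc 0 τ ×ˢ univ) := fun s hs => ⟨hs, trivial⟩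
  exact (h1.comp_hasDerivWithinAt p.1 h2 hm).derivWithin
    (uniqueDiffOn_Icc hτ p.1 hp.1)

lemma isPeriodic_timeDeriv {Φ : ℝ → Rn n → F} (hp : ∀ t ∈ Icc 0 τ, IsPeriodic (Φ t)) {t : ℝ}
    (ht : t ∈ Icc 0 τ) : IsPeriodic (timeDeriv τ Φ t) := fun k x =>
  derivWithin_congr (fun s hs => hp s hs k x) (hp t ht k x)

end Joint

section TimeDerivative

variable {τ : ℝ}

/-- Fourier coefficients may be differentiated in time under the integral sign. The function is
extended beyond `[0, τ]` with a constant time derivative in order to cover the end points. -/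
lemma hasDerivWithinAt_fourierCoefficient (hτ : 0 ≤ τ) {Φ Ψ : ℝ → Rn n → ℂ}
    (hΦ : ∀ t ∈ Icc 0 τ, Continuous (Φ t)) (hΦp : ∀ t ∈ Icc 0 τ, IsPeriodic (Φ t))
    (hΨ : ContinuousOn (fun p : ℝ × Rn n => Ψ p.1 p.2) (Icc 0 τ ×ˢ univ))
    (hΨp : ∀ t ∈ Icc 0 τ, IsPeriodic (Ψ t))
    (hd : ∀ x, ∀ t ∈ Icc 0 τ, HasDerivWithinAt (fun s => Φ s x) (Ψ t x) (Icc 0 τ) t)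
    (ξ : Freq n) {t : ℝ} (ht : t ∈ Icc 0 τ) :
    HasDerivWithinAt (fun s => fourierCoefficient (Φ s) ξ) (fourierCoefficient (Ψ t) ξ)
      (Icc 0 τ) t := by
  let W : ℝ → Rn n → ℂ := fun s x => Ψ (projIcc 0 τ hτ s) x
  let E : ℝ → Rn n → ℂ := fun s x => Φ 0 x + ∫ r in 0..s, W r x
  have h0 : (0 : ℝ) ∈ Icc 0 τ := ⟨le_rfl, hτ⟩
  have hW : Continuous fun p : ℝ × Rn n => W p.1 p.2 :=
    hΨ.comp_continuous (f := fun p : ℝ × Rn n => ((projIcc 0 τ hτ p.1 : ℝ), p.2))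
      ((continuous_subtype_val.comp (continuous_projIcc.comp continuous_fst)).prodMk
        continuous_snd) fun p => ⟨(projIcc 0 τ hτ p.1).2, trivial⟩
  have hWx : ∀ x, Continuous fun r => W r x := fun x =>
    hW.comp (continuous_id.prodMk continuous_const)
  have hWr : ∀ r, Continuous (W r) := fun r => hW.comp (continuous_const.prodMk continuous_id)
  have hEc : ∀ s, Continuous (E s) := fun s =>
    (hΦ 0 h0).add (intervalIntegral.continuous_parametric_intervalIntegral_of_continuous'
      (f := fun x r => W r x) (hW.comp continuous_swap) 0 s)
  have hWeq : ∀ s ∈ Icc 0 τ, W s = Ψ s := fun s hs => by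
    simp only [W, projIcc_of_mem hτ hs]
  have hEeq : ∀ s ∈ Icc 0 τ, E s = Φ s := by
    intro s hs
    funext x
    have hsub : Icc 0 s ⊆ Icc 0 τ := Icc_subset_Icc le_rfl hs.2
    have := intervalIntegral.integral_eq_sub_of_hasDerivAt_of_le hs.1
      (f := fun r => Φ r x) (f' := fun r => W r x)
      (fun r hr => ((hd x r (hsub hr)).continuousWithinAt).mono hsub)
      (fun r hr => by
        have hr' := hsub (Ioo_subset_Icc_self hr)
        rw [hWeq r hr']
        exact (hd x r hr').hasDerivAt (Icc_mem_nhds hr.1 (hr.2.trans_le hs.2)))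
      ((hWx x).intervalIntegrable 0 s)
    simp only [E, this]
    ring
  have hEd : ∀ x s, HasDerivAt (fun s => E s x) (W s x) s := fun x s =>
    (intervalIntegral.integral_hasDerivAt_right ((hWx x).intervalIntegrable 0 s)
      ((hWx x).stronglyMeasurableAtFilter _ _) (hWx x).continuousAt).const_add (Φ 0 x)
  obtain ⟨M, hM⟩ := exists_bound_of_continuousOn hΨ hΨp
  have hχ := continuous_character (-ξ)
  have key := (hasDerivAt_integral_of_dominated_loc_of_deriv_le
    (μ := volume.restrict (unitCube (0 : Fin n → ℝ))) (x₀ := t) (s := univ) (bound := fun _ => M)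
    (F := fun s y => E s (scale y) * character (-ξ) (scale y))
    (F' := fun s y => W s (scale y) * character (-ξ) (scale y)) Filter.univ_mem
    (.of_forall fun s =>
      (((hEc s).mul hχ).comp continuous_scale).aestronglyMeasurable)
    (integrable_cell ((hEc t).mul hχ) fun k x => by
      rw [Pi.mul_apply, Pi.mul_apply, hEeq t ht, hΦp t ht k x, isPeriodic_character _ k x])
    (((hWr t).mul hχ).comp continuous_scale).aestronglyMeasurable
    (.of_forall fun y s _ => by
      rw [norm_mul, norm_character, mul_one]
      exact hM _ (projIcc 0 τ hτ s).2 _)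
    (integrable_const M)
    (.of_forall fun y s _ => (hEd (scale y) s).mul_const _)).2
  rw [hWeq t ht] at key
  simp only [fourierCoefficient_eq, cellMean]
  exact key.hasDerivWithinAt.congr (fun s hs => by simp only [hEeq s hs])
    (by simp only [hEeq t ht])

end TimeDerivative

section VectorField

/-- The Fourier coefficients of a real vector field. -/
def vecCoef (h : Rn n → Rn n) (ξ : Freq n) : Cn n :=
  WithLp.toLp 2 fun k => fourierCoefficient (fun x => ((h x k : ℝ) : ℂ)) ξ

lemma vecCoef_apply (h : Rn n → Rn n) (ξ : Freq n) (k : Fin n) :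
    vecCoef h ξ k = fourierCoefficient (fun x => ((h x k : ℝ) : ℂ)) ξ := rfl

lemma vecCoef_neg (h : Rn n → Rn n) (ξ : Freq n) : vecCoef h (-ξ) = conjC (vecCoef h ξ) := by
  ext k
  rw [conjC_apply, vecCoef_apply, vecCoef_apply, fourierCoefficient_eq, fourierCoefficient_eq,
    cellMean, cellMean, ← integral_conj]
  simp only [map_mul, Complex.conj_ofReal, character_neg, Complex.conj_conj]

lemma sum_smul_single (v : Cn n) : ∑ k, v k • EuclideanSpace.single k (1 : ℂ) = v := by
  ext k
  simp [Finset.sum_apply, Pi.single_apply]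

lemma norm_le_sum_norm_apply (v : Cn n) : ‖v‖ ≤ ∑ k, ‖v k‖ := by
  conv_lhs => rw [← sum_smul_single v]
  refine (norm_sum_le _ _).trans (Finset.sum_le_sum fun k _ => ?_)
  simp [norm_smul]

lemma rapidOn_of_apply {T : Type*} {S : Set T} {a : T → Freq n → Cn n}
    (h : ∀ k, RapidOn S fun t ξ => a t ξ k) : RapidOn S a := by
  intro s
  choose M hM using fun k => h k s
  refine ⟨∑ k, M k, fun t ht ξ => ?_⟩
  calc (1 + ‖ξ‖) ^ s * ‖a t ξ‖ ≤ (1 + ‖ξ‖) ^ s * ∑ k, ‖a t ξ k‖ := by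
        gcongr
        exact norm_le_sum_norm_apply _
    _ = ∑ k, (1 + ‖ξ‖) ^ s * ‖a t ξ k‖ := Finset.mul_sum _ _ _
    _ ≤ _ := Finset.sum_le_sum fun k _ => hM k t ht ξ

lemma SmoothPeriodic.contDiff_component {h : Rn n → Rn n} (hh : SmoothPeriodic h) (k : Fin n) :
    ContDiff ℝ ∞ fun x => ((h x k : ℝ) : ℂ) :=
  Complex.ofRealCLM.contDiff.comp
    ((EuclideanSpace.proj k : Rn n →L[ℝ] ℝ).contDiff.comp hh.1)

lemma IsPeriodic.component {h : Rn n → Rn n} (hh : IsPeriodic h) (k : Fin n) :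
    IsPeriodic fun x => ((h x k : ℝ) : ℂ) := fun l x => by
  beta_reduce
  rw [hh l x]

lemma SmoothPeriodic.rapid_vecCoef {h : Rn n → Rn n} (hh : SmoothPeriodic h) :
    Rapid (vecCoef h) :=
  rapidOn_unit.1 <| rapidOn_of_apply fun k => rapidOn_unit.2 <|
    rapid_fourierCoefficient (hh.contDiff_component k) (hh.2.component k)

lemma SmoothPeriodic.synth_vecCoef {h : Rn n → Rn n} (hh : SmoothPeriodic h) (x : Rn n) :
    synth (vecCoef h) x = complexify (h x) := by
  ext k
  have h1 := clm_synth (EuclideanSpace.proj k : Cn n →L[ℂ] ℂ) hh.rapid_vecCoef.summable_norm x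
  refine h1.trans ?_
  have h2 := synth_fourierCoefficient (hh.contDiff_component k).continuous (hh.2.component k)
    (rapid_fourierCoefficient (hh.contDiff_component k) (hh.2.component k)).summable_norm.of_norm
  exact congrFun h2 x

lemma vecCoef_realPart_synth {b : Freq n → Cn n} (hb : Rapid b)
    (hr : ∀ ξ, b (-ξ) = conjC (b ξ)) : vecCoef (fun x => realPart (synth b x)) = b := by
  have hs := hb.summable_norm
  funext ξ
  ext k
  have h1 : (fun x => ((realPart (synth b x) k : ℝ) : ℂ)) = synth fun ξ => b ξ k := by
    funext x
    rw [← complexify_apply, complexify_realPart (conjC_synth hs hr x)]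
    exact clm_synth (EuclideanSpace.proj k : Cn n →L[ℂ] ℂ) hs x
  rw [vecCoef_apply, h1]
  exact fourierCoefficient_synth
    (.of_nonneg_of_le (fun _ => norm_nonneg _) (fun ξ => PiLp.norm_apply_le (b ξ) k) hs) ξ

end VectorField

section Solution

variable {g : QuadraticMap ℝ (Rn n) (Rn n)} {i : Fin n} {f : Rn n → Rn n} {T : EReal}
  {u : ℝ → Rn n → Rn n} {τ : ℝ}

lemma Icc_subset_timeInterval (hτ : τ ∈ timeInterval T) : Icc 0 τ ⊆ timeInterval T := fun _ ht =>
  ⟨ht.1, (EReal.coe_le_coe_iff.2 ht.2).trans_lt hτ.2⟩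

lemma IsSolution.smoothPeriodic (h : IsSolution g i f T u) {t : ℝ} (ht : t ∈ timeInterval T) :
    SmoothPeriodic (u t) := ⟨ContDiffOn.contDiff_slice h.smooth ht, h.periodic t ht⟩

/-- Joint smoothness bounds all spatial derivatives uniformly on `[0, τ]`, hence the coefficients decay
rapidly, uniformly in time. -/
lemma IsSolution.rapidOn_vecCoef (h : IsSolution g i f T u) (hτ : τ ∈ timeInterval T)
    (hτ0 : 0 < τ) : RapidOn (Icc 0 τ) fun t => vecCoef (u t) := by
  have hsub := Icc_subset_timeInterval hτ
  refine rapidOn_of_apply fun l => ?_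
  have hΦ : ContDiffOn ℝ ∞ (fun p : ℝ × Rn n => ((u p.1 p.2 l : ℝ) : ℂ)) (Icc 0 τ ×ˢ univ) :=
    Complex.ofRealCLM.contDiff.comp_contDiffOn
      ((EuclideanSpace.proj l : Rn n →L[ℝ] ℝ).contDiff.comp_contDiffOn
        (h.smooth.mono (prod_mono hsub Subset.rfl)))
  have hp : ∀ t ∈ Icc 0 τ, IsPeriodic fun x => ((u t x l : ℝ) : ℂ) := fun t ht =>
    (h.periodic t (hsub ht)).component l
  refine rapidOn_fourierCoefficient (fun t ht => ContDiffOn.contDiff_slice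
    (Φ := fun t x => ((u t x l : ℝ) : ℂ)) hΦ ht) hp (fun k s => ?_)
    (exists_bound_of_continuousOn hΦ.continuousOn hp)
  have hs : ContDiffOn ℝ ∞ (fun p : ℝ × Rn n =>
      (pderiv k)^[s] (fun x => ((u p.1 x l : ℝ) : ℂ)) p.2) (Icc 0 τ ×ˢ univ) := by
    induction s with
    | zero => exact hΦ
    | succ s ih =>
      simp only [Function.iterate_succ_apply']
      exact ContDiffOn.fderiv_slice hτ0
        (Φ := fun t => (pderiv k)^[s] fun x => ((u t x l : ℝ) : ℂ)) ih _
  exact exists_bound_of_continuousOn hs.continuousOn fun t ht => isPeriodic_pderiv_iterate (hp t ht) k s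

lemma hasDerivWithinAt_vecCoef (hτ0 : 0 < τ)
    (hs : ContDiffOn ℝ ∞ (fun p : ℝ × Rn n => u p.1 p.2) (Icc 0 τ ×ˢ univ))
    (hp : ∀ t ∈ Icc 0 τ, IsPeriodic (u t)) (ξ : Freq n) {t : ℝ} (ht : t ∈ Icc 0 τ) :
    HasDerivWithinAt (fun s => vecCoef (u s) ξ) (vecCoef (timeDeriv τ u t) ξ) (Icc 0 τ) t := by
  have h1 : ∀ k, HasDerivWithinAt (fun s => vecCoef (u s) ξ k) (vecCoef (timeDeriv τ u t) ξ k)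
      (Icc 0 τ) t := by
    intro k
    refine hasDerivWithinAt_fourierCoefficient (Φ := fun s x => ((u s x k : ℝ) : ℂ))
      (Ψ := fun s x => ((timeDeriv τ u s x k : ℝ) : ℂ)) hτ0.le (fun s hs' => ?_)
      (fun s hs' => (hp s hs').component k) ?_
      (fun s hs' => (isPeriodic_timeDeriv hp hs').component k) (fun x s hs' => ?_) ξ ht
    · exact (SmoothPeriodic.contDiff_component
        ⟨ContDiffOn.contDiff_slice hs hs', hp s hs'⟩ k).continuous
    · exact Complex.continuous_ofReal.comp_continuousOn
        ((EuclideanSpace.proj k : Rn n →L[ℝ] ℝ).continuous.comp_continuousOn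
          (ContDiffOn.continuousOn_timeDeriv hτ0 hs))
    · exact ((Complex.ofRealCLM.comp (EuclideanSpace.proj k : Rn n →L[ℝ] ℝ)).hasFDerivAt
        ).comp_hasDerivWithinAt s (ContDiffOn.hasDerivWithinAt_timeDeriv hs hs' x)
  have h2 := HasDerivWithinAt.fun_sum (u := Finset.univ) fun k _ =>
    (h1 k).smul_const (EuclideanSpace.single k (1 : ℂ))
  simpa only [sum_smul_single] using h2

/-- The Fourier coefficients of a solution solve the system of ordinary differential equations. -/
lemma IsSolution.isMild (h : IsSolution g i f T u) (hτ : τ ∈ timeInterval T) (hτ0 : 0 < τ) :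
    IsMild (complexBilin g) i τ fun t => vecCoef (u t) := by
  have hsub := Icc_subset_timeInterval hτ
  have hrapid := h.rapidOn_vecCoef hτ hτ0
  have hs := h.smooth.mono (prod_mono hsub Subset.rfl)
  have hp : ∀ t ∈ Icc 0 τ, IsPeriodic (u t) := fun t ht => h.periodic t (hsub ht)
  have hd := fun ξ t (ht : t ∈ Icc 0 τ) => hasDerivWithinAt_vecCoef hτ0 hs hp ξ ht
  have hpos : ∀ ξ, ∀ t ∈ Ioc 0 τ, vecCoef (timeDeriv τ u t) ξ =
      (-(lenSq ξ : ℂ)) • vecCoef (u t) ξ + nonlinearity (complexBilin g) i (vecCoef (u t)) ξ := by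
    intro ξ t ht
    have htI := Ioc_subset_Icc_self ht
    have hb := hrapid.rapid htI
    have hr := vecCoef_neg (u t)
    have hsp := h.smoothPeriodic (hsub htI)
    have hu : (fun x => realPart (synth (vecCoef (u t)) x)) = u t := by
      funext x
      rw [hsp.synth_vecCoef, realPart_complexify]
    have heq : timeDeriv τ u t = fun x => realPart (synth (fun ξ => (-(lenSq ξ : ℂ)) •
        vecCoef (u t) ξ + nonlinearity (complexBilin g) i (vecCoef (u t)) ξ) x) := by
      funext x
      rw [← rightHandSide_realPart_synth g i hb hr, hu]
      have hg : (fun y => g (realPart (synth (vecCoef (u t)) y))) = fun y => g (u t y) :=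
        funext fun y => congrArg g (congrFun hu y)
      rw [hg]
      exact (h.equation t (hsub htI) ht.1 x).hasDerivWithinAt.derivWithin
        (uniqueDiffOn_Icc hτ0 t htI)
    have hsum : Rapid fun ξ => (-(lenSq ξ : ℂ)) • vecCoef (u t) ξ +
        nonlinearity (complexBilin g) i (vecCoef (u t)) ξ :=
      rapidOn_unit.1 ((rapidOn_unit.2 (hb.rightHandSide g i).1).add
        (rapidOn_unit.2 (hb.rightHandSide g i).2))
    rw [heq, vecCoef_realPart_synth hsum (rightHandSide_neg g i hb hr)]
  have hcont : ∀ ξ, ContinuousOn (fun s => vecCoef (u s) ξ) (Icc 0 τ) := fun ξ t ht =>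
    (hd ξ t ht).continuousWithinAt
  refine ⟨hrapid, fun ξ t ht => ?_, fun t _ => vecCoef_neg (u t)⟩
  rcases ht.1.eq_or_lt with rfl | ht0
  -- At time `0` the differential equation is not required; it follows by continuity from later times.
  · have hN : ContinuousOn (fun s => (-(lenSq ξ : ℂ)) • vecCoef (u s) ξ +
        nonlinearity (complexBilin g) i (vecCoef (u s)) ξ) (Icc 0 τ) :=
      ((hcont ξ).const_smul (-(lenSq ξ : ℂ))).add
        (continuousOn_nonlinearity (B := complexBilin g) (i := i) hrapid hcont ξ)
    have hderiv : ∀ s ∈ Ioo 0 τ, HasDerivAt (fun s => vecCoef (u s) ξ)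
        ((-(lenSq ξ : ℂ)) • vecCoef (u s) ξ +
          nonlinearity (complexBilin g) i (vecCoef (u s)) ξ) s := fun s hs' => by
      rw [← hpos ξ s (Ioo_subset_Ioc_self hs')]
      exact (hd ξ s (Ioo_subset_Icc_self hs')).hasDerivAt (Icc_mem_nhds hs'.1 hs'.2)
    have hmem : Ioo 0 τ ∈ nhdsWithin (0 : ℝ) (Ioi 0) := Ioo_mem_nhdsGT hτ0
    refine (hasDerivWithinAt_Ici_of_tendsto_deriv (s := Ioo 0 τ)
      (fun s hs' => (hderiv s hs').differentiableAt.differentiableWithinAt)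
      ((hcont ξ 0 ht).mono Ioo_subset_Icc_self) hmem ?_).mono Icc_subset_Ici_self
    have h1 := ((hN 0 ht).mono Ioo_subset_Icc_self).tendsto
    rw [nhdsWithin_Ioo_eq_nhdsGT hτ0] at h1
    refine h1.congr' ?_
    filter_upwards [hmem] with s hs'
    exact (hderiv s hs').deriv.symm
  · rw [← hpos ξ t ⟨ht0, ht.2⟩]
    exact hd ξ t ht

end Solution

end PeriodicModel

namespace PeriodicModel

/-! ### Continuation and the lower bound for the existence time -/

variable {n : ℕ}

section Glue

variable {B : Cn n →L[ℂ] Cn n →L[ℂ] Cn n} {i : Fin n} {τ δ : ℝ} {a b : ℝ → Freq n → Cn n}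

/-- Solutions on consecutive time intervals join to a solution. -/
lemma IsMild.glue (hτ : 0 ≤ τ) (hδ : 0 ≤ δ) (ha : IsMild B i τ a) (hb : IsMild B i δ b)
    (hab : b 0 = a τ) : IsMild B i (τ + δ) fun t => if t ≤ τ then a t else b (t - τ) := by
  set c : ℝ → Freq n → Cn n := fun t => if t ≤ τ then a t else b (t - τ) with hc
  have hca : ∀ t ∈ Icc 0 τ, c t = a t := fun t ht => if_pos ht.2
  have hcb : ∀ t ∈ Icc τ (τ + δ), c t = b (t - τ) := by
    intro t ht
    rcases ht.1.eq_or_lt with rfl | h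
    · rw [hca τ ⟨hτ, le_rfl⟩, sub_self, hab]
    · exact if_neg (not_le.2 h)
  have hshift : ∀ t ∈ Icc τ (τ + δ), t - τ ∈ Icc 0 δ := fun t ht =>
    ⟨by linarith [ht.1], by linarith [ht.2]⟩
  have hunion : Icc 0 (τ + δ) = Icc 0 τ ∪ Icc τ (τ + δ) :=
    (Icc_union_Icc_eq_Icc hτ (by linarith)).symm
  have h1 : ∀ ξ, ∀ t ∈ Icc 0 τ, HasDerivWithinAt (fun s => c s ξ)
      ((-(lenSq ξ : ℂ)) • c t ξ + nonlinearity B i (c t) ξ) (Icc 0 τ) t := by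
    intro ξ t ht
    rw [hca t ht]
    exact (ha.deriv ξ t ht).congr (fun s hs => congrFun (hca s hs) ξ) (congrFun (hca t ht) ξ)
  have h2 : ∀ ξ, ∀ t ∈ Icc τ (τ + δ), HasDerivWithinAt (fun s => c s ξ)
      ((-(lenSq ξ : ℂ)) • c t ξ + nonlinearity B i (c t) ξ) (Icc τ (τ + δ)) t := by
    intro ξ t ht
    rw [hcb t ht]
    have h3 := (hb.deriv ξ (t - τ) (hshift t ht)).scomp t
      (((hasDerivAt_id t).sub_const τ).hasDerivWithinAt (s := Icc τ (τ + δ))) hshift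
    rw [one_smul] at h3
    exact h3.congr (fun s hs => congrFun (hcb s hs) ξ) (congrFun (hcb t ht) ξ)
  refine ⟨fun s => ?_, fun ξ t ht => ?_, fun t ht ξ => ?_⟩
  · obtain ⟨M, hM⟩ := ha.rapid s
    obtain ⟨M', hM'⟩ := hb.rapid s
    refine ⟨max M M', fun t ht ξ => ?_⟩
    rw [hunion] at ht
    rcases ht with ht | ht
    · rw [hca t ht]
      exact (hM t ht ξ).trans (le_max_left _ _)
    · rw [hcb t ht]
      exact (hM' _ (hshift t ht) ξ).trans (le_max_right _ _)
  · rw [hunion]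
    refine HasFDerivWithinAt.union ?_ ?_
    · by_cases h : t ∈ Icc 0 τ
      · exact h1 ξ t h
      · exact .of_notMem_closure (by rwa [isClosed_Icc.closure_eq])
    · by_cases h : t ∈ Icc τ (τ + δ)
      · exact h2 ξ t h
      · exact .of_notMem_closure (by rwa [isClosed_Icc.closure_eq])
  · rw [hunion] at ht
    rcases ht with ht | ht
    · rw [hca t ht]
      exact ha.real t ht ξ
    · rw [hcb t ht]
      exact hb.real _ (hshift t ht) ξ

end Glue

section CoefficientBound

lemma norm_coef_le_of_norm_synth_le {b : Freq n → Cn n} (hb : Rapid b) {M : ℝ}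
    (hM : ∀ x, ‖synth b x‖ ≤ M) (ξ : Freq n) : ‖b ξ‖ ≤ n * M := by
  have hs := hb.summable_norm
  have h1 : ∀ k ∈ Finset.univ, ‖b ξ k‖ ≤ M := by
    intro k _
    have hk : Summable fun ξ => ‖b ξ k‖ :=
      .of_nonneg_of_le (fun _ => norm_nonneg _) (fun ξ => PiLp.norm_apply_le (b ξ) k) hs
    rw [← fourierCoefficient_synth hk ξ]
    refine norm_fourierCoefficient_le (fun x => ?_) ξ
    have h2 : synth b x k = synth (fun ξ => b ξ k) x :=
      clm_synth (EuclideanSpace.proj k : Cn n →L[ℂ] ℂ) hs x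
    rw [← h2]
    exact (PiLp.norm_apply_le (synth b x) k).trans (hM x)
  refine (norm_le_sum_norm_apply _).trans ((Finset.sum_le_card_nsmul _ _ _ h1).trans_eq ?_)
  simp

/-- Bounds for a function and its derivatives of order `n + 1` bound the sum of the Fourier
coefficients. -/
lemma tsum_norm_le_of_norm_synth_wordCoef_le {b : Freq n → Cn n} (hb : Rapid b) {M M' : ℝ}
    (hM : ∀ x, ‖synth b x‖ ≤ M)
    (hM' : ∀ w : List (Fin n), w.length = n + 1 → ∀ x, ‖synth (wordCoef w b) x‖ ≤ M') :
    ∑' ξ, ‖b ξ‖ ≤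
      2 ^ (n + 1) * (n * M + n * (n * M')) * ∑' ξ : Freq n, ((1 + ‖ξ‖) ^ (n + 1))⁻¹ := by
  rw [← tsum_mul_left]
  refine hb.summable_norm.tsum_le_tsum (fun ξ => ?_) ((summable_weight n).mul_left _)
  rw [← div_eq_mul_inv, le_div_iff₀' (by positivity)]
  have h1 : ∀ k ∈ Finset.univ, |(ξ k : ℝ)| ^ (n + 1) * ‖b ξ‖ ≤ n * M' := by
    intro k _
    have h2 := norm_coef_le_of_norm_synth_le (hb.wordCoef (List.replicate (n + 1) k))
      (hM' _ List.length_replicate) ξ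
    rwa [wordCoef, norm_smul, wordSymbol, List.map_replicate, List.prod_replicate, norm_pow,
      norm_mul, Complex.norm_I, one_mul, Complex.norm_intCast] at h2
  calc (1 + ‖ξ‖) ^ (n + 1) * ‖b ξ‖
      ≤ 2 ^ (n + 1) * (1 + ∑ k, |(ξ k : ℝ)| ^ (n + 1)) * ‖b ξ‖ := by
        gcongr
        exact weight_le_sum ξ (n + 1)
    _ = 2 ^ (n + 1) * (‖b ξ‖ + ∑ k, |(ξ k : ℝ)| ^ (n + 1) * ‖b ξ‖) := by
        rw [← Finset.sum_mul]
        ring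
    _ ≤ 2 ^ (n + 1) * (n * M + n * (n * M')) := by
        gcongr
        · exact norm_coef_le_of_norm_synth_le hb hM ξ
        · exact (Finset.sum_le_card_nsmul _ _ _ h1).trans_eq (by simp)

end CoefficientBound

section Continuation

variable (B : Cn n →L[ℂ] Cn n →L[ℂ] Cn n)

/-- A length of the time interval that is admissible in `exists_isMild`. -/
lemma exists_step {A : ℝ} (hA : 0 < A) :
    ∃ δ : ℝ, 0 < δ ∧ 16 * (1 + n ^ 2) * √δ * ‖B‖ * A ≤ 1 := by
  have hB := B.opNorm_nonneg
  refine ⟨(1 / (16 * (1 + (n : ℝ) ^ 2) * (‖B‖ + 1) * A)) ^ 2, by positivity, ?_⟩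
  rw [Real.sqrt_sq (by positivity)]
  have h1 : 16 * (1 + (n : ℝ) ^ 2) * (1 / (16 * (1 + (n : ℝ) ^ 2) * (‖B‖ + 1) * A)) * ‖B‖ * A =
      ‖B‖ / (‖B‖ + 1) := by
    field_simp
  rw [h1]
  exact div_le_one_of_le₀ (by linarith) (by linarith)

variable {B}

/-- A solution exists until after the time up to which the a priori estimates hold: these bound the
sum of the Fourier coefficients away from time `0`, so that the solution can be continued by steps
of a fixed length. -/
lemma exists_isMild_lt (hB : ∀ v w, B (conjC v) (conjC w) = conjC (B v w)) (i : Fin n)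
    {f : Freq n → Cn n} (hf : Rapid f) (hfr : ∀ ξ, f (-ξ) = conjC (f ξ)) {R : ℝ} (hR : 0 < R)
    (hfR : ∀ x, ‖synth f x‖ ≤ R) {t₁ : ℝ} (ht₁ : √t₁ * R ≤ smallness B) :
    ∃ τ a, 0 < τ ∧ t₁ < τ ∧ IsMild B i τ a ∧ a 0 = f := by
  by_contra! hcon
  obtain ⟨K, hK, hKb⟩ := exists_weighted_bound B i (n + 1)
  have hsum0 : 0 ≤ ∑' ξ, ‖f ξ‖ := tsum_nonneg fun _ => norm_nonneg _
  obtain ⟨τ₀, hτ₀, hτ₀A⟩ := exists_step B (A := ∑' ξ, ‖f ξ‖ + 1) (by linarith)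
  obtain ⟨a₀, ha₀, ha₀f⟩ := exists_isMild hB i (by linarith) hτ₀ hτ₀A hf hfr (by linarith)
  set A : ℝ := 2 ^ (n + 1) * (n * (2 * R) + n * (n * (K * R / √τ₀ ^ (n + 1)))) *
    ∑' ξ : Freq n, ((1 + ‖ξ‖) ^ (n + 1))⁻¹ with hAdef
  have hA0 : 0 ≤ A := by
    have : 0 ≤ ∑' ξ : Freq n, ((1 + ‖ξ‖) ^ (n + 1))⁻¹ := tsum_nonneg fun _ => by positivity
    positivity
  obtain ⟨δ, hδ, hδA⟩ := exists_step B (A := A + 1) (by linarith)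
  have hstep : ∀ τ a, τ₀ ≤ τ → IsMild B i τ a → a 0 = f → ∃ b, IsMild B i (τ + δ) b ∧ b 0 = f := by
    intro τ a hτ ha ha0
    have hτpos : 0 < τ := hτ₀.trans_le hτ
    have hτ1 : τ ≤ t₁ := not_lt.1 fun h => hcon τ a hτpos h ha ha0
    have hsmall : √τ * R ≤ smallness B :=
      (mul_le_mul_of_nonneg_right (Real.sqrt_le_sqrt hτ1) hR.le).trans ht₁
    have hmem : τ ∈ Icc 0 τ := ⟨hτpos.le, le_rfl⟩
    have hrapid := ha.rapid.rapid hmem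
    have hinit : ∀ x, ‖synth (a 0) x‖ ≤ R := by rwa [ha0]
    have hA : ∑' ξ, ‖a τ ξ‖ ≤ A + 1 := by
      refine (tsum_norm_le_of_norm_synth_wordCoef_le hrapid
        (fun x => ha.norm_synth_le hR hinit hmem hsmall x) (M' := K * R / √τ₀ ^ (n + 1))
        fun w hw x => ?_).trans (by linarith)
      have h1 := hKb τ a ha R hR hinit τ ⟨hτpos, le_rfl⟩ hsmall w hw x
      have hsq := Real.sqrt_pos.2 hτ₀
      rw [le_div_iff₀' (by positivity)]
      refine le_trans ?_ h1
      gcongr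
    obtain ⟨b, hb, hb0⟩ := exists_isMild hB i (by linarith) hδ hδA hrapid (ha.real τ hmem) hA
    exact ⟨_, ha.glue hτpos.le hδ.le hb hb0, by rw [if_pos hτpos.le, ha0]⟩
  have hall : ∀ m : ℕ, ∃ a, IsMild B i (τ₀ + m * δ) a ∧ a 0 = f := by
    intro m
    induction m with
    | zero => exact ⟨a₀, by simpa using ha₀, ha₀f⟩
    | succ m ih =>
      obtain ⟨a, ha, ha0⟩ := ih
      obtain ⟨b, hb, hb0⟩ := hstep _ a (by linarith [mul_nonneg m.cast_nonneg hδ.le]) ha ha0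
      refine ⟨b, ?_, hb0⟩
      have : τ₀ + ((m + 1 : ℕ) : ℝ) * δ = τ₀ + m * δ + δ := by
        push_cast
        ring
      rwa [this]
  obtain ⟨m, hm⟩ := Archimedean.arch t₁ hδ
  rw [nsmul_eq_mul] at hm
  obtain ⟨a, ha, ha0⟩ := hall m
  exact hcon _ a (by linarith [mul_nonneg m.cast_nonneg hδ.le]) (by linarith) ha ha0

end Continuation

section MaxNorm

lemma norm_realPart_le (v : Cn n) : ‖realPart v‖ ≤ ‖v‖ := by
  rw [EuclideanSpace.norm_eq, EuclideanSpace.norm_eq]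
  refine Real.sqrt_le_sqrt (Finset.sum_le_sum fun k _ => ?_)
  exact pow_le_pow_left₀ (norm_nonneg _) (Complex.abs_re_le_norm (v k)) 2

lemma SmoothPeriodic.norm_le_maxNorm {f : Rn n → Rn n} (hf : SmoothPeriodic f) (x : Rn n) :
    ‖f x‖ ≤ maxNorm f := by
  obtain ⟨M, hM⟩ := hf.2.exists_bound hf.1.continuous
  exact le_ciSup (f := fun x => ‖f x‖) ⟨M, by rintro _ ⟨x, rfl⟩; exact hM x⟩ x

lemma SmoothPeriodic.maxNorm_pos {f : Rn n → Rn n} (hf : SmoothPeriodic f) (h0 : f ≠ 0) :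
    0 < maxNorm f := by
  obtain ⟨x, hx⟩ := Function.ne_iff.1 h0
  exact (norm_pos_iff.2 hx).trans_le (hf.norm_le_maxNorm x)

lemma sqrt_mul_le_of_le_div_sq {c R t : ℝ} (hc : 0 ≤ c) (hR : 0 < R) (ht : t ≤ c ^ 2 / R ^ 2) :
    √t * R ≤ c := by
  rw [← div_pow] at ht
  have h1 := Real.sqrt_le_sqrt ht
  rw [Real.sqrt_sq (by positivity)] at h1
  exact (le_div_iff₀ hR).1 h1

lemma rpow_half_eq_sqrt_pow {t : ℝ} (ht : 0 ≤ t) (j : ℕ) : t ^ ((j : ℝ) / 2) = √t ^ j := by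
  rw [Real.sqrt_eq_rpow, ← Real.rpow_natCast, ← Real.rpow_mul ht]
  congr 1
  ring

end MaxNorm

end PeriodicModel

end

open PeriodicModel in
theorem theorem1p2 (n : ℕ) (hn : 3 ≤ n) (g : QuadraticMap ℝ (Rn n) (Rn n)) (i : Fin n) :
    ∃ c₀ : ℝ, 0 < c₀ ∧
      (∀ f : Rn n → Rn n, SmoothPeriodic f → f ≠ 0 →
        ((c₀ / maxNorm f ^ 2 : ℝ) : EReal) < lifespan g i f ∧
        ∀ (T : EReal) (u : ℝ → Rn n → Rn n), IsSolution g i f T u →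
          ∀ t ∈ timeInterval T, t ≤ c₀ / maxNorm f ^ 2 →
            maxNorm (u t) ≤ 2 * maxNorm f) ∧
      (∀ j : ℕ, 1 ≤ j → ∃ K : ℝ, 0 < K ∧
        ∀ f : Rn n → Rn n, SmoothPeriodic f → f ≠ 0 →
          ∀ (T : EReal) (u : ℝ → Rn n → Rn n), IsSolution g i f T u →
            ∀ t ∈ timeInterval T, 0 < t → t ≤ c₀ / maxNorm f ^ 2 →
              t ^ ((j : ℝ) / 2) * derivMaxNorm j (u t) ≤ K * maxNorm f) := by
  have hc := smallness_pos (complexBilin g)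
  have hinit : ∀ {f : Rn n → Rn n}, SmoothPeriodic f → ∀ x,
      ‖synth (vecCoef f) x‖ ≤ maxNorm f := fun {f} hf x => by
    rw [hf.synth_vecCoef, norm_complexify]
    exact hf.norm_le_maxNorm x
  refine ⟨smallness (complexBilin g) ^ 2, by positivity, fun f hf hf0 => ⟨?_, ?_⟩, fun j _ => ?_⟩
  · have hR := hf.maxNorm_pos hf0
    obtain ⟨τ, a, hτ, hlt, ha, ha0⟩ := exists_isMild_lt (complexBilin_conjC g) i hf.rapid_vecCoef
      (vecCoef_neg f) hR (hinit hf) (sqrt_mul_le_of_le_div_sq hc.le hR le_rfl)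
    have hsol := ha.isSolution hτ (f := f) fun x => by rw [ha0, hf.synth_vecCoef]
    exact (EReal.coe_lt_coe_iff.2 hlt).trans_le (le_sSup ⟨_, hsol⟩)
  · intro T u hu t ht htle
    have hR := hf.maxNorm_pos hf0
    refine ciSup_le fun x => ?_
    rcases ht.1.eq_or_lt with rfl | ht0
    · rw [hu.initial]
      linarith [hf.norm_le_maxNorm x]
    · have h1 := (hu.isMild ht ht0).norm_synth_le hR (by rw [hu.initial]; exact hinit hf)
        ⟨ht.1, le_rfl⟩ (sqrt_mul_le_of_le_div_sq hc.le hR htle) x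
      rwa [(hu.smoothPeriodic ht).synth_vecCoef, norm_complexify] at h1
  · obtain ⟨K, hK, hKb⟩ := exists_weighted_bound (complexBilin g) i j
    refine ⟨K + 1, by linarith, fun f hf hf0 T u hu t ht ht0 htle => ?_⟩
    have hR := hf.maxNorm_pos hf0
    have hsm := hu.smoothPeriodic ht
    have hut : u t = fun x => realPart (synth (vecCoef (u t)) x) := by
      funext x
      rw [hsm.synth_vecCoef, realPart_complexify]
    have hpos : 0 < √t ^ j := pow_pos (Real.sqrt_pos.2 ht0) j
    have hle : derivMaxNorm j (u t) ≤ K * maxNorm f / √t ^ j := by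
      refine Real.iSup_le (fun α => Real.iSup_le (fun x => ?_) (by positivity)) (by positivity)
      obtain ⟨w, hw, hwD⟩ := exists_word_multiD α.1
      rw [hut, hwD _ hsm.rapid_vecCoef]
      refine (norm_realPart_le _).trans ?_
      rw [le_div_iff₀' hpos]
      exact hKb t _ (hu.isMild ht ht0) _ hR (by rw [hu.initial]; exact hinit hf) t ⟨ht0, le_rfl⟩
        (sqrt_mul_le_of_le_div_sq hc.le hR htle) w (hw.trans α.2) x
    rw [rpow_half_eq_sqrt_pow ht0.le]
    have h1 := mul_le_mul_of_nonneg_left hle hpos.le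
    rw [mul_div_cancel₀ _ hpos.ne'] at h1
    linarith
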